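/- Let $({\sf C},\otimes,K,c)$ be a symmetric monoidal category (associativity and unit isomorphisms are suppressed, and $P$ also denotes $id_P$), and let $H=(H,\eta_H,\mu_H,\varepsilon_H,\delta_H,\lambda_H)$ be a finite Hopf algebra in ${\sf C}$, i.e. there are an object $H^{\ast}$ and morphisms $a\colon K\to H^{\ast}\otimes H$, $b\colon H\otimes H^{\ast}\to K$ such that $(H^{\ast}\otimes b)\circ(a\otimes H^{\ast})=id_{H^{\ast}}$ and $(b\otimes H)\circ(H\otimes a)=id_{H}$. Then the antipode $\lambda_H$ is an isomorphism, and the pair $(D(H),T(H))$ is a Hopf brace in ${\sf C}$ if and only if $$(\mu_{H}\otimes H)\circ(H\otimes c_{H,H})\circ(J\otimes H)\circ\bigl(H\otimes((\varphi_{H}^{ad}\otimes H)\circ(H\otimes c_{H,H})\circ(\delta_{H}\otimes H))\bigr)=(\mu_{H}\otimes H)\circ(H\otimes J)\circ(c_{H,H}\otimes H),$$ where $$J=(H\otimes(\mu_{H}\circ(\lambda_{H}^{-1}\otimes H)))\circ(\delta_{H}\otimes H)\circ c_{H,H}\circ(\mu_{H}\otimes H)\circ(H\otimes\delta_{H}),\qquad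 \varphi_{H}^{ad}=\mu_{H}\circ(\mu_{H}\otimes\lambda_{H})\circ(H\otimes c_{H,H})\circ(\delta_{H}\otimes H).$$ Here the following notation is used. * $\widehat H=(H^{cop})^{\ast}$ is the Hopf algebra on $H^{\ast}$ with $\eta_{\widehat H}=(H^{\ast}\otimes\varepsilon_H)\circ a$, $\mu_{\widehat H}=(H^{\ast}\otimes b)\circ(H^{\ast}\otimes H\otimes b\otimes H^{\ast})\circ(((H^{\ast}\otimes(c_{H,H}\circ\delta_H))\circ a)\otimes H^{\ast}\otimes H^{\ast})$, $\varepsilon_{\widehat H}=b\circ(\eta_H\otimes H^{\ast})$, $\delta_{\widehat H}=(H^{\ast}\otimes H^{\ast}\otimes(b\circ(\mu_H\otimes H^{\ast})))\circ(((H^{\ast}\otimes a\otimes H)\circ a)\otimes H^{\ast})$ and $\lambda_{\widehat H}=(H^{\ast}\otimes b)\circ(H^{\ast}\otimes\lambda_H^{-1}\otimes H^{\ast})\circ(a\otimes H^{\ast})$. * $T(H)=\widehat H\otimes H$ is the tensor product Hopf algebra. * $D(H)=\widehat H\bowtie H$ is the Drinfeld double: it has the unit, counit and coproduct of $\widehat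 H\otimes H$, the product $(\mu_{\widehat H}\otimes\mu_H)\circ(H^{\ast}\otimes\Psi\otimes H)$ and the antipode $\Psi\circ(\lambda_H\otimes\lambda_{\widehat H})\circ c_{H^{\ast},H}$, where $\Psi=(\varphi\otimes\phi)\circ(H\otimes c_{H,H^{\ast}}\otimes H^{\ast})\circ(\delta_H\otimes\delta_{\widehat H})$, $\varphi=(H^{\ast}\otimes b)\circ(H^{\ast}\otimes R\otimes H^{\ast})\circ(a\otimes H\otimes H^{\ast})$, $\phi=(H\otimes b)\circ(\overline R\otimes H^{\ast})$, $R=\mu_H\circ c_{H,H}\circ(\mu_H\otimes\lambda_H^{-1})\circ(H\otimes\delta_H)$ and $\overline R=(H\otimes(\mu_H\circ(\lambda_H^{-1}\otimes H)))\circ(\delta_H\otimes H)\circ c_{H,H}\circ\delta_H$. * A pair $(X_1,X_2)$ with $X_i=(X,\eta^i,\mu^i,\varepsilon,\delta,\lambda^i)$, having the same counit $\varepsilon$ and coproduct $\delta$, is a Hopf brace if $X_1$ and $X_2$ are Hopf algebras in ${\sf C}$ and $\mu^2\circ(X\otimes\mu^1)=\mu^1\circ(\mu^2\otimes\Gamma)\circ(X\otimes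 c_{X,X}\otimes X)\circ(\delta\otimes X\otimes X)$, where $\Gamma=\mu^1\circ(\lambda^1\otimes\mu^2)\circ(\delta\otimes X)$. -/

import Mathlib

open CategoryTheory MonoidalCategory
open scoped MonObj ComonObj HopfObj

universe v u

noncomputable section

/-- The six-tuples `(X, η, μ, ε, δ, lam)` of which Hopf algebras in a monoidal category are made,
without any axiom. -/
@[ext]
structure HopfTuple {C : Type u} [Category.{v} C] [MonoidalCategory C] (X : C) where
  one : 𝟙_ C ⟶ X
  mul : X ⊗ X ⟶ X
  counit : X ⟶ 𝟙_ C
  comul : X ⟶ X ⊗ X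
  antipode : X ⟶ X

namespace HopfTuple

variable {C : Type u} [Category.{v} C] [MonoidalCategory C] [SymmetricCategory C]

/-- The structure morphisms of a Hopf algebra in `C`. -/
def of (X : C) [HopfObj X] : HopfTuple X where
  one := η[X]
  mul := μ[X]
  counit := ε[X]
  comul := Δ[X]
  antipode := 𝒮[X]

/-- The six-tuple `A` is a Hopf algebra in `C`. -/
def IsHopf {X : C} (A : HopfTuple X) : Prop :=
  ∃ _ : HopfObj X, of X = A

/-- `Γ = μ¹ ∘ (lam¹ ⊗ μ²) ∘ (δ ⊗ X)`. -/
def gamma {X : C} (A₁ A₂ : HopfTuple X) : X ⊗ X ⟶ X :=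
  A₁.comul ▷ X ⊗≫ (A₁.antipode ⊗ₘ A₂.mul) ≫ A₁.mul

/-- The pair `(A₁, A₂)` is a Hopf brace: two Hopf algebra structures with the same underlying
coalgebra such that
`μ² ∘ (X ⊗ μ¹) = μ¹ ∘ (μ² ⊗ Γ) ∘ (X ⊗ c ⊗ X) ∘ (δ ⊗ X ⊗ X)`. -/
structure IsHopfBrace {X : C} (A₁ A₂ : HopfTuple X) : Prop where
  isHopf₁ : A₁.IsHopf
  isHopf₂ : A₂.IsHopf
  counit_eq : A₁.counit = A₂.counit
  comul_eq : A₁.comul = A₂.comul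
  compat :
    X ◁ A₁.mul ≫ A₂.mul =
      A₁.comul ▷ (X ⊗ X) ⊗≫ X ◁ (β_ X X).hom ▷ X ⊗≫ (A₂.mul ⊗ₘ gamma A₁ A₂) ≫ A₁.mul

/-- `Ψ = (φ ⊗ ψ) ∘ (Y ⊗ c_{Y,X} ⊗ X) ∘ (δ_Y ⊗ δ_X)` for a left action `φ : Y ⊗ X ⟶ X` and a right
action `ψ : Y ⊗ X ⟶ Y`. -/
def crossing {X Y : C} (A : HopfTuple X) (B : HopfTuple Y) (φ : Y ⊗ X ⟶ X) (ψ : Y ⊗ X ⟶ Y) :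
    Y ⊗ X ⟶ X ⊗ Y :=
  (B.comul ⊗ₘ A.comul) ⊗≫ Y ◁ (β_ Y X).hom ▷ X ⊗≫ (φ ⊗ₘ ψ)

/-- The tensor product `A ⊗ B`. -/
def tensor {X Y : C} (A : HopfTuple X) (B : HopfTuple Y) : HopfTuple (X ⊗ Y) where
  one := 𝟙 (𝟙_ C) ⊗≫ (A.one ⊗ₘ B.one)
  mul := 𝟙 ((X ⊗ Y) ⊗ (X ⊗ Y)) ⊗≫ X ◁ (β_ Y X).hom ▷ Y ⊗≫ (A.mul ⊗ₘ B.mul)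
  counit := (A.counit ⊗ₘ B.counit) ⊗≫ 𝟙 (𝟙_ C)
  comul := (A.comul ⊗ₘ B.comul) ⊗≫ X ◁ (β_ X Y).hom ▷ Y ⊗≫ 𝟙 ((X ⊗ Y) ⊗ (X ⊗ Y))
  antipode := A.antipode ⊗ₘ B.antipode

/-- The bicrossed product `A ⋈ B` of `A` and `B` along the actions `φ` and `ψ`: the unit, counit
and coproduct are those of `A ⊗ B`, the product is `(μ_A ⊗ μ_B) ∘ (X ⊗ Ψ ⊗ Y)` and the antipode is
`Ψ ∘ (lam_B ⊗ lam_A) ∘ c_{X,Y}`. -/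
def bicrossed {X Y : C} (A : HopfTuple X) (B : HopfTuple Y) (φ : Y ⊗ X ⟶ X) (ψ : Y ⊗ X ⟶ Y) :
    HopfTuple (X ⊗ Y) where
  one := (tensor A B).one
  mul := 𝟙 ((X ⊗ Y) ⊗ (X ⊗ Y)) ⊗≫ X ◁ crossing A B φ ψ ▷ Y ⊗≫ (A.mul ⊗ₘ B.mul)
  counit := (tensor A B).counit
  comul := (tensor A B).comul
  antipode := (β_ X Y).hom ≫ (B.antipode ⊗ₘ A.antipode) ≫ crossing A B φ ψ

end HopfTuple

namespace DrinfeldDouble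

variable {C : Type u} [Category.{v} C] [MonoidalCategory C] [SymmetricCategory C]
variable (H Hd : C) [HopfObj H]

/-- The adjoint action `μ ∘ (μ ⊗ lam) ∘ (H ⊗ c) ∘ (δ ⊗ H)` of `H` on itself. -/
def adjointAction : H ⊗ H ⟶ H :=
  Δ[H] ▷ H ⊗≫ H ◁ (β_ H H).hom ⊗≫ (μ[H] ⊗ₘ 𝒮[H]) ≫ μ[H]

section

variable [IsIso 𝒮[H]]

/-- `R = μ ∘ c ∘ (μ ⊗ lam⁻¹) ∘ (H ⊗ δ)`. -/
def R : H ⊗ H ⟶ H :=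
  H ◁ Δ[H] ⊗≫ (μ[H] ⊗ₘ inv 𝒮[H]) ≫ (β_ H H).hom ≫ μ[H]

/-- `R̄ = (H ⊗ (μ ∘ (lam⁻¹ ⊗ H))) ∘ (δ ⊗ H) ∘ c ∘ δ`. -/
def Rbar : H ⟶ H ⊗ H :=
  Δ[H] ≫ (β_ H H).hom ≫ Δ[H] ▷ H ⊗≫ H ◁ (inv 𝒮[H] ▷ H ≫ μ[H])

/-- `J = (H ⊗ (μ ∘ (lam⁻¹ ⊗ H))) ∘ (δ ⊗ H) ∘ c ∘ (μ ⊗ H) ∘ (H ⊗ δ)`. -/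
def J : H ⊗ H ⟶ H ⊗ H :=
  H ◁ Δ[H] ⊗≫ μ[H] ▷ H ≫ (β_ H H).hom ≫ Δ[H] ▷ H ⊗≫ H ◁ (inv 𝒮[H] ▷ H ≫ μ[H])

variable [ExactPairing Hd H]

/-- The Hopf algebra `Ĥ = (H^cop)^*` on the dual `Hd` of `H`, where `η_ Hd H : 𝟙_ C ⟶ Hd ⊗ H` is
the unit and `ε_ Hd H : H ⊗ Hd ⟶ 𝟙_ C` the counit of the duality. -/
def dualCop : HopfTuple Hd where
  one := η_ Hd H ⊗≫ Hd ◁ ε[H] ⊗≫ 𝟙 Hd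
  mul := 𝟙 (Hd ⊗ Hd) ⊗≫ (η_ Hd H ≫ Hd ◁ (Δ[H] ≫ (β_ H H).hom)) ▷ (Hd ⊗ Hd) ⊗≫
    (Hd ⊗ H) ◁ (ε_ Hd H) ▷ Hd ⊗≫ Hd ◁ ε_ Hd H ⊗≫ 𝟙 Hd
  counit := 𝟙 Hd ⊗≫ η[H] ▷ Hd ⊗≫ ε_ Hd H
  comul := 𝟙 Hd ⊗≫ η_ Hd H ▷ Hd ⊗≫ Hd ◁ (η_ Hd H) ▷ (H ⊗ Hd) ⊗≫
    (Hd ⊗ Hd) ◁ (μ[H] ▷ Hd ≫ ε_ Hd H) ⊗≫ 𝟙 (Hd ⊗ Hd)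
  antipode := 𝟙 Hd ⊗≫ η_ Hd H ▷ Hd ⊗≫ Hd ◁ (inv 𝒮[H]) ▷ Hd ⊗≫ Hd ◁ ε_ Hd H ⊗≫ 𝟙 Hd

/-- The left action `(Hd ⊗ b) ∘ (Hd ⊗ R ⊗ Hd) ∘ (a ⊗ H ⊗ Hd)` of `H` on `Ĥ`. -/
def leftAction : H ⊗ Hd ⟶ Hd :=
  𝟙 (H ⊗ Hd) ⊗≫ η_ Hd H ▷ (H ⊗ Hd) ⊗≫ Hd ◁ R H ▷ Hd ⊗≫ Hd ◁ ε_ Hd H ⊗≫ 𝟙 Hd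

/-- The right action `(H ⊗ b) ∘ (R̄ ⊗ Hd)` of `Ĥ` on `H`. -/
def rightAction : H ⊗ Hd ⟶ H :=
  Rbar H ▷ Hd ⊗≫ H ◁ ε_ Hd H ⊗≫ 𝟙 H

/-- The tensor product Hopf algebra `T(H) = Ĥ ⊗ H`. -/
def T : HopfTuple (Hd ⊗ H) :=
  (dualCop H Hd).tensor (HopfTuple.of H)

/-- The Drinfeld double `D(H) = Ĥ ⋈ H`. -/
def D : HopfTuple (Hd ⊗ H) :=
  (dualCop H Hd).bicrossed (HopfTuple.of H) (leftAction H Hd) (rightAction H Hd)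

end

end DrinfeldDouble

end

/-! Write `b` for the evaluation `ε_ Hd H`, `S` for the antipode, and use Sweedler notation as
shorthand for the diagrams.

Invertibility of `S`. The dual `Hd` is a right Hopf module over `H`, with action `(f·h)(x) = f(x
S(h))` and coaction characterised by `f₀(x) f₁ = x₁ f(x₂)`. For any Hopf module, `P(m) = m₀·S(m₁)`
projects onto coinvariants, and applying the coaction and then `P` to `P(m)·h` returns `P(m) ⊗ h`.
On `Hd` the action sees `h` only through `S(h)`, so `P(f) ⊗ h` is recovered from `P(f) ⊗ S(h)`.
Closing the `Hd` strand after inserting the transpose of `S` multiplies by a trace that equals `1`,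
which leaves a retraction of `S`. The same statement for the dual Hopf algebra, transposed back,
gives a section (`isIso_antipode`).

The double. The pairing `b` of `H` with `Ĥ` is convolution invertible, with inverse `b ∘ (S⁻¹ ⊗ Ĥ)`.
The crossing is conjugation by `b` followed by the symmetry: `Ψ(k ⊗ p) = b(k₁, p₁) p₂ ⊗ k₂ b(S⁻¹ k₃,
p₃)`. Conjugation by an invertible functional is a comonoid morphism, and conjugation by a
convolution product is a composite of conjugations; since `b` is multiplicative in each variable,
`Ψ` is a distributive law (`IsHopfPairing.isDistributiveLaw`). Hence `D(H)` is a Hopf algebra, while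
`T(H)` is the case where the crossing is the symmetry. A comonoid morphism into a tensor product is
determined by its components, so `Ψ` is the crossing built from the two given actions
(`crossing_eq`).

The brace equation. On `q ⊗ h`, `a ⊗ k`, `p ⊗ l` its sides are `q a F(h ⊗ k ⊗ p) l`, with `F = h ∘
Ψ(k ⊗ p)` on the left, where `∘` is the product of `T(H)`, and `F = Ψ(h₁ k S(h₂) ⊗ p) h₃` on the
right. Inserting units recovers `F`, so only the two values of `F` have to be compared. Pairing the
`Hd` leg of `Ψ(k ⊗ p)` with `x` gives `k₂ b(S⁻¹(k₃) x k₁, p)`, that is, `J(x ⊗ k)` with its second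
leg paired with `p`. As `b` is nondegenerate, the equality of the two `F` is exactly the identity
for `J`. -/

noncomputable section

namespace CategoryTheory

/-! ### Transposition along exact pairings -/

section Mate

variable {C : Type u} [Category.{v} C] [MonoidalCategory C]

/-- Morphisms into `X' ⊗ W` are determined by their pairing with `X`. -/
theorem ExactPairing.hom_ext_tensor {X X' Z W : C} [ExactPairing X' X] {f g : Z ⟶ X' ⊗ W}
    (h : X ◁ f ≫ (α_ _ _ _).inv ≫ ε_ X' X ▷ W = X ◁ g ≫ (α_ _ _ _).inv ≫ ε_ X' X ▷ W) :
    f = g := by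
  have key : ∀ k : Z ⟶ X' ⊗ W, k = 𝟙 _ ⊗≫ η_ X' X ▷ Z ⊗≫
      X' ◁ (X ◁ k ≫ (α_ _ _ _).inv ≫ ε_ X' X ▷ W) ⊗≫ 𝟙 _ := fun k => by
    symm
    calc _ = 𝟙 _ ⊗≫ (η_ X' X ▷ Z ≫ (X' ⊗ X) ◁ k) ⊗≫ X' ◁ ε_ X' X ▷ W ⊗≫ 𝟙 _ := by monoidal
      _ = k ⊗≫ (η_ X' X ▷ X' ⊗≫ X' ◁ ε_ X' X) ▷ W ⊗≫ 𝟙 _ := by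
        rw [← whisker_exchange]; monoidal
      _ = k := by rw [ExactPairing.evaluation_coevaluation'']; monoidal
  rw [key f, key g, h]

theorem ExactPairing.hom_ext {X X' Z : C} [ExactPairing X' X] {f g : Z ⟶ X'}
    (h : X ◁ f ≫ ε_ X' X = X ◁ g ≫ ε_ X' X) : f = g := by
  rw [← cancel_mono (ρ_ X').inv]
  apply ExactPairing.hom_ext_tensor (X := X)
  have e : ∀ k : Z ⟶ X', X ◁ (k ≫ (ρ_ X').inv) ≫ (α_ _ _ _).inv ≫ ε_ X' X ▷ 𝟙_ C =
    (X ◁ k ≫ ε_ X' X) ≫ (ρ_ _).inv := fun k => by monoidal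
  rw [e, e, h]

/-- Morphisms out of `W ⊗ X` are determined by their pairing with `X'`. -/
theorem ExactPairing.hom_ext_right {X X' Z W : C} [ExactPairing X' X] {f g : Z ⟶ W ⊗ X}
    (h : f ▷ X' ≫ (α_ _ _ _).hom ≫ W ◁ ε_ X' X = g ▷ X' ≫ (α_ _ _ _).hom ≫ W ◁ ε_ X' X) :
    f = g := by
  have key : ∀ k : Z ⟶ W ⊗ X, k = 𝟙 _ ⊗≫ Z ◁ η_ X' X ⊗≫
      (k ▷ X' ≫ (α_ _ _ _).hom ≫ W ◁ ε_ X' X) ▷ X ⊗≫ 𝟙 _ := fun k => by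
    symm
    calc _ = 𝟙 _ ⊗≫ (Z ◁ η_ X' X ≫ k ▷ (X' ⊗ X)) ⊗≫ W ◁ ε_ X' X ▷ X ⊗≫ 𝟙 _ := by monoidal
      _ = k ⊗≫ W ◁ (X ◁ η_ X' X ⊗≫ ε_ X' X ▷ X) ⊗≫ 𝟙 _ := by
        rw [whisker_exchange]; monoidal
      _ = k := by rw [ExactPairing.coevaluation_evaluation'']; monoidal
  rw [key f, key g, h]

/-- The transpose `Y' ⟶ X'` of `f : X ⟶ Y`. -/
def mate {X Y : C} (X' Y' : C) [ExactPairing X' X] [ExactPairing Y' Y] (f : X ⟶ Y) : Y' ⟶ X' :=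
  (λ_ Y').inv ≫ η_ X' X ▷ Y' ≫ (α_ _ _ _).hom ≫ X' ◁ (f ▷ Y' ≫ ε_ Y' Y) ≫ (ρ_ X').hom

section

variable {X Y Z X' Y' Z' : C} [ExactPairing X' X] [ExactPairing Y' Y] [ExactPairing Z' Z]

theorem mate_evaluation (f : X ⟶ Y) :
    X ◁ mate X' Y' f ≫ ε_ X' X = f ▷ Y' ≫ ε_ Y' Y := by
  calc _ = 𝟙 _ ⊗≫ X ◁ η_ X' X ▷ Y' ⊗≫ ((X ⊗ X') ◁ (f ▷ Y' ≫ ε_ Y' Y) ≫ ε_ X' X ▷ _) ⊗≫ 𝟙 _ := by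
        rw [mate]; monoidal
    _ = 𝟙 _ ⊗≫ (X ◁ η_ X' X ⊗≫ ε_ X' X ▷ X) ▷ Y' ⊗≫ (f ▷ Y' ≫ ε_ Y' Y) ⊗≫ 𝟙 _ := by
      rw [whisker_exchange]; monoidal
    _ = _ := by rw [ExactPairing.coevaluation_evaluation'']; monoidal

theorem eq_mate {f : X ⟶ Y} {g : Y' ⟶ X'} (h : X ◁ g ≫ ε_ X' X = f ▷ Y' ≫ ε_ Y' Y) :
    g = mate X' Y' f :=
  ExactPairing.hom_ext (h.trans (mate_evaluation f).symm)

theorem mate_id : mate X' X' (𝟙 X) = 𝟙 X' := (eq_mate (by simp)).symm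

theorem mate_comp (f : X ⟶ Y) (g : Y ⟶ Z) :
    mate X' Z' (f ≫ g) = mate Y' Z' g ≫ mate X' Y' f := by
  refine (eq_mate ?_).symm
  rw [MonoidalCategory.whiskerLeft_comp, Category.assoc, mate_evaluation, whisker_exchange_assoc,
    mate_evaluation, comp_whiskerRight, Category.assoc]

theorem mate_injective {f g : X ⟶ Y} (h : mate X' Y' f = mate X' Y' g) : f = g := by
  rw [← cancel_mono (λ_ _).inv]
  apply ExactPairing.hom_ext_right (X' := Y')
  have e : ∀ k : X ⟶ Y, (k ≫ (λ_ _).inv) ▷ Y' ≫ (α_ _ _ _).hom ≫ 𝟙_ C ◁ ε_ Y' Y =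
    (k ▷ Y' ≫ ε_ Y' Y) ≫ (λ_ _).inv := fun k => by monoidal
  rw [e, e, ← mate_evaluation (X' := X'), h, mate_evaluation]

theorem mate_surjective (g : Y' ⟶ X') : ∃ f : X ⟶ Y, mate X' Y' f = g := by
  refine ⟨(ρ_ X).inv ≫ X ◁ η_ Y' Y ≫ (α_ _ _ _).inv ≫ (X ◁ g ≫ ε_ X' X) ▷ Y ≫ (λ_ Y).hom, ?_⟩
  refine (eq_mate ?_).symm
  symm
  calc _ = 𝟙 _ ⊗≫ X ◁ η_ Y' Y ▷ Y' ⊗≫ ((X ◁ g ≫ ε_ X' X) ▷ (Y ⊗ Y') ≫ _ ◁ ε_ Y' Y) ⊗≫ 𝟙 _ := by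
        monoidal
    _ = 𝟙 _ ⊗≫ X ◁ (η_ Y' Y ▷ Y' ⊗≫ Y' ◁ ε_ Y' Y) ⊗≫ (X ◁ g ≫ ε_ X' X) ⊗≫ 𝟙 _ := by
      rw [← whisker_exchange]; monoidal
    _ = _ := by rw [ExactPairing.evaluation_coevaluation'']; monoidal

theorem tensor_evaluation_eq :
    ε_ (X' ⊗ Y') (Y ⊗ X) = 𝟙 _ ⊗≫ Y ◁ ε_ X' X ▷ Y' ⊗≫ ε_ Y' Y := by
  rw [ExactPairing.tensor_evaluation]

theorem mate_whiskerLeft (f : X ⟶ Y) :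
    mate (X' ⊗ Z') (Y' ⊗ Z') (Z ◁ f) = mate X' Y' f ▷ Z' := by
  refine (eq_mate ?_).symm
  rw [tensor_evaluation_eq, tensor_evaluation_eq]
  calc _ = 𝟙 _ ⊗≫ Z ◁ (X ◁ mate X' Y' f ≫ ε_ X' X) ▷ Z' ⊗≫ ε_ Z' Z := by monoidal
    _ = _ := by rw [mate_evaluation]; monoidal

theorem mate_whiskerRight (f : X ⟶ Y) :
    mate (Z' ⊗ X') (Z' ⊗ Y') (f ▷ Z) = Z' ◁ mate X' Y' f := by
  refine (eq_mate ?_).symm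
  rw [tensor_evaluation_eq, tensor_evaluation_eq]
  calc _ = 𝟙 _ ⊗≫ X ◁ ((Z ⊗ Z') ◁ mate X' Y' f ≫ ε_ Z' Z ▷ X') ⊗≫ ε_ X' X := by monoidal
    _ = 𝟙 _ ⊗≫ X ◁ (ε_ Z' Z ▷ Y') ⊗≫ (X ◁ mate X' Y' f ≫ ε_ X' X) := by
      rw [whisker_exchange]; monoidal
    _ = 𝟙 _ ⊗≫ (X ◁ ε_ Z' Z ≫ f ▷ _) ▷ Y' ⊗≫ ε_ Y' Y := by
      rw [mate_evaluation]
      calc _ = 𝟙 _ ⊗≫ (X ◁ ε_ Z' Z ≫ f ▷ (𝟙_ C)) ▷ Y' ⊗≫ ε_ Y' Y := by monoidal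
        _ = _ := by monoidal
    _ = _ := by rw [whisker_exchange]; monoidal

theorem mate_tensorHom {X₂ Y₂ X₂' Y₂' : C} [ExactPairing X₂' X₂] [ExactPairing Y₂' Y₂]
    (f : X ⟶ Y) (g : X₂ ⟶ Y₂) :
    mate (X₂' ⊗ X') (Y₂' ⊗ Y') (f ⊗ₘ g) = mate X₂' Y₂' g ⊗ₘ mate X' Y' f := by
  rw [tensorHom_def', mate_comp (Y' := Y₂' ⊗ X'), mate_whiskerLeft, mate_whiskerRight, tensorHom_def']

theorem mate_associator_hom :
    mate (Z' ⊗ (Y' ⊗ X')) ((Z' ⊗ Y') ⊗ X') (α_ X Y Z).hom = (α_ Z' Y' X').hom := by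
  refine (eq_mate ?_).symm
  simp only [tensor_evaluation_eq]
  monoidal

theorem mate_associator_inv :
    mate ((Z' ⊗ Y') ⊗ X') (Z' ⊗ (Y' ⊗ X')) (α_ X Y Z).inv = (α_ Z' Y' X').inv := by
  refine (eq_mate ?_).symm
  simp only [tensor_evaluation_eq]
  monoidal

theorem evaluation_unit : ε_ (𝟙_ C) (𝟙_ C) = (ρ_ (𝟙_ C)).hom := rfl

theorem mate_leftUnitor_inv :
    mate X' (X' ⊗ 𝟙_ C) (λ_ X).inv = (ρ_ X').hom := by
  refine (eq_mate ?_).symm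
  rw [tensor_evaluation_eq, evaluation_unit]
  monoidal

theorem mate_rightUnitor_inv :
    mate X' (𝟙_ C ⊗ X') (ρ_ X).inv = (λ_ X').hom := by
  refine (eq_mate ?_).symm
  rw [tensor_evaluation_eq, evaluation_unit]
  monoidal

theorem mate_leftUnitor_hom :
    mate (X' ⊗ 𝟙_ C) X' (λ_ X).hom = (ρ_ X').inv := by
  refine (eq_mate ?_).symm
  rw [tensor_evaluation_eq, evaluation_unit]
  monoidal

theorem mate_rightUnitor_hom :
    mate (𝟙_ C ⊗ X') X' (ρ_ X).hom = (λ_ X').inv := by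
  refine (eq_mate ?_).symm
  rw [tensor_evaluation_eq, evaluation_unit]
  monoidal

end
end Mate

/-! ### Transposes of symmetries. -/

section Symmetric

variable {C : Type u} [Category.{v} C] [MonoidalCategory C] [SymmetricCategory C]
variable {X Y Z X' Y' Z' : C} [ExactPairing X' X] [ExactPairing Y' Y] [ExactPairing Z' Z]

/-- A strand crosses a morphism with two inputs. -/
theorem whiskerLeft_braiding_comp {A B D X : C} (f : A ⊗ B ⟶ D) :
    A ◁ (β_ X B).hom ⊗≫ f ▷ X =
      𝟙 (A ⊗ X ⊗ B) ⊗≫ (β_ A X).hom ▷ B ⊗≫ X ◁ f ⊗≫ (β_ X D).hom := by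
  symm
  calc _ = 𝟙 _ ⊗≫ (β_ A X).hom ▷ B ⊗≫ (X ◁ f ≫ (β_ X D).hom) := by monoidal
    _ = 𝟙 _ ⊗≫ ((β_ A X).hom ≫ (β_ X A).hom) ▷ B ⊗≫ A ◁ (β_ X B).hom ⊗≫ f ▷ X := by
      rw [BraidedCategory.braiding_naturality_right, BraidedCategory.braiding_tensor_right_hom]
      monoidal
    _ = _ := by rw [SymmetricCategory.symmetry]; monoidal

theorem whiskerLeft_braiding_pairing {A B X : C} (f : A ⊗ B ⟶ 𝟙_ C) :
    A ◁ (β_ X B).hom ⊗≫ f ▷ X ⊗≫ 𝟙 X =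
      𝟙 (A ⊗ X ⊗ B) ⊗≫ (β_ A X).hom ▷ B ⊗≫ X ◁ f ⊗≫ 𝟙 X := by
  have := whiskerLeft_braiding_comp (X := X) f
  rw [braiding_tensorUnit_right] at this
  calc _ = (A ◁ (β_ X B).hom ⊗≫ f ▷ X) ⊗≫ 𝟙 X := by monoidal
    _ = _ := by rw [this]; monoidal

/-- Each of the two pairings is slid through a crossing by `whiskerLeft_braiding_pairing`. -/
theorem mate_braiding :
    mate (Y' ⊗ X') (X' ⊗ Y') (β_ X Y).hom = (β_ X' Y').hom := by
  refine (eq_mate ?_).symm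
  simp only [tensor_evaluation_eq]
  calc _ = 𝟙 _ ⊗≫ X ◁ (Y ◁ (β_ X' Y').hom ⊗≫ ε_ Y' Y ▷ X' ⊗≫ 𝟙 X') ⊗≫ ε_ X' X := by monoidal
    _ = 𝟙 _ ⊗≫ (X ◁ (β_ Y X').hom) ▷ Y' ⊗≫ ((X ⊗ X') ◁ ε_ Y' Y ≫ ε_ X' X ▷ _) ⊗≫ 𝟙 _ := by
      rw [whiskerLeft_braiding_pairing]; monoidal
    _ = 𝟙 _ ⊗≫ (X ◁ (β_ Y X').hom ⊗≫ ε_ X' X ▷ Y ⊗≫ 𝟙 Y) ▷ Y' ⊗≫ ε_ Y' Y := by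
      rw [whisker_exchange]; monoidal
    _ = _ := by rw [whiskerLeft_braiding_pairing]; monoidal

theorem mate_tensorμ {W W' : C} [ExactPairing W' W] :
    mate ((Z' ⊗ W') ⊗ (X' ⊗ Y')) ((Z' ⊗ X') ⊗ (W' ⊗ Y')) (tensorμ Y X W Z)
      = tensorμ Z' X' W' Y' := by
  simp only [tensorμ]
  rw [mate_comp (Y' := ((Z' ⊗ W') ⊗ X') ⊗ Y'), mate_comp (Y' := (Z' ⊗ (W' ⊗ X')) ⊗ Y'),
    mate_comp (Y' := (Z' ⊗ (X' ⊗ W')) ⊗ Y'), mate_comp (Y' := ((Z' ⊗ X') ⊗ W') ⊗ Y'),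
    mate_associator_hom, mate_associator_inv, mate_whiskerLeft, mate_whiskerLeft, mate_whiskerLeft,
    mate_whiskerRight, mate_associator_hom, mate_associator_inv, mate_braiding]
  monoidal

end Symmetric
-- Dual and co-opposite Hopf algebras.
variable {C : Type u} [Category.{v} C] [MonoidalCategory C] [SymmetricCategory C]

/-- The Hopf algebra on the dual `Hd` of `H` whose operations are the transposes of those of `H`. -/
@[reducible]
def dualHopfObj (H Hd : C) [HopfObj H] [ExactPairing Hd H] : HopfObj Hd where
  one := mate Hd (𝟙_ C) ε[H]
  mul := mate Hd (Hd ⊗ Hd) Δ[H]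
  counit := mate (𝟙_ C) Hd η[H]
  comul := mate (Hd ⊗ Hd) Hd μ[H]
  antipode := mate Hd Hd 𝒮[H]
  -- Pairings of tensor products are nested, so transposition reverses tensor factors: a left axiom
  -- of `Hd` comes from the right axiom for the dual operation of `H`, and conversely.
  one_mul := by
    rw [← mate_whiskerLeft (Z := H), ← mate_comp, ComonObj.comul_counit, mate_rightUnitor_inv]
  mul_one := by
    rw [← mate_whiskerRight (Z := H), ← mate_comp, ComonObj.counit_comul, mate_leftUnitor_inv]
  mul_assoc := by
    rw [← mate_whiskerLeft (Z := H), ← mate_whiskerRight (Z := H), ← mate_comp, ← mate_comp,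
      ← mate_associator_hom (X := H) (Y := H) (Z := H),
      ← mate_comp, ComonObj.comul_assoc, Category.assoc]
  counit_comul := by
    rw [← mate_whiskerLeft (Z := H), ← mate_comp, MonObj.mul_one, mate_rightUnitor_hom]
  comul_counit := by
    rw [← mate_whiskerRight (Z := H), ← mate_comp, MonObj.one_mul, mate_leftUnitor_hom]
  comul_assoc := by
    rw [← mate_whiskerLeft (Z := H), ← mate_whiskerRight (Z := H), ← mate_comp,
      ← mate_associator_hom (X := H) (Y := H) (Z := H), ← mate_comp,
      ← mate_comp, MonObj.mul_assoc, Category.assoc]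
  mul_comul := by
    rw [← mate_tensorHom, ← mate_tensorHom, ← mate_tensorμ (X := H) (Y := H) (Z := H) (W := H),
      ← mate_comp, ← mate_comp,
      ← mate_comp, BimonObj.mul_comul, Category.assoc]
  one_comul := by
    rw [← mate_comp, BimonObj.mul_counit]
    change mate (Hd ⊗ Hd) (𝟙_ C) ((ε[H] ⊗ₘ ε[H]) ≫ (λ_ _).hom) = (λ_ (𝟙_ C)).inv ≫
      (mate Hd (𝟙_ C) ε[H] ⊗ₘ mate Hd (𝟙_ C) ε[H])
    rw [mate_comp (Y' := 𝟙_ C ⊗ 𝟙_ C), mate_leftUnitor_hom, mate_tensorHom, unitors_inv_equal]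
  mul_counit := by
    rw [← mate_comp, BimonObj.one_comul]
    change mate (𝟙_ C) (Hd ⊗ Hd) ((λ_ _).inv ≫ (η[H] ⊗ₘ η[H])) =
      (mate (𝟙_ C) Hd η[H] ⊗ₘ mate (𝟙_ C) Hd η[H]) ≫ (λ_ (𝟙_ C)).hom
    rw [mate_comp (Y' := 𝟙_ C ⊗ 𝟙_ C), mate_leftUnitor_inv, mate_tensorHom, unitors_equal]
  one_counit := by
    rw [← mate_comp, BimonObj.one_counit, mate_id]
  antipode_left := by
    rw [← mate_whiskerLeft (Z := H), ← mate_comp, ← mate_comp, ← mate_comp, Category.assoc,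
      HopfObj.antipode_right]
  antipode_right := by
    rw [← mate_whiskerRight (Z := H), ← mate_comp, ← mate_comp, ← mate_comp, Category.assoc,
      HopfObj.antipode_left]

/-- In elements, `S⁻¹(h₂) h₁ = ε(h) 1`: the antihomomorphism `S` carries it to `S(h₁) h₂ = ε(h) 1`.
-/
theorem braiding_antipode_cop (H : C) [HopfObj H] [IsIso 𝒮[H]] :
    Δ[H] ≫ (β_ H H).hom ≫ inv 𝒮[H] ▷ H ≫ μ[H] = ε[H] ≫ η[H] := by
  rw [← cancel_mono 𝒮[H]]
  simp only [Category.assoc, HopfObj.one_antipode, HopfObj.mul_antipode]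
  calc _ = Δ[H] ≫ (β_ H H).hom ≫ (𝟙 H ⊗ₘ 𝒮[H]) ≫ (β_ H H).hom ≫ μ[H] := by
        rw [← tensorHom_id, tensorHom_comp_tensorHom_assoc]; simp
    _ = _ := by
      rw [BraidedCategory.braiding_naturality_assoc, SymmetricCategory.symmetry_assoc,
        tensorHom_id, HopfObj.antipode_left]

theorem braiding_antipode_cop' (H : C) [HopfObj H] [IsIso 𝒮[H]] :
    Δ[H] ≫ (β_ H H).hom ≫ H ◁ inv 𝒮[H] ≫ μ[H] = ε[H] ≫ η[H] := by
  rw [← cancel_mono 𝒮[H]]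
  simp only [Category.assoc, HopfObj.one_antipode, HopfObj.mul_antipode]
  calc _ = Δ[H] ≫ (β_ H H).hom ≫ (𝒮[H] ⊗ₘ 𝟙 H) ≫ (β_ H H).hom ≫ μ[H] := by
        rw [← id_tensorHom, tensorHom_comp_tensorHom_assoc]; simp
    _ = _ := by
      rw [BraidedCategory.braiding_naturality_assoc, SymmetricCategory.symmetry_assoc,
        id_tensorHom, HopfObj.antipode_right]

/-- The opposite comonoid. -/
@[reducible]
def copComonObj (H : C) [ComonObj H] : ComonObj H where
  counit := ε[H]
  comul := Δ[H] ≫ (β_ H H).hom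
  counit_comul := by
    rw [Category.assoc, ← BraidedCategory.braiding_naturality_right, ComonObj.comul_counit_assoc,
      braiding_tensorUnit_right, Iso.inv_hom_id_assoc]
  comul_counit := by
    rw [Category.assoc, ← BraidedCategory.braiding_naturality_left, ComonObj.counit_comul_assoc,
      braiding_tensorUnit_left, Iso.inv_hom_id_assoc]
  comul_assoc := by
    simp only [Category.assoc, MonoidalCategory.whiskerLeft_comp, comp_whiskerRight]
    rw [← BraidedCategory.braiding_naturality_left_assoc,
      ← BraidedCategory.braiding_naturality_right_assoc, ComonObj.comul_assoc_assoc]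
    simp only [BraidedCategory.braiding_tensor_left_hom, BraidedCategory.braiding_tensor_right_hom]
    simp only [Category.assoc, Iso.hom_inv_id_assoc]
    rw [← BraidedCategory.yang_baxter, Iso.hom_inv_id_assoc]

/-- The bimonoid with the opposite coproduct. -/
@[reducible]
def copBimonObj (H : C) [BimonObj H] : BimonObj H :=
  { toMonObj := inferInstance
    toComonObj := copComonObj H
    mul_comul := by
      change μ[H] ≫ Δ[H] ≫ (β_ H H).hom = ((Δ[H] ≫ (β_ H H).hom) ⊗ₘ (Δ[H] ≫ (β_ H H).hom)) ≫
        tensorμ H H H H ≫ (μ[H] ⊗ₘ μ[H])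
      rw [BimonObj.mul_comul_assoc, BraidedCategory.braiding_naturality,
        SymmetricCategory.tensorμ_braid_swap_assoc, tensorHom_comp_tensorHom_assoc]
    one_comul := by
      change η[H] ≫ Δ[H] ≫ (β_ H H).hom = (λ_ (𝟙_ C)).inv ≫ (η[H] ⊗ₘ η[H])
      rw [BimonObj.one_comul_assoc]
      change ((λ_ (𝟙_ C)).inv ≫ (η[H] ⊗ₘ η[H])) ≫ _ = _
      rw [Category.assoc, BraidedCategory.braiding_naturality, braiding_tensorUnit_left,
        ← unitors_inv_equal]
      simp
    mul_counit := BimonObj.mul_counit H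
    one_counit := BimonObj.one_counit H }

/-- The Hopf algebra with the opposite coproduct and the inverse antipode. -/
@[reducible]
def copHopfObj (H : C) [HopfObj H] [IsIso 𝒮[H]] : HopfObj H :=
  { toBimonObj := copBimonObj H
    antipode := inv 𝒮[H]
    antipode_left := by
      change (Δ[H] ≫ (β_ H H).hom) ≫ inv 𝒮[H] ▷ H ≫ μ[H] = ε[H] ≫ η[H]
      rw [Category.assoc, braiding_antipode_cop]
    antipode_right := by
      change (Δ[H] ≫ (β_ H H).hom) ≫ H ◁ inv 𝒮[H] ≫ μ[H] = ε[H] ≫ η[H]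
      rw [Category.assoc, braiding_antipode_cop'] }

end CategoryTheory

namespace DrinfeldDouble

variable {C : Type u} [Category.{v} C] [MonoidalCategory C] [SymmetricCategory C]

/-- Each formula defining `Ĥ` is the transpose of an operation of `H^cop`, so the Hopf axioms for
`Ĥ` need no separate verification. -/
theorem dualCop_eq (H Hd : C) [HopfObj H] [IsIso 𝒮[H]] [ExactPairing Hd H] :
    dualCop H Hd =
      letI := copHopfObj H
      letI := dualHopfObj H Hd
      HopfTuple.of Hd := by
  ext
  · change _ = mate Hd (𝟙_ C) ε[H]
    rw [mate, evaluation_unit, dualCop]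
    monoidal
  · change _ = mate Hd (Hd ⊗ Hd) (Δ[H] ≫ (β_ H H).hom)
    rw [mate, tensor_evaluation_eq, dualCop]
    monoidal
  · change _ = mate (𝟙_ C) Hd η[H]
    rw [mate, dualCop]
    change _ = (λ_ Hd).inv ≫ (ρ_ (𝟙_ C)).inv ▷ Hd ≫ _
    monoidal
  · change _ = mate (Hd ⊗ Hd) Hd μ[H]
    rw [mate, ExactPairing.tensor_coevaluation, dualCop]
    monoidal
  · change _ = mate Hd Hd (inv 𝒮[H])
    rw [mate, dualCop]
    monoidal

end DrinfeldDouble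

namespace CategoryTheory

/-! ### Hopf modules and the projection onto coinvariants. -/

section HopfModule

variable {C : Type u} [Category.{v} C] [MonoidalCategory C]

/-- `a` is a right action of the monoid `H` on `N`. -/
structure IsRightAction {H N : C} [MonObj H] (a : N ⊗ H ⟶ N) : Prop where
  assoc : a ▷ H ≫ a = (α_ N H H).hom ≫ N ◁ μ[H] ≫ a
  unit : N ◁ η[H] ≫ a = (ρ_ N).hom

/-- `r` is a right coaction of the comonoid `H` on `X`. -/
structure IsRightCoaction {H X : C} [ComonObj H] (r : X ⟶ X ⊗ H) : Prop where
  coassoc : r ≫ X ◁ Δ[H] = r ≫ r ▷ H ≫ (α_ X H H).hom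
  counit : r ≫ X ◁ ε[H] = (ρ_ X).inv

/-- The convolution of `φ : X ⟶ N` and `g : H ⟶ H` along a coaction and an action. -/
def actConv {H X N : C} (r : X ⟶ X ⊗ H) (a : N ⊗ H ⟶ N) (φ : X ⟶ N) (g : H ⟶ H) : X ⟶ N :=
  r ≫ φ ▷ H ≫ N ◁ g ≫ a

/-- Coassociativity of the coaction and associativity of the action give `(φ * g) * g' = φ * (g *
g')`. With `g = 𝟙` and `g' = S`, or the reverse, convolution with `S` becomes the two-sided inverse
of convolution with the identity. -/
theorem actConv_actConv {H X N : C} [MonObj H] [ComonObj H] {r : X ⟶ X ⊗ H} {a : N ⊗ H ⟶ N}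
    (hr : IsRightCoaction r) (ha : IsRightAction a) (φ : X ⟶ N) {g g' : H ⟶ H}
    (h : Δ[H] ≫ g ▷ H ≫ H ◁ g' ≫ μ[H] = ε[H] ≫ η[H]) :
    actConv r a (actConv r a φ g) g' = φ := by
  calc _ = r ≫ r ▷ H ≫ φ ▷ H ▷ H ≫ (N ◁ g) ▷ H ≫ (a ▷ H ≫ N ◁ g') ≫ a := by
        simp only [actConv, comp_whiskerRight, Category.assoc]
    _ = r ≫ r ▷ H ≫ φ ▷ H ▷ H ≫ (N ◁ g) ▷ H ≫ (N ⊗ H) ◁ g' ≫ a ▷ H ≫ a := by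
      rw [← whisker_exchange, Category.assoc]
    _ = (r ≫ r ▷ H ≫ (α_ _ _ _).hom) ≫ φ ▷ (H ⊗ H) ≫ N ◁ (g ▷ H ≫ H ◁ g' ≫ μ[H]) ≫ a := by
      rw [ha.assoc]; monoidal
    _ = r ≫ (X ◁ Δ[H] ≫ φ ▷ (H ⊗ H)) ≫ N ◁ (g ▷ H ≫ H ◁ g' ≫ μ[H]) ≫ a := by
      rw [← hr.coassoc]; simp only [Category.assoc]
    _ = r ≫ φ ▷ H ≫ N ◁ (Δ[H] ≫ g ▷ H ≫ H ◁ g' ≫ μ[H]) ≫ a := by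
      rw [whisker_exchange]; monoidal
    _ = r ≫ (φ ▷ H ≫ N ◁ ε[H]) ≫ N ◁ η[H] ≫ a := by rw [h]; monoidal
    _ = _ := by
      rw [← whisker_exchange, ha.unit]
      simp only [← Category.assoc]
      rw [hr.counit]; monoidal

variable [BraidedCategory C]

/-- `M` is a right Hopf module over the bimonoid `H`. -/
structure IsHopfModule {H M : C} [BimonObj H] (a : M ⊗ H ⟶ M) (r : M ⟶ M ⊗ H) : Prop where
  action : IsRightAction a
  coaction : IsRightCoaction r
  compat : a ≫ r = (r ⊗ₘ Δ[H]) ≫ tensorμ M H H H ≫ (a ⊗ₘ μ[H])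

/-- With this coaction on `M ⊗ H`, convolution by the identity and by `S` can be inverted for
morphisms out of `M ⊗ H`, in particular for the action itself. Coassociativity uses that the
coproduct is multiplicative. -/
theorem IsRightCoaction.tensor {H M : C} [BimonObj H] {r : M ⟶ M ⊗ H} (hr : IsRightCoaction r) :
    IsRightCoaction ((r ⊗ₘ Δ[H]) ≫ tensorμ M H H H ≫ (M ⊗ H) ◁ μ[H]) where
  coassoc := by
    calc _ = ((r ≫ M ◁ Δ[H]) ⊗ₘ (Δ[H] ≫ H ◁ Δ[H])) ≫ tensorμ M (H ⊗ H) H (H ⊗ H) ≫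
          (M ⊗ H) ◁ (tensorμ H H H H ≫ (μ[H] ⊗ₘ μ[H])) := by
          simp only [Category.assoc, ← MonoidalCategory.whiskerLeft_comp, BimonObj.mul_comul]
          rw [MonoidalCategory.whiskerLeft_comp, ← id_tensorHom (M ⊗ H) (Δ[H] ⊗ₘ Δ[H]),
            ← id_tensorHom_id, ← tensorμ_natural_assoc, tensorHom_comp_tensorHom_assoc,
            id_tensorHom, id_tensorHom]
      _ = ((r ≫ r ▷ H) ⊗ₘ (Δ[H] ≫ Δ[H] ▷ H)) ≫ (tensorμ (M ⊗ H) H (H ⊗ H) H ≫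
          tensorμ M H H H ▷ (H ⊗ H) ≫ (α_ _ _ _).hom) ≫ (M ⊗ H) ◁ (μ[H] ⊗ₘ μ[H]) := by
        rw [associator_monoidal, hr.coassoc, ComonObj.comul_assoc]
        simp only [← tensorHom_comp_tensorHom, Category.assoc, MonoidalCategory.whiskerLeft_comp]
      _ = (r ⊗ₘ Δ[H]) ≫ (tensorμ M H H H ≫ (r ⊗ₘ Δ[H]) ▷ (H ⊗ H)) ≫
          (tensorμ M H H H ▷ (H ⊗ H) ≫ (α_ _ _ _).hom) ≫ (M ⊗ H) ◁ (μ[H] ⊗ₘ μ[H]) := by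
        rw [← tensorHom_id (r ⊗ₘ Δ[H]), ← id_tensorHom_id, ← tensorμ_natural]
        simp only [tensorHom_id, ← tensorHom_comp_tensorHom, Category.assoc]
      _ = ((r ⊗ₘ Δ[H]) ≫ tensorμ M H H H) ≫ (((r ⊗ₘ Δ[H]) ≫ tensorμ M H H H) ▷ (H ⊗ H) ≫
          _ ◁ μ[H]) ≫ ((M ⊗ H) ◁ μ[H]) ▷ H ≫ (α_ _ _ _).hom := by
        simp only [Category.assoc, comp_whiskerRight]
        congr 4
        rw [tensorHom_def']
        monoidal
      _ = _ := by
        rw [← whisker_exchange]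
        simp only [Category.assoc, comp_whiskerRight]
  counit := by
    calc _ = ((r ≫ M ◁ ε[H]) ⊗ₘ (Δ[H] ≫ H ◁ ε[H])) ≫ tensorμ M (𝟙_ C) H (𝟙_ C) ≫
          (M ⊗ H) ◁ (λ_ _).hom := by
          simp only [Category.assoc, ← MonoidalCategory.whiskerLeft_comp, BimonObj.mul_counit,
            Comon.tensorObj_counit]
          rw [MonoidalCategory.whiskerLeft_comp, ← id_tensorHom (M ⊗ H) (ε[H] ⊗ₘ ε[H]),
            ← id_tensorHom_id, ← tensorμ_natural_assoc, tensorHom_comp_tensorHom_assoc,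
            id_tensorHom, id_tensorHom]
      _ = _ := by
        rw [hr.counit, ComonObj.comul_counit, tensorμ, braiding_tensorUnit_left]
        monoidal

/-- The arrow-reversed counterpart of `IsRightCoaction.tensor`, for morphisms into `M ⊗ H` such as
the coaction. -/
theorem IsRightAction.tensor {H M : C} [BimonObj H] {a : M ⊗ H ⟶ M} (ha : IsRightAction a) :
    IsRightAction ((M ⊗ H) ◁ Δ[H] ≫ tensorμ M H H H ≫ (a ⊗ₘ μ[H])) where
  assoc := by
    symm
    calc _ = (α_ _ _ _).hom ≫ (M ⊗ H) ◁ (Δ[H] ⊗ₘ Δ[H]) ≫ (M ⊗ H) ◁ tensorμ H H H H ≫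
          tensorμ M H (H ⊗ H) (H ⊗ H) ≫ ((M ◁ μ[H] ≫ a) ⊗ₘ (H ◁ μ[H] ≫ μ[H])) := by
          simp only [← MonoidalCategory.whiskerLeft_comp_assoc, BimonObj.mul_comul]
          simp only [MonoidalCategory.whiskerLeft_comp, Category.assoc]
          rw [← id_tensorHom (M ⊗ H) (μ[H] ⊗ₘ μ[H]), ← id_tensorHom_id, tensorμ_natural_assoc,
            tensorHom_comp_tensorHom, id_tensorHom, id_tensorHom]
      _ = (α_ _ _ _).hom ≫ ((M ⊗ H) ◁ (Δ[H] ⊗ₘ Δ[H]) ≫ (α_ _ _ _).inv) ≫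
          (tensorμ M H H H ▷ (H ⊗ H) ≫ tensorμ (M ⊗ H) (H ⊗ H) H H ≫
          ((α_ M H H).hom ⊗ₘ (α_ H H H).hom)) ≫ ((M ◁ μ[H] ≫ a) ⊗ₘ (H ◁ μ[H] ≫ μ[H])) := by
        rw [tensor_associativity]
        simp only [Category.assoc, Iso.inv_hom_id_assoc]
      _ = (α_ _ _ _).hom ≫ ((M ⊗ H) ◁ (Δ[H] ⊗ₘ Δ[H]) ≫ (α_ _ _ _).inv) ≫
          tensorμ M H H H ▷ (H ⊗ H) ≫ (tensorμ (M ⊗ H) (H ⊗ H) H H ≫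
          ((a ▷ H) ⊗ₘ (μ[H] ▷ H))) ≫ (a ⊗ₘ μ[H]) := by
        simp only [Category.assoc, tensorHom_comp_tensorHom, ha.assoc, MonObj.mul_assoc]
      _ = ((M ⊗ H) ◁ Δ[H]) ▷ H ≫ (((M ⊗ H) ⊗ (H ⊗ H)) ◁ Δ[H] ≫
          (tensorμ M H H H ≫ (a ⊗ₘ μ[H])) ▷ (H ⊗ H)) ≫ tensorμ M H H H ≫ (a ⊗ₘ μ[H]) := by
        rw [← tensorHom_id a, ← tensorHom_id μ[H], ← tensorμ_natural, id_tensorHom_id, tensorHom_id,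
          MonoidalCategory.tensorHom_def Δ[H] Δ[H]]
        monoidal
      _ = _ := by
        rw [whisker_exchange]
        simp only [Category.assoc, comp_whiskerRight]
  unit := by
    calc _ = (M ⊗ H) ◁ (η[H] ≫ Δ[H]) ≫ tensorμ M H H H ≫ (a ⊗ₘ μ[H]) := by
          simp only [Category.assoc, MonoidalCategory.whiskerLeft_comp]
      _ = (M ⊗ H) ◁ ((λ_ _).inv ≫ (η[H] ⊗ₘ η[H])) ≫ tensorμ M H H H ≫ (a ⊗ₘ μ[H]) := by
        rw [BimonObj.one_comul]; rfl
      _ = (M ⊗ H) ◁ (λ_ _).inv ≫ tensorμ M H (𝟙_ C) (𝟙_ C) ≫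
          ((M ◁ η[H] ≫ a) ⊗ₘ (H ◁ η[H] ≫ μ[H])) := by
        rw [MonoidalCategory.whiskerLeft_comp, Category.assoc, ← id_tensorHom (M ⊗ H) (η[H] ⊗ₘ η[H]),
          ← id_tensorHom_id, tensorμ_natural_assoc, tensorHom_comp_tensorHom, id_tensorHom,
          id_tensorHom]
      _ = _ := by
        rw [ha.unit, MonObj.mul_one, tensorμ, braiding_tensorUnit_right]
        monoidal

namespace IsHopfModule

variable {H M : C} [HopfObj H] {a : M ⊗ H ⟶ M} {r : M ⟶ M ⊗ H}

theorem actConv_antipode_id {X N : C} {r : X ⟶ X ⊗ H} {a : N ⊗ H ⟶ N} (hr : IsRightCoaction r)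
    (ha : IsRightAction a) (φ : X ⟶ N) : actConv r a (actConv r a φ 𝒮[H]) (𝟙 H) = φ :=
  actConv_actConv hr ha φ (by
    rw [MonoidalCategory.whiskerLeft_id, Category.id_comp, HopfObj.antipode_left])

theorem actConv_id_antipode {X N : C} {r : X ⟶ X ⊗ H} {a : N ⊗ H ⟶ N} (hr : IsRightCoaction r)
    (ha : IsRightAction a) (φ : X ⟶ N) : actConv r a (actConv r a φ (𝟙 H)) 𝒮[H] = φ :=
  actConv_actConv hr ha φ (by rw [id_whiskerRight, Category.id_comp, HopfObj.antipode_right])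

/-- Convolving with the antipode projects a Hopf module onto its coinvariants. -/
theorem action_comp_coinvariants (h : IsHopfModule a r) :
    a ≫ actConv r a (𝟙 M) 𝒮[H] = M ◁ ε[H] ≫ (ρ_ M).hom ≫ actConv r a (𝟙 M) 𝒮[H] := by
  set P := actConv r a (𝟙 M) 𝒮[H] with hP
  set r₂ := (r ⊗ₘ Δ[H]) ≫ tensorμ M H H H ≫ (M ⊗ H) ◁ μ[H] with hr₂
  -- Uniqueness of convolution inverses: compatibility gives `a ≫ P = a * S`, and `h₂` gives `(P ⊗
  -- ε) * 𝟙 = a`. Convolving the latter with `S` identifies `a ≫ P` with `P ⊗ ε`.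
  have h₁ : a ≫ P = actConv r₂ a a 𝒮[H] := by
    rw [hP, actConv, id_whiskerRight, Category.id_comp, ← Category.assoc, h.compat, actConv, hr₂,
      tensorHom_def' a μ[H]]
    simp only [Category.assoc]
  have h₂ : actConv r₂ a (M ◁ ε[H] ≫ (ρ_ M).hom ≫ P) (𝟙 H) = a := by
    calc _ = (r ⊗ₘ Δ[H]) ≫ tensorμ M H H H ≫ ((M ⊗ H) ◁ μ[H] ≫
          (M ◁ ε[H] ≫ (ρ_ M).hom ≫ P) ▷ H) ≫ a := by
          rw [actConv, hr₂]
          simp only [Category.assoc, MonoidalCategory.whiskerLeft_id, Category.id_comp]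
      _ = (r ⊗ₘ Δ[H]) ≫ (tensorμ M H H H ≫ ((𝟙 M ⊗ₘ ε[H]) ⊗ₘ (𝟙 H ⊗ₘ 𝟙 H))) ≫
          ((ρ_ M).hom ▷ _ ≫ P ▷ _ ≫ M ◁ μ[H]) ≫ a := by
          rw [whisker_exchange]
          simp only [Category.assoc, id_whiskerRight, tensorHom_id, id_tensorHom M, comp_whiskerRight]
      _ = (r ⊗ₘ (Δ[H] ≫ ε[H] ▷ H)) ≫ tensorμ M H (𝟙_ C) H ≫
          ((ρ_ M).hom ▷ _ ≫ P ▷ _ ≫ M ◁ μ[H]) ≫ a := by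
        rw [← tensorμ_natural]
        rw [Category.assoc, tensorHom_comp_tensorHom_assoc, id_tensorHom_id, Category.comp_id,
          tensorHom_id]
      _ = (r ≫ P ▷ H) ▷ H ≫ ((α_ _ _ _).hom ≫ M ◁ μ[H] ≫ a) := by
        rw [ComonObj.counit_comul, tensorμ, braiding_tensorUnit_right]
        monoidal
      _ = actConv r a P (𝟙 H) ▷ H ≫ a := by
        rw [← h.action.assoc, actConv]; simp
      _ = _ := by
        rw [hP, actConv_antipode_id h.coaction h.action]
        simp
  have h₃ := actConv_id_antipode h.coaction.tensor h.action (M ◁ ε[H] ≫ (ρ_ M).hom ≫ P)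
  rw [← hr₂, h₂] at h₃
  rw [h₁, h₃]

/-- The argument of `action_comp_coinvariants` with arrows reversed: `P ≫ r = r * S`, while
convolving `P(m) ⊗ 1` with the identity gives `r`. -/
theorem coinvariants_comp_coaction (h : IsHopfModule a r) :
    actConv r a (𝟙 M) 𝒮[H] ≫ r = actConv r a (𝟙 M) 𝒮[H] ≫ (ρ_ M).inv ≫ M ◁ η[H] := by
  set P := actConv r a (𝟙 M) 𝒮[H] with hP
  set a₂ := (M ⊗ H) ◁ Δ[H] ≫ tensorμ M H H H ≫ (a ⊗ₘ μ[H]) with ha₂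
  have h₁ : P ≫ r = actConv r a₂ r 𝒮[H] := by
    rw [hP, actConv, id_whiskerRight, Category.id_comp, Category.assoc, Category.assoc, h.compat,
      actConv, ha₂, MonoidalCategory.tensorHom_def r, ← whisker_exchange_assoc,
      Category.assoc, ← whisker_exchange_assoc]
  have h₂ : actConv r a₂ (P ≫ (ρ_ M).inv ≫ M ◁ η[H]) (𝟙 H) = r := by
    calc _ = r ≫ P ▷ H ≫ (ρ_ M).inv ▷ H ≫ ((M ◁ η[H]) ▷ H ≫ (M ⊗ H) ◁ Δ[H]) ≫
          tensorμ M H H H ≫ (a ⊗ₘ μ[H]) := by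
          rw [actConv, ha₂]; simp
      _ = r ≫ P ▷ H ≫ (ρ_ M).inv ▷ H ≫ (M ⊗ 𝟙_ C) ◁ Δ[H] ≫ (((𝟙 M ⊗ₘ η[H]) ⊗ₘ (𝟙 H ⊗ₘ 𝟙 H)) ≫
          tensorμ M H H H) ≫ (a ⊗ₘ μ[H]) := by
        rw [← whisker_exchange]; simp
      _ = r ≫ P ▷ H ≫ (ρ_ M).inv ▷ H ≫ (M ⊗ 𝟙_ C) ◁ Δ[H] ≫ tensorμ M (𝟙_ C) H H ≫
          (a ⊗ₘ (η[H] ▷ H ≫ μ[H])) := by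
        rw [tensorμ_natural, Category.assoc, tensorHom_comp_tensorHom]
        simp
      _ = r ≫ (P ▷ H ≫ M ◁ Δ[H]) ≫ (α_ _ _ _).inv ≫ a ▷ H := by
        rw [MonObj.one_mul, tensorμ, braiding_tensorUnit_left]
        monoidal
      _ = (r ≫ M ◁ Δ[H]) ≫ P ▷ (H ⊗ H) ≫ (α_ _ _ _).inv ≫ a ▷ H := by
        rw [← whisker_exchange]; simp
      _ = r ≫ (actConv r a P (𝟙 H)) ▷ H := by
        rw [h.coaction.coassoc, actConv]
        simp
      _ = _ := by
        rw [hP, actConv_antipode_id h.coaction h.action]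
        simp
  have h₃ := actConv_id_antipode h.coaction h.action.tensor (P ≫ (ρ_ M).inv ≫ M ◁ η[H])
  rw [← ha₂, h₂] at h₃
  rw [h₁, h₃]

/-- The splitting of the action on coinvariants. -/
theorem coinvariants_action_coaction (h : IsHopfModule a r) :
    actConv r a (𝟙 M) 𝒮[H] ▷ H ≫ a ≫ r ≫ actConv r a (𝟙 M) 𝒮[H] ▷ H =
      actConv r a (𝟙 M) 𝒮[H] ▷ H := by
  set P := actConv r a (𝟙 M) 𝒮[H] with hP
  have hPr : P ≫ r = P ≫ (ρ_ M).inv ≫ M ◁ η[H] := h.coinvariants_comp_coaction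
  have haP : a ≫ P = M ◁ ε[H] ≫ (ρ_ M).hom ≫ P := h.action_comp_coinvariants
  -- By `haP`, `P(m₀·S(m₁)) = P(m₀) ε(S(m₁)) = P(m)`.
  have hPP : P ≫ P = P := by
    calc P ≫ P = r ≫ M ◁ 𝒮[H] ≫ a ≫ P := by
          nth_rewrite 1 [hP]
          simp [actConv]
      _ = (r ≫ M ◁ ε[H]) ≫ (ρ_ M).hom ≫ P := by
        rw [haP, ← MonoidalCategory.whiskerLeft_comp_assoc, HopfObj.antipode_counit]
        simp
      _ = P := by rw [h.coaction.counit]; simp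
  calc _ = (P ⊗ₘ 𝟙 H) ≫ ((r ⊗ₘ Δ[H]) ≫ tensorμ M H H H ≫ (a ⊗ₘ μ[H])) ≫ (P ⊗ₘ 𝟙 H) := by
        rw [← h.compat, tensorHom_id, Category.assoc]
    _ = ((P ≫ r) ⊗ₘ Δ[H]) ≫ tensorμ M H H H ≫ ((a ≫ P) ⊗ₘ μ[H]) := by
        simp only [Category.assoc, tensorHom_comp_tensorHom_assoc, tensorHom_comp_tensorHom,
          Category.id_comp, Category.comp_id]
    _ = ((P ≫ (ρ_ M).inv) ⊗ₘ Δ[H]) ≫ (((𝟙 M ⊗ₘ η[H]) ⊗ₘ (𝟙 H ⊗ₘ 𝟙 H)) ≫ tensorμ M H H H) ≫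
        ((𝟙 M ⊗ₘ ε[H]) ⊗ₘ (𝟙 H ⊗ₘ 𝟙 H)) ≫ (((ρ_ M).hom ≫ P) ⊗ₘ μ[H]) := by
      rw [hPr, haP]
      simp only [Category.assoc, tensorHom_comp_tensorHom_assoc, tensorHom_comp_tensorHom,
          Category.id_comp, Category.comp_id, id_tensorHom M, id_tensorHom_id]
    _ = ((P ≫ (ρ_ M).inv) ⊗ₘ Δ[H]) ≫ (tensorμ M (𝟙_ C) H H ≫
        ((𝟙 M ⊗ₘ ε[H]) ⊗ₘ (𝟙 (𝟙_ C) ⊗ₘ 𝟙 H))) ≫ (((ρ_ M).hom ≫ P) ⊗ₘ (η[H] ▷ H ≫ μ[H])) := by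
      rw [tensorμ_natural]
      simp only [← tensorHom_id η[H], Category.assoc, tensorHom_comp_tensorHom,
        tensorHom_comp_tensorHom_assoc, Category.id_comp, Category.comp_id]
    _ = ((P ≫ (ρ_ M).inv) ⊗ₘ (Δ[H] ≫ ε[H] ▷ H)) ≫ tensorμ M (𝟙_ C) (𝟙_ C) H ≫
        (((ρ_ M).hom ≫ P) ⊗ₘ (η[H] ▷ H ≫ μ[H])) := by
      rw [← tensorμ_natural]
      simp only [Category.assoc, tensorHom_comp_tensorHom_assoc, Category.comp_id, id_whiskerRight,
        tensorHom_id]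
    _ = (P ≫ P) ▷ H := by
      rw [ComonObj.counit_comul, MonObj.one_mul, tensorμ, braiding_tensorUnit_left]
      monoidal
    _ = P ▷ H := by rw [hPP]

end IsHopfModule
end HopfModule
-- Bending strands along exact pairings.
section

variable {C : Type u} [Category.{v} C] [MonoidalCategory C]

/-- The morphism `Y' ⟶ X' ⊗ W` obtained by bending the strands `X` and `Y` of `g`. -/
def comate {X Y W : C} (X' Y' : C) [ExactPairing X' X] [ExactPairing Y' Y] (g : X ⟶ W ⊗ Y) :
    Y' ⟶ X' ⊗ W :=
  𝟙 _ ⊗≫ η_ X' X ▷ Y' ⊗≫ X' ◁ (g ▷ Y' ⊗≫ W ◁ ε_ Y' Y ⊗≫ 𝟙 W)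

/-- The morphism `Z ⊗ Y' ⟶ X'` obtained by bending the strands `X` and `Y` of `g`. -/
def actMate {X Y Z : C} (X' Y' : C) [ExactPairing X' X] [ExactPairing Y' Y] (g : X ⊗ Z ⟶ Y) :
    Z ⊗ Y' ⟶ X' :=
  𝟙 _ ⊗≫ η_ X' X ▷ (Z ⊗ Y') ⊗≫ X' ◁ (g ▷ Y' ⊗≫ ε_ Y' Y) ⊗≫ 𝟙 X'

variable {X Y Z W X' Y' : C} [ExactPairing X' X] [ExactPairing Y' Y]

theorem comate_evaluation (g : X ⟶ W ⊗ Y) :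
    X ◁ comate X' Y' g ⊗≫ ε_ X' X ▷ W ⊗≫ 𝟙 W = g ▷ Y' ⊗≫ W ◁ ε_ Y' Y ⊗≫ 𝟙 W := by
  set k := g ▷ Y' ⊗≫ W ◁ ε_ Y' Y ⊗≫ 𝟙 W with hk
  calc _ = 𝟙 _ ⊗≫ X ◁ η_ X' X ▷ Y' ⊗≫ ((X ⊗ X') ◁ k ≫ ε_ X' X ▷ W) ⊗≫ 𝟙 W := by
        rw [comate, ← hk]; monoidal
    _ = 𝟙 _ ⊗≫ (X ◁ η_ X' X ⊗≫ ε_ X' X ▷ X) ▷ Y' ⊗≫ k := by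
      rw [whisker_exchange]; monoidal
    _ = k := by rw [ExactPairing.coevaluation_evaluation'']; monoidal

theorem actMate_evaluation (g : X ⊗ Z ⟶ Y) :
    X ◁ actMate X' Y' g ≫ ε_ X' X = 𝟙 _ ⊗≫ g ▷ Y' ⊗≫ ε_ Y' Y := by
  set k := g ▷ Y' ⊗≫ ε_ Y' Y with hk
  calc _ = 𝟙 _ ⊗≫ X ◁ η_ X' X ▷ (Z ⊗ Y') ⊗≫ ((X ⊗ X') ◁ k ≫ ε_ X' X ▷ _) ⊗≫ 𝟙 _ := by
        rw [actMate, ← hk]; monoidal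
    _ = 𝟙 _ ⊗≫ (X ◁ η_ X' X ⊗≫ ε_ X' X ▷ X) ▷ (Z ⊗ Y') ⊗≫ k := by
      rw [whisker_exchange]; monoidal
    _ = _ := by rw [ExactPairing.coevaluation_evaluation'']; monoidal

/-- A version of `ExactPairing.hom_ext_tensor` up to coherence. -/
theorem ExactPairing.hom_ext_tensor' {f g : Z ⟶ X' ⊗ W}
    (h : X ◁ f ⊗≫ ε_ X' X ▷ W ⊗≫ 𝟙 W = X ◁ g ⊗≫ ε_ X' X ▷ W ⊗≫ 𝟙 W) : f = g := by
  apply ExactPairing.hom_ext_tensor (X := X)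
  have e : ∀ k : Z ⟶ X' ⊗ W, X ◁ k ≫ (α_ _ _ _).inv ≫ ε_ X' X ▷ W =
    (X ◁ k ⊗≫ ε_ X' X ▷ W ⊗≫ 𝟙 W) ≫ (λ_ _).inv := fun k => by monoidal
  rw [e, e, h]

/-- The dual-basis identity: a coaction on the dual leg of the coevaluation can be traded for `g` on
the other leg. This is what makes the trace of the projection computable. -/
theorem coevaluation_comate (g : X ⟶ W ⊗ X) :
    η_ X' X ≫ comate X' X' g ▷ X = η_ X' X ≫ X' ◁ g ≫ (α_ _ _ _).inv := by
  rw [← cancel_mono (α_ _ _ _).hom]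
  apply ExactPairing.hom_ext_tensor' (X := X)
  calc _ = X ◁ η_ X' X ⊗≫ (X ◁ comate X' X' g ⊗≫ ε_ X' X ▷ W ⊗≫ 𝟙 W) ▷ X := by monoidal
    _ = 𝟙 _ ⊗≫ (X ◁ η_ X' X ≫ g ▷ (X' ⊗ X)) ⊗≫ W ◁ ε_ X' X ▷ X ⊗≫ 𝟙 (W ⊗ X) := by
      rw [comate_evaluation]; monoidal
    _ = 𝟙 _ ⊗≫ g ⊗≫ W ◁ (X ◁ η_ X' X ⊗≫ ε_ X' X ▷ X) ⊗≫ 𝟙 (W ⊗ X) := by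
      rw [whisker_exchange]; monoidal
    _ = 𝟙 _ ⊗≫ (X ◁ η_ X' X ⊗≫ ε_ X' X ▷ X) ⊗≫ g := by
      rw [ExactPairing.coevaluation_evaluation'']; monoidal
    _ = X ◁ η_ X' X ⊗≫ (ε_ X' X ▷ X ≫ 𝟙_ C ◁ g) ⊗≫ 𝟙 _ := by monoidal
    _ = _ := by
      rw [← whisker_exchange]; monoidal

/-- The coaction is determined by `f₀(x) f₁ = x₁ f(x₂)`, so its axioms are those of the coproduct
read through the pairing. -/
theorem isRightCoaction_comate (H Hd : C) [ComonObj H] [ExactPairing Hd H] :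
    IsRightCoaction (comate Hd Hd Δ[H]) where
  coassoc := by
    set r := comate Hd Hd Δ[H] with hr
    have e := comate_evaluation (X' := Hd) (Y' := Hd) Δ[H]
    rw [← hr] at e
    apply ExactPairing.hom_ext_tensor' (X := H)
    calc _ = H ◁ r ⊗≫ (ε_ Hd H ▷ H ≫ 𝟙_ C ◁ Δ[H]) ⊗≫ 𝟙 _ := by
          rw [← whisker_exchange]; monoidal
      _ = (H ◁ r ⊗≫ ε_ Hd H ▷ H ⊗≫ 𝟙 H) ≫ Δ[H] := by monoidal
      _ = Δ[H] ▷ Hd ⊗≫ (H ◁ ε_ Hd H ≫ Δ[H] ▷ 𝟙_ C) ⊗≫ 𝟙 _ := by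
        rw [e]; monoidal
      _ = (Δ[H] ≫ Δ[H] ▷ H ≫ (α_ _ _ _).hom) ▷ Hd ⊗≫ (H ⊗ H) ◁ ε_ Hd H ⊗≫ 𝟙 _ := by
        rw [whisker_exchange]; monoidal
      _ = Δ[H] ▷ Hd ⊗≫ H ◁ (Δ[H] ▷ Hd ⊗≫ H ◁ ε_ Hd H ⊗≫ 𝟙 H) ⊗≫ 𝟙 _ := by
        rw [← ComonObj.comul_assoc]; monoidal
      _ = 𝟙 _ ⊗≫ (Δ[H] ▷ Hd ≫ (H ⊗ H) ◁ r) ⊗≫ H ◁ ε_ Hd H ▷ H ⊗≫ 𝟙 _ := by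
        rw [← e]; monoidal
      _ = H ◁ r ⊗≫ (Δ[H] ▷ Hd ⊗≫ H ◁ ε_ Hd H ⊗≫ 𝟙 H) ▷ H := by
        rw [← whisker_exchange]; monoidal
      _ = _ := by
        rw [← e]; monoidal
  counit := by
    set r := comate Hd Hd Δ[H] with hr
    have e := comate_evaluation (X' := Hd) (Y' := Hd) Δ[H]
    rw [← hr] at e
    apply ExactPairing.hom_ext_tensor' (X := H)
    calc _ = H ◁ r ⊗≫ (ε_ Hd H ▷ H ≫ 𝟙_ C ◁ ε[H]) ⊗≫ 𝟙 _ := by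
          rw [← whisker_exchange]; monoidal
      _ = (H ◁ r ⊗≫ ε_ Hd H ▷ H ⊗≫ 𝟙 H) ≫ ε[H] := by monoidal
      _ = Δ[H] ▷ Hd ⊗≫ (H ◁ ε_ Hd H ≫ ε[H] ▷ 𝟙_ C) ⊗≫ 𝟙 _ := by
        rw [e]; monoidal
      _ = (Δ[H] ≫ ε[H] ▷ H) ▷ Hd ⊗≫ ε_ Hd H := by
        rw [whisker_exchange]; monoidal
      _ = _ := by
        rw [ComonObj.counit_comul]; monoidal

end

/-! ### The dual of a Hopf algebra as a Hopf module. -/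

section Antipode

variable {C : Type u} [Category.{v} C] [MonoidalCategory C] [SymmetricCategory C]
variable (H Hd : C) [HopfObj H] [ExactPairing Hd H]

/-- Right translation `(h·f)(x) = f(x h)` is a left action because the product is associative. -/
theorem actMate_mul_assoc :
    H ◁ actMate Hd Hd μ[H] ≫ actMate Hd Hd μ[H] =
      (α_ H H Hd).inv ≫ μ[H] ▷ Hd ≫ actMate Hd Hd μ[H] := by
  set L := actMate Hd Hd μ[H] with hL
  have e := actMate_evaluation (X' := Hd) (Y' := Hd) μ[H]
  rw [← hL] at e
  apply ExactPairing.hom_ext (X := H)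
  calc _ = H ◁ H ◁ L ≫ (H ◁ L ≫ ε_ Hd H) := by simp
    _ = 𝟙 _ ⊗≫ ((H ⊗ H) ◁ L ≫ μ[H] ▷ Hd) ⊗≫ ε_ Hd H := by rw [e]; monoidal
    _ = 𝟙 _ ⊗≫ μ[H] ▷ (H ⊗ Hd) ⊗≫ (H ◁ L ≫ ε_ Hd H) := by rw [whisker_exchange]; monoidal
    _ = 𝟙 _ ⊗≫ (μ[H] ▷ H ≫ μ[H]) ▷ Hd ⊗≫ ε_ Hd H := by rw [e]; monoidal
    _ = H ◁ ((α_ H H Hd).inv ≫ μ[H] ▷ Hd) ≫ (𝟙 _ ⊗≫ μ[H] ▷ Hd ⊗≫ ε_ Hd H) := by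
      rw [MonObj.mul_assoc]; monoidal
    _ = _ := by rw [← e]; simp

theorem one_actMate_mul : η[H] ▷ Hd ≫ actMate Hd Hd μ[H] = (λ_ Hd).hom := by
  apply ExactPairing.hom_ext (X := H)
  rw [MonoidalCategory.whiskerLeft_comp, Category.assoc, actMate_evaluation]
  calc _ = 𝟙 _ ⊗≫ (H ◁ η[H] ≫ μ[H]) ▷ Hd ⊗≫ ε_ Hd H := by monoidal
    _ = _ := by rw [MonObj.mul_one]; monoidal

theorem braiding_whiskerRight_braiding_tensor (X Y Z : C) :
    (β_ X Y).hom ▷ Z ≫ (β_ (Y ⊗ X) Z).hom ≫ (α_ _ _ _).inv =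
      (α_ _ _ _).hom ≫ X ◁ (β_ Y Z).hom ≫ (β_ X (Z ⊗ Y)).hom := by
  rw [BraidedCategory.braiding_naturality_left_assoc, BraidedCategory.braiding_tensor_left_hom,
    BraidedCategory.braiding_tensor_right_hom]
  simp only [Category.assoc]

/-- The right action `f ⊗ h ↦ f (- * S h)` on the dual of a Hopf algebra. -/
def dualAction : Hd ⊗ H ⟶ Hd := Hd ◁ 𝒮[H] ≫ (β_ Hd H).hom ≫ actMate Hd Hd μ[H]

/-- Precomposing with the antihomomorphism `S` turns the left action by translation into a right
one. -/
theorem isRightAction_dualAction : IsRightAction (dualAction H Hd) where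
  assoc := by
    have hL := actMate_mul_assoc H Hd
    rw [dualAction]
    set L := actMate Hd Hd μ[H]
    calc _ = (Hd ◁ 𝒮[H]) ▷ H ≫ (β_ Hd H).hom ▷ H ≫ (L ▷ H ≫ Hd ◁ 𝒮[H]) ≫ (β_ Hd H).hom ≫ L := by
          simp only [comp_whiskerRight, Category.assoc]
      _ = (Hd ◁ 𝒮[H]) ▷ H ≫ ((β_ Hd H).hom ▷ H ≫ (H ⊗ Hd) ◁ 𝒮[H]) ≫
          (β_ (H ⊗ Hd) H).hom ≫ H ◁ L ≫ L := by
        rw [← whisker_exchange, ← BraidedCategory.braiding_naturality_left_assoc]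
        simp only [Category.assoc]
      _ = (Hd ◁ 𝒮[H]) ▷ H ≫ (Hd ⊗ H) ◁ 𝒮[H] ≫ ((β_ Hd H).hom ▷ H ≫
          (β_ (H ⊗ Hd) H).hom ≫ (α_ _ _ _).inv) ≫ μ[H] ▷ Hd ≫ L := by
        rw [← whisker_exchange, hL]
        simp only [Category.assoc]
      _ = (α_ _ _ _).hom ≫ Hd ◁ (𝒮[H] ▷ H ≫ H ◁ 𝒮[H] ≫ (β_ H H).hom) ≫
          (β_ Hd (H ⊗ H)).hom ≫ μ[H] ▷ Hd ≫ L := by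
        rw [braiding_whiskerRight_braiding_tensor]
        monoidal
      _ = _ := by
        rw [← BraidedCategory.braiding_naturality_right_assoc]
        simp only [← MonoidalCategory.whiskerLeft_comp_assoc, HopfObj.mul_antipode,
          MonoidalCategory.tensorHom_def, Category.assoc]
  unit := by
    rw [dualAction, ← MonoidalCategory.whiskerLeft_comp_assoc, HopfObj.one_antipode,
      BraidedCategory.braiding_naturality_right_assoc, one_actMate_mul]
    simp

section

variable (A B : C) [MonObj A] [MonObj B]

theorem tensorObj_mul : μ[A ⊗ B] = tensorμ A B A B ≫ (μ[A] ⊗ₘ μ[B]) := rfl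

theorem tensorObj_one : η[A ⊗ B] = (λ_ (𝟙_ C)).inv ≫ (η[A] ⊗ₘ η[B]) := rfl

theorem inl_inr_mul :
    (((ρ_ A).inv ≫ A ◁ η[B]) ⊗ₘ ((λ_ B).inv ≫ η[A] ▷ B)) ≫ μ[A ⊗ B] = 𝟙 (A ⊗ B) := by
  rw [← id_tensorHom, ← tensorHom_id, ← tensorHom_comp_tensorHom, tensorObj_mul, Category.assoc,
    tensorμ_natural_assoc, tensorHom_comp_tensorHom, id_tensorHom, tensorHom_id, MonObj.mul_one,
    MonObj.one_mul, tensorμ, braiding_tensorUnit_left]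
  monoidal

theorem inr_inr_mul :
    (((λ_ B).inv ≫ η[A] ▷ B) ⊗ₘ ((λ_ B).inv ≫ η[A] ▷ B)) ≫ μ[A ⊗ B] =
      μ[B] ≫ (λ_ B).inv ≫ η[A] ▷ B := by
  rw [← tensorHom_id, ← tensorHom_comp_tensorHom, tensorObj_mul, Category.assoc,
    tensorμ_natural_assoc, tensorHom_comp_tensorHom, MonoidalCategory.tensorHom_def η[A],
    Category.assoc, MonObj.mul_one, tensorμ, braiding_tensorUnit_right,
    id_tensorHom_id, Category.id_comp, MonoidalCategory.tensorHom_def' _ μ[B]]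
  monoidal

theorem whiskerLeft_inl_mul :
    (A ⊗ B) ◁ ((ρ_ A).inv ≫ A ◁ η[B]) ≫ μ[A ⊗ B] =
      (α_ _ _ _).hom ≫ A ◁ (β_ B A).hom ≫ (α_ _ _ _).inv ≫ μ[A] ▷ B := by
  rw [← id_tensorHom A, MonoidalCategory.whiskerLeft_comp, ← id_tensorHom _ (𝟙 A ⊗ₘ η[B]),
    ← id_tensorHom_id A B, tensorObj_mul, Category.assoc,
    tensorμ_natural_assoc, tensorHom_comp_tensorHom, id_tensorHom, id_tensorHom, MonObj.mul_one,
    tensorμ]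
  monoidal

end

/-- In elements, `S(h₁)₁ h₂ ⊗ S(h₁)₂ = 1 ⊗ S(h)`. In the convolution monoid of morphisms `H ⟶ H ⊗ H`
the coproduct factors as `i₁ * i₂`; since `S ≫ Δ` inverts it on the left and `S ≫ i₂` inverts `i₂`
on the right, `(S ≫ Δ) * i₁ = S ≫ i₂`. -/
theorem antipode_comul_inl :
    Δ[H] ≫ (𝒮[H] ≫ Δ[H]) ▷ H ≫ (α_ _ _ _).hom ≫ H ◁ (β_ H H).hom ≫ (α_ _ _ _).inv ≫ μ[H] ▷ H =
      𝒮[H] ≫ (λ_ H).inv ≫ η[H] ▷ H := by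
  set i₁ : Conv H (H ⊗ H) := (ρ_ H).inv ≫ H ◁ η[H] with hi₁
  set i₂ : H ⟶ H ⊗ H := (λ_ H).inv ≫ η[H] ▷ H with hi₂
  let d : Conv H (H ⊗ H) := Δ[H]
  let e : Conv H (H ⊗ H) := 𝒮[H] ≫ Δ[H]
  let j : Conv H (H ⊗ H) := i₂
  let k : Conv H (H ⊗ H) := 𝒮[H] ≫ i₂
  have hd : i₁ * j = d := by
    rw [Conv.mul_eq, ← MonoidalCategory.tensorHom_def_assoc]
    exact (congrArg _ (inl_inr_mul H H)).trans (Category.comp_id _)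
  have he : e * d = 1 := by
    rw [Conv.mul_eq, Conv.one_eq, ← MonoidalCategory.tensorHom_def_assoc]
    calc _ = Δ[H] ≫ 𝒮[H] ▷ H ≫ (Δ[H] ⊗ₘ Δ[H]) ≫ μ[H ⊗ H] := by
          rw [← tensorHom_id, tensorHom_comp_tensorHom_assoc, Category.id_comp]
      _ = (Δ[H] ≫ 𝒮[H] ▷ H ≫ μ[H]) ≫ Δ[H] := by
        simp only [tensorObj_mul, Category.assoc, BimonObj.mul_comul]
      _ = _ := by rw [HopfObj.antipode_left, Category.assoc, BimonObj.one_comul]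
  have hj : j * k = 1 := by
    rw [Conv.mul_eq, Conv.one_eq, ← MonoidalCategory.tensorHom_def_assoc]
    calc _ = Δ[H] ≫ H ◁ 𝒮[H] ≫ (i₂ ⊗ₘ i₂) ≫ μ[H ⊗ H] := by
          rw [← id_tensorHom, tensorHom_comp_tensorHom_assoc, Category.id_comp]
      _ = (Δ[H] ≫ H ◁ 𝒮[H] ≫ μ[H]) ≫ i₂ := by
        rw [inr_inr_mul]; simp only [Category.assoc]; rfl
      _ = _ := by
        rw [HopfObj.antipode_right, Category.assoc, tensorObj_one, hi₂,
          leftUnitor_inv_naturality_assoc, MonoidalCategory.tensorHom_def']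
  have key : e * i₁ = k := by
    calc e * i₁ = e * i₁ * (j * k) := by rw [hj, mul_one]
      _ = e * (i₁ * j) * k := by simp only [mul_assoc]
      _ = k := by rw [hd, he, one_mul]
  rw [Conv.mul_eq] at key
  rw [← whiskerLeft_inl_mul]
  exact key

/-- In elements, `h₁ ⊗ h₂ S(k) = (h S(k₁))₁ k₂ ⊗ (h S(k₁))₂`. This is the Hopf module compatibility
of `Hd` before dualising, and it reduces to `antipode_comul_inl` because the coproduct is
multiplicative. -/
theorem comul_comp_mul_antipode :
    Δ[H] ▷ H ≫ (α_ _ _ _).hom ≫ H ◁ (H ◁ 𝒮[H] ≫ μ[H]) =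
      H ◁ Δ[H] ≫ (α_ _ _ _).inv ≫ (H ◁ 𝒮[H] ≫ μ[H] ≫ Δ[H]) ▷ H ≫ (α_ _ _ _).hom ≫
        H ◁ (β_ H H).hom ≫ (α_ _ _ _).inv ≫ μ[H] ▷ H := by
  symm
  set i₁ : H ⟶ H ⊗ H := (ρ_ H).inv ≫ H ◁ η[H] with hi₁
  set i₂ : H ⟶ H ⊗ H := (λ_ H).inv ≫ η[H] ▷ H with hi₂
  have hQ := antipode_comul_inl H
  calc _ = H ◁ Δ[H] ≫ (α_ _ _ _).inv ≫ (H ◁ 𝒮[H] ≫ (Δ[H] ⊗ₘ Δ[H]) ≫ μ[H ⊗ H]) ▷ H ≫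
        (H ⊗ H) ◁ i₁ ≫ μ[H ⊗ H] := by
        rw [whiskerLeft_inl_mul, tensorObj_mul, BimonObj.mul_comul]
    _ = H ◁ Δ[H] ≫ (α_ _ _ _).inv ≫ (H ◁ 𝒮[H] ≫ (Δ[H] ⊗ₘ Δ[H])) ▷ H ≫
        ((H ⊗ H) ⊗ (H ⊗ H)) ◁ i₁ ≫ (μ[H ⊗ H] ▷ (H ⊗ H) ≫ μ[H ⊗ H]) := by
      rw [comp_whiskerRight, comp_whiskerRight, Category.assoc, Category.assoc,
        ← whisker_exchange_assoc]
      simp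
    _ = (Δ[H] ⊗ₘ (Δ[H] ≫ (𝒮[H] ≫ Δ[H]) ▷ H ≫ (H ⊗ H) ◁ i₁ ≫ μ[H ⊗ H])) ≫ μ[H ⊗ H] := by
      have e : Δ[H] ≫ (𝒮[H] ≫ Δ[H]) ▷ H ≫ (H ⊗ H) ◁ i₁ ≫ μ[H ⊗ H] =
          (Δ[H] ≫ (𝒮[H] ≫ Δ[H]) ▷ H) ≫ (H ⊗ H) ◁ i₁ ≫ μ[H ⊗ H] := by simp only [Category.assoc]
      have e' : Δ[H] ⊗ₘ ((Δ[H] ≫ (𝒮[H] ≫ Δ[H]) ▷ H) ≫ (H ⊗ H) ◁ i₁ ≫ μ[H ⊗ H]) =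
          H ◁ (Δ[H] ≫ (𝒮[H] ≫ Δ[H]) ▷ H) ≫ Δ[H] ▷ ((H ⊗ H) ⊗ H) ≫
            (H ⊗ H) ◁ ((H ⊗ H) ◁ i₁ ≫ μ[H ⊗ H]) := by
        rw [MonoidalCategory.tensorHom_def', MonoidalCategory.whiskerLeft_comp, Category.assoc,
          whisker_exchange, MonoidalCategory.whiskerLeft_comp]
      rw [MonObj.mul_assoc, e, e', MonoidalCategory.tensorHom_def']
      monoidal
    _ = (Δ[H] ⊗ₘ (𝒮[H] ≫ i₂)) ≫ tensorμ H H H H ≫ (μ[H] ⊗ₘ μ[H]) := by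
      rw [whiskerLeft_inl_mul, hQ, tensorObj_mul]
    _ = (Δ[H] ⊗ₘ (𝒮[H] ≫ (λ_ H).inv)) ≫ tensorμ H H (𝟙_ C) H ≫
        ((H ◁ η[H] ≫ μ[H]) ⊗ₘ (μ[H])) := by
      have e₂ : Δ[H] ⊗ₘ (𝒮[H] ≫ i₂) =
          (Δ[H] ⊗ₘ (𝒮[H] ≫ (λ_ H).inv)) ≫ ((𝟙 H ⊗ₘ 𝟙 H) ⊗ₘ (η[H] ⊗ₘ 𝟙 H)) := by
        rw [tensorHom_comp_tensorHom, id_tensorHom_id, Category.comp_id, tensorHom_id,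
          Category.assoc]
      rw [e₂, Category.assoc, tensorμ_natural_assoc, tensorHom_comp_tensorHom, id_tensorHom,
        id_tensorHom_id, Category.id_comp]
    _ = _ := by
      rw [MonObj.mul_one, tensorμ, braiding_tensorUnit_right, MonoidalCategory.tensorHom_def Δ[H],
        MonoidalCategory.tensorHom_def _ μ[H]]
      monoidal

end Antipode
section

variable {C : Type u} [Category.{v} C] [MonoidalCategory C] [SymmetricCategory C]

theorem braiding_tensor_tensorμ_braiding (A B X Y : C) :
    (β_ (A ⊗ B) (X ⊗ Y)).hom ≫ tensorμ X Y A B ≫ (β_ X A).hom ▷ (Y ⊗ B) =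
      𝟙 ((A ⊗ B) ⊗ (X ⊗ Y)) ⊗≫ A ◁ (β_ B (X ⊗ Y)).hom ⊗≫ 𝟙 _ := by
  rw [BraidedCategory.braiding_tensor_left_hom, tensorμ, BraidedCategory.braiding_tensor_right_hom A]
  calc _ = 𝟙 _ ⊗≫ A ◁ (β_ B (X ⊗ Y)).hom ⊗≫ (β_ A X).hom ▷ (Y ⊗ B) ⊗≫
        X ◁ ((β_ A Y).hom ≫ (β_ Y A).hom) ▷ B ⊗≫ (β_ X A).hom ▷ (Y ⊗ B) := by monoidal
    _ = 𝟙 _ ⊗≫ A ◁ (β_ B (X ⊗ Y)).hom ⊗≫ ((β_ A X).hom ≫ (β_ X A).hom) ▷ (Y ⊗ B) := by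
      rw [SymmetricCategory.symmetry]; monoidal
    _ = _ := by rw [SymmetricCategory.symmetry]; monoidal

variable (H Hd : C) [HopfObj H] [ExactPairing Hd H]

theorem braiding_dualAction :
    (β_ H Hd).hom ≫ dualAction H Hd = 𝒮[H] ▷ Hd ≫ actMate Hd Hd μ[H] := by
  rw [dualAction, ← BraidedCategory.braiding_naturality_left_assoc,
    SymmetricCategory.symmetry_assoc]

theorem dualAction_eq :
    dualAction H Hd = (β_ Hd H).hom ≫ 𝒮[H] ▷ Hd ≫ actMate Hd Hd μ[H] := by
  rw [← braiding_dualAction, SymmetricCategory.symmetry_assoc]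

/-- Tested against `x`, the coaction of `f·h` is `x₁ f(x₂ S(h))`, whereas `f₀·h₁ ⊗ f₁ h₂` gives `(x
S(h₁))₁ h₂ f((x S(h₁))₂)`. They agree by `comul_comp_mul_antipode`. -/
theorem isHopfModule_dualAction : IsHopfModule (dualAction H Hd) (comate Hd Hd Δ[H]) where
  action := isRightAction_dualAction H Hd
  coaction := isRightCoaction_comate H Hd
  compat := by
    have hr := comate_evaluation (X' := Hd) (Y' := Hd) Δ[H]
    have hL := actMate_evaluation (X' := Hd) (Y' := Hd) μ[H]
    have ha := dualAction_eq H Hd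
    -- After the symmetry the right action becomes translation by `S(h)` from the left, with no
    -- crossing left inside it.
    rw [← cancel_epi (β_ H Hd).hom, ← Category.assoc, braiding_dualAction]
    set r := comate Hd Hd Δ[H]
    set L := actMate Hd Hd μ[H]
    have hL' : H ◁ (𝒮[H] ▷ Hd ≫ L) ≫ ε_ Hd H =
        𝟙 _ ⊗≫ (H ◁ 𝒮[H] ≫ μ[H]) ▷ Hd ⊗≫ ε_ Hd H := by
      rw [MonoidalCategory.whiskerLeft_comp, Category.assoc, hL]; monoidal
    have key : (β_ H Hd).hom ≫ (r ⊗ₘ Δ[H]) ≫ tensorμ Hd H H H ≫ (dualAction H Hd ⊗ₘ μ[H]) =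
        Δ[H] ▷ Hd ⊗≫ H ◁ ((β_ H Hd).hom ≫ r ▷ H) ⊗≫ ((𝒮[H] ▷ Hd ≫ L) ⊗ₘ μ[H]) := by
      calc _ = (Δ[H] ⊗ₘ r) ≫ ((β_ (H ⊗ H) (Hd ⊗ H)).hom ≫ tensorμ Hd H H H ≫
            (β_ Hd H).hom ▷ (H ⊗ H)) ≫ ((𝒮[H] ▷ Hd ≫ L) ⊗ₘ μ[H]) := by
            rw [← BraidedCategory.braiding_naturality_assoc, ha]
            simp only [Category.assoc]
            rw [← tensorHom_id (β_ Hd H).hom, tensorHom_comp_tensorHom, Category.id_comp]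
        _ = Δ[H] ▷ Hd ⊗≫ H ◁ (H ◁ r ≫ (β_ H (Hd ⊗ H)).hom) ⊗≫ ((𝒮[H] ▷ Hd ≫ L) ⊗ₘ μ[H]) := by
          rw [braiding_tensor_tensorμ_braiding, MonoidalCategory.tensorHom_def Δ[H]]
          monoidal
        _ = _ := by rw [BraidedCategory.braiding_naturality_right]
    rw [key]
    apply ExactPairing.hom_ext_tensor' (X := H)
    calc _ = H ◁ (𝒮[H] ▷ Hd ≫ L) ≫ (H ◁ r ⊗≫ ε_ Hd H ▷ H ⊗≫ 𝟙 H) := by monoidal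
      _ = (H ◁ (𝒮[H] ▷ Hd ≫ L) ≫ Δ[H] ▷ Hd) ⊗≫ H ◁ ε_ Hd H ⊗≫ 𝟙 H := by rw [hr]; monoidal
      _ = 𝟙 _ ⊗≫ Δ[H] ▷ H ▷ Hd ⊗≫ H ◁ (H ◁ (𝒮[H] ▷ Hd ≫ L) ≫ ε_ Hd H) ⊗≫ 𝟙 H := by
        rw [whisker_exchange]; monoidal
      _ = 𝟙 _ ⊗≫ (Δ[H] ▷ H ≫ (α_ _ _ _).hom ≫ H ◁ (H ◁ 𝒮[H] ≫ μ[H])) ▷ Hd ⊗≫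
          H ◁ ε_ Hd H ⊗≫ 𝟙 H := by
        rw [hL']; monoidal
      _ = 𝟙 _ ⊗≫ H ◁ Δ[H] ▷ Hd ⊗≫ (H ◁ 𝒮[H] ≫ μ[H] ≫ Δ[H]) ▷ H ▷ Hd ⊗≫
          H ◁ ((β_ H H).hom ▷ Hd ⊗≫ H ◁ ε_ Hd H ⊗≫ 𝟙 H) ⊗≫ μ[H] := by
        rw [comul_comp_mul_antipode]
        calc _ = 𝟙 _ ⊗≫ H ◁ Δ[H] ▷ Hd ⊗≫ (H ◁ 𝒮[H] ≫ μ[H] ≫ Δ[H]) ▷ H ▷ Hd ⊗≫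
              H ◁ (β_ H H).hom ▷ Hd ⊗≫ (μ[H] ▷ (H ⊗ Hd) ≫ H ◁ ε_ Hd H) ⊗≫ 𝟙 H := by monoidal
          _ = _ := by rw [← whisker_exchange]; monoidal
      _ = 𝟙 _ ⊗≫ H ◁ Δ[H] ▷ Hd ⊗≫ (H ◁ 𝒮[H] ≫ μ[H] ≫ Δ[H]) ▷ (H ⊗ Hd) ⊗≫
          H ◁ (H ◁ (β_ H Hd).hom ⊗≫ ε_ Hd H ▷ H ⊗≫ 𝟙 H) ⊗≫ μ[H] := by
        rw [whiskerLeft_braiding_pairing]; monoidal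
      _ = 𝟙 _ ⊗≫ H ◁ Δ[H] ▷ Hd ⊗≫ ((H ◁ 𝒮[H] ≫ μ[H]) ▷ (H ⊗ Hd) ⊗≫ (Δ[H] ▷ (H ⊗ Hd) ≫
          (H ⊗ H) ◁ (β_ H Hd).hom)) ⊗≫ H ◁ ε_ Hd H ▷ H ⊗≫ μ[H] := by
        monoidal
      _ = 𝟙 _ ⊗≫ H ◁ Δ[H] ▷ Hd ⊗≫ (H ◁ 𝒮[H] ≫ μ[H]) ▷ (H ⊗ Hd) ⊗≫
          H ◁ (β_ H Hd).hom ⊗≫ (Δ[H] ▷ Hd ⊗≫ H ◁ ε_ Hd H ⊗≫ 𝟙 H) ▷ H ⊗≫ μ[H] := by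
        rw [← whisker_exchange]; monoidal
      _ = 𝟙 _ ⊗≫ H ◁ Δ[H] ▷ Hd ⊗≫ ((H ◁ 𝒮[H] ≫ μ[H]) ▷ (H ⊗ Hd) ≫
          H ◁ ((β_ H Hd).hom ≫ r ▷ H)) ⊗≫ ε_ Hd H ▷ (H ⊗ H) ⊗≫ μ[H] := by
        rw [← hr]; monoidal
      _ = 𝟙 _ ⊗≫ H ◁ (Δ[H] ▷ Hd ⊗≫ H ◁ ((β_ H Hd).hom ≫ r ▷ H)) ⊗≫
          (𝟙 (H ⊗ H ⊗ Hd) ⊗≫ (H ◁ 𝒮[H] ≫ μ[H]) ▷ Hd ⊗≫ ε_ Hd H) ▷ (H ⊗ H) ⊗≫ μ[H] := by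
        rw [← whisker_exchange]; monoidal
      _ = 𝟙 _ ⊗≫ H ◁ (Δ[H] ▷ Hd ⊗≫ H ◁ ((β_ H Hd).hom ≫ r ▷ H)) ⊗≫
          ((H ◁ (𝒮[H] ▷ Hd ≫ L) ≫ ε_ Hd H) ▷ (H ⊗ H) ≫ (𝟙_ C) ◁ μ[H]) ⊗≫ 𝟙 H := by
        rw [hL']; monoidal
      _ = _ := by
        rw [← whisker_exchange, MonoidalCategory.tensorHom_def' _ μ[H]]; monoidal

end
-- Invertibility of the antipode.
section

variable {C : Type u} [Category.{v} C] [MonoidalCategory C] [SymmetricCategory C]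
variable (H Hd : C) [HopfObj H] [ExactPairing Hd H]

/-- The trace of the endomorphism `ε ≫ η`, which factors through the unit object, is `η ≫ ε = 𝟙`. -/
theorem coevaluation_counit_one_evaluation :
    η_ Hd H ≫ Hd ◁ (ε[H] ≫ η[H]) ≫ (β_ Hd H).hom ≫ ε_ Hd H = 𝟙 (𝟙_ C) := by
  rw [MonoidalCategory.whiskerLeft_comp, Category.assoc,
    BraidedCategory.braiding_naturality_right_assoc, braiding_tensorUnit_right]
  symm
  calc _ = η[H] ≫ ε[H] := by rw [BimonObj.one_counit]
    _ = 𝟙 _ ⊗≫ η[H] ⊗≫ (H ◁ η_ Hd H ⊗≫ ε_ Hd H ▷ H) ⊗≫ ε[H] ⊗≫ 𝟙 (𝟙_ C) := by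
      rw [ExactPairing.coevaluation_evaluation'']; monoidal
    _ = 𝟙 _ ⊗≫ (η[H] ▷ 𝟙_ C ≫ H ◁ η_ Hd H) ⊗≫ (ε_ Hd H ▷ H ≫ 𝟙_ C ◁ ε[H]) ⊗≫ 𝟙 (𝟙_ C) := by
      monoidal
    _ = 𝟙 _ ⊗≫ η_ Hd H ⊗≫ (η[H] ▷ (Hd ⊗ H) ≫ H ◁ (Hd ◁ ε[H])) ⊗≫ ε_ Hd H ⊗≫ 𝟙 (𝟙_ C) := by
      rw [← whisker_exchange, ← whisker_exchange]; monoidal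
    _ = _ := by
      rw [← whisker_exchange]; monoidal

/-- In elements, `S(h₂) S²(h₁) = S(S(h₁) h₂) = ε(h) 1`. -/
theorem comul_braiding_antipode_antipode_sq :
    Δ[H] ≫ (β_ H H).hom ≫ 𝒮[H] ▷ H ≫ H ◁ (𝒮[H] ≫ 𝒮[H]) ≫ μ[H] = ε[H] ≫ η[H] := by
  calc _ = Δ[H] ≫ (β_ H H).hom ≫ H ◁ 𝒮[H] ≫ (𝒮[H] ⊗ₘ 𝒮[H]) ≫ μ[H] := by
        rw [MonoidalCategory.tensorHom_def, Category.assoc, whisker_exchange_assoc,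
          MonoidalCategory.whiskerLeft_comp, Category.assoc]
    _ = (Δ[H] ≫ 𝒮[H] ▷ H ≫ μ[H]) ≫ 𝒮[H] := by
      simp only [Category.assoc, HopfObj.mul_antipode,
        BraidedCategory.braiding_naturality_left_assoc, BraidedCategory.braiding_naturality_assoc]
    _ = _ := by rw [HopfObj.antipode_left, Category.assoc, HopfObj.one_antipode]

/-- With dual bases the trace is the sum of the `eⁱ₀(S(eᵢ) S²(eⁱ₁))`. Moving the coaction across the
coevaluation turns it into the sum of the `eⁱ(S(eᵢ₂) S²(eᵢ₁))`, which is the trace of `ε ≫ η`. -/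
theorem trace_coinvariants :
    (η_ Hd H ≫ (β_ Hd H).hom) ≫ H ◁ (actConv (comate Hd Hd Δ[H]) (dualAction H Hd) (𝟙 Hd) 𝒮[H] ≫
      mate Hd Hd 𝒮[H]) ≫ ε_ Hd H = 𝟙 (𝟙_ C) := by
  have hr : η_ Hd H ≫ comate Hd Hd Δ[H] ▷ H = _ := coevaluation_comate (X' := Hd) Δ[H]
  have hL := actMate_evaluation (X' := Hd) (Y' := Hd) μ[H]
  have ha := dualAction_eq H Hd
  set r := comate Hd Hd Δ[H]
  set L := actMate Hd Hd μ[H]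
  have h₁ : H ◁ (actConv r (dualAction H Hd) (𝟙 Hd) 𝒮[H] ≫ mate Hd Hd 𝒮[H]) ≫ ε_ Hd H =
      H ◁ (r ≫ (β_ Hd H).hom) ⊗≫ (𝒮[H] ▷ H ≫ H ◁ (𝒮[H] ≫ 𝒮[H]) ≫ μ[H]) ▷ Hd ⊗≫ ε_ Hd H := by
    rw [actConv, ha, MonoidalCategory.whiskerLeft_comp _ _ (mate Hd Hd 𝒮[H]), Category.assoc,
      mate_evaluation, whisker_exchange_assoc, BraidedCategory.braiding_naturality_right_assoc]
    calc _ = 𝒮[H] ▷ Hd ≫ H ◁ (r ≫ (β_ Hd H).hom ≫ (𝒮[H] ≫ 𝒮[H]) ▷ Hd) ≫ (H ◁ L ≫ ε_ Hd H) := by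
          monoidal
      _ = 𝟙 _ ⊗≫ (𝒮[H] ▷ Hd ≫ H ◁ (r ≫ (β_ Hd H).hom)) ⊗≫
          ((H ◁ (𝒮[H] ≫ 𝒮[H])) ≫ μ[H]) ▷ Hd ⊗≫ ε_ Hd H := by
        rw [hL]; monoidal
      _ = _ := by rw [← whisker_exchange]; monoidal
  rw [h₁]
  set g := 𝒮[H] ▷ H ≫ H ◁ (𝒮[H] ≫ 𝒮[H]) ≫ μ[H] with hg
  calc _ = η_ Hd H ≫ ((β_ Hd H).hom ≫ H ◁ r) ≫ H ◁ (β_ Hd H).hom ⊗≫ g ▷ Hd ⊗≫ ε_ Hd H := by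
        monoidal
    _ = (η_ Hd H ≫ r ▷ H) ≫ (β_ (Hd ⊗ H) H).hom ≫ H ◁ (β_ Hd H).hom ⊗≫ g ▷ Hd ⊗≫ ε_ Hd H := by
      rw [← BraidedCategory.braiding_naturality_left]; monoidal
    _ = η_ Hd H ≫ Hd ◁ Δ[H] ≫ Hd ◁ (β_ H H).hom ≫ (β_ Hd (H ⊗ H)).hom ≫ g ▷ Hd ≫ ε_ Hd H := by
      rw [hr, BraidedCategory.braiding_tensor_left_hom, BraidedCategory.braiding_tensor_right_hom]
      monoidal
    _ = η_ Hd H ≫ Hd ◁ (Δ[H] ≫ (β_ H H).hom ≫ g) ≫ (β_ Hd H).hom ≫ ε_ Hd H := by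
      rw [← BraidedCategory.braiding_naturality_right_assoc]; monoidal
    _ = _ := by
      rw [hg, comul_braiding_antipode_antipode_sq, coevaluation_counit_one_evaluation]

/-- On coinvariants the action can be undone by the coaction followed by the projection, and the
action of `h` involves only `S(h)`. Closing the dual strand of the resulting identity yields the
retraction, normalised by `trace_coinvariants`. -/
theorem exists_antipode_comp_eq_id (H Hd : C) [HopfObj H] [ExactPairing Hd H] : ∃ T : H ⟶ H, 𝒮[H] ≫ T = 𝟙 H := by
  have ht := trace_coinvariants H Hd
  have hM := (isHopfModule_dualAction H Hd).coinvariants_action_coaction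
  set a := dualAction H Hd with ha
  set r := comate Hd Hd Δ[H]
  set P := actConv r a (𝟙 Hd) 𝒮[H]
  set Q := mate Hd Hd 𝒮[H]
  set t := η_ Hd H ≫ (β_ Hd H).hom
  set L := actMate Hd Hd μ[H]
  -- The map `w` uses the translation without `S`, so that precomposing with `S` restores the Hopf
  -- module action and `hM` applies. The factor `Q` is there to make the trace equal to `1`.
  let w : Hd ⊗ H ⟶ Hd ⊗ H := P ▷ H ≫ ((β_ Hd H).hom ≫ L) ≫ r ≫ P ▷ H ≫ Q ▷ H
  have hw : Hd ◁ 𝒮[H] ≫ w = P ▷ H ≫ Q ▷ H := by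
    have : Hd ◁ 𝒮[H] ≫ w = (P ▷ H ≫ a ≫ r ≫ P ▷ H) ≫ Q ▷ H := by
      simp only [w, ha, dualAction, Category.assoc, whisker_exchange_assoc]; rfl
    rw [this, hM]
  refine ⟨(λ_ H).inv ≫ t ▷ H ≫ (α_ _ _ _).hom ≫ H ◁ w ≫ (α_ _ _ _).inv ≫ ε_ Hd H ▷ H ≫
    (λ_ H).hom, ?_⟩
  calc _ = 𝟙 _ ⊗≫ (𝟙_ C ◁ 𝒮[H] ≫ t ▷ H) ⊗≫ H ◁ w ⊗≫ ε_ Hd H ▷ H ⊗≫ 𝟙 _ := by monoidal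
    _ = 𝟙 _ ⊗≫ t ▷ H ⊗≫ H ◁ (Hd ◁ 𝒮[H] ≫ w) ⊗≫ ε_ Hd H ▷ H ⊗≫ 𝟙 _ := by
      rw [whisker_exchange]; monoidal
    _ = 𝟙 _ ⊗≫ (t ≫ H ◁ (P ≫ Q) ≫ ε_ Hd H) ▷ H ⊗≫ 𝟙 _ := by rw [hw]; monoidal
    _ = _ := by rw [ht]; monoidal

/-- The antipode of a Hopf object with a dual is an isomorphism. -/
theorem isIso_antipode (H Hd : C) [HopfObj H] [ExactPairing Hd H] : IsIso 𝒮[H] := by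
  obtain ⟨T, hT⟩ := exists_antipode_comp_eq_id H Hd
  -- The antipode of the dual Hopf algebra is the transpose of `S`, and transposition reverses
  -- composition: a retraction there is a section of `S` here.
  obtain ⟨T', hT'⟩ : ∃ T' : Hd ⟶ Hd, mate Hd Hd 𝒮[H] ≫ T' = 𝟙 Hd := by
    let := dualHopfObj H Hd
    let : ExactPairing H Hd := BraidedCategory.exactPairing_swap Hd H
    exact exists_antipode_comp_eq_id Hd H
  obtain ⟨T₂, rfl⟩ := mate_surjective (X := H) (Y := H) T'
  have h : T₂ ≫ 𝒮[H] = 𝟙 H := by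
    apply mate_injective (X' := Hd) (Y' := Hd)
    rw [mate_comp (Y' := Hd), hT', mate_id]
  have : T₂ = T := by
    rw [← Category.comp_id T₂, ← hT, ← Category.assoc, h, Category.id_comp]
  exact ⟨T, hT, this ▸ h⟩

end
-- Comonoid morphisms.
section ComonHom

variable {C : Type u} [Category.{v} C] [MonoidalCategory C]

attribute [local instance] ComonObj.instTensorUnit

theorem comul_tensorUnit : Δ[𝟙_ C] = (λ_ (𝟙_ C)).inv := rfl

theorem counit_tensorUnit : ε[𝟙_ C] = 𝟙 (𝟙_ C) := rfl

section

variable [BraidedCategory C] {W X Y Z : C} [ComonObj W] [ComonObj X] [ComonObj Y] [ComonObj Z]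

instance IsComonHom.tensorHom (f : W ⟶ X) (g : Y ⟶ Z) [IsComonHom f] [IsComonHom g] :
    IsComonHom (f ⊗ₘ g) where
  hom_counit := by
    simp only [Comon.tensorObj_counit, tensorHom_comp_tensorHom_assoc, IsComonHom.hom_counit]
  hom_comul := by
    simp only [Comon.tensorObj_comul, tensorHom_comp_tensorHom_assoc, IsComonHom.hom_comul]
    rw [← tensorHom_comp_tensorHom_assoc, tensorμ_natural, Category.assoc]

instance IsComonHom.whiskerLeft (g : Y ⟶ Z) [IsComonHom g] : IsComonHom (X ◁ g) := by
  rw [← id_tensorHom]; infer_instance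

instance IsComonHom.whiskerRight (g : Y ⟶ Z) [IsComonHom g] : IsComonHom (g ▷ X) := by
  rw [← tensorHom_id]; infer_instance

instance IsComonHom.associator_hom : IsComonHom (α_ X Y Z).hom where
  hom_counit := by simp only [Comon.tensorObj_counit]; monoidal
  hom_comul := by
    simp only [Comon.tensorObj_comul, Category.assoc]
    calc _ = (α_ _ _ _).hom ≫ (Δ[X] ⊗ₘ (Δ[Y] ⊗ₘ Δ[Z])) ≫ (X ⊗ X) ◁ tensorμ Y Y Z Z ≫ tensorμ _ _ _ _ := by
          rw [← id_tensorHom (X ⊗ X), tensorHom_comp_tensorHom_assoc, Category.comp_id]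
      _ = ((Δ[X] ⊗ₘ Δ[Y]) ⊗ₘ Δ[Z]) ≫ tensorμ X X Y Y ▷ (Z ⊗ Z) ≫ tensorμ _ _ _ _ ≫
          ((α_ _ _ _).hom ⊗ₘ (α_ _ _ _).hom) := by
        rw [tensor_associativity, associator_naturality_assoc]
      _ = _ := by
        rw [← tensorHom_id, tensorHom_comp_tensorHom_assoc, Category.comp_id]

instance IsComonHom.leftUnitor_hom : IsComonHom (λ_ X).hom where
  hom_counit := by simp only [Comon.tensorObj_counit, counit_tensorUnit]; monoidal
  hom_comul := by
    simp only [Comon.tensorObj_comul, comul_tensorUnit, tensorμ, braiding_tensorUnit_left]; monoidal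

instance IsComonHom.rightUnitor_hom : IsComonHom (ρ_ X).hom where
  hom_counit := by simp only [Comon.tensorObj_counit, counit_tensorUnit]; monoidal
  hom_comul := by
    simp only [Comon.tensorObj_comul, comul_tensorUnit, tensorμ, braiding_tensorUnit_right]
    monoidal

instance IsComonHom.counit : IsComonHom ε[X] where
  hom_counit := Category.comp_id _
  hom_comul := by
    rw [comul_tensorUnit, ComonObj.counit_comul_hom]

instance IsComonHom.one {A : C} [BimonObj A] : IsComonHom η[A] where
  hom_counit := BimonObj.one_counit A
  hom_comul := by
    rw [BimonObj.one_comul]; rfl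

instance IsComonHom.mul {A : C} [BimonObj A] : IsComonHom μ[A] where
  hom_counit := by rw [BimonObj.mul_counit, Comon.tensorObj_counit]
  hom_comul := by
    rw [BimonObj.mul_comul, Comon.tensorObj_comul, Category.assoc]

end

section

variable [SymmetricCategory C]

/-- The symmetry is compatible with the interchange of the middle factors; this makes the symmetry
of two comonoids a comonoid morphism. -/
theorem braiding_tensorμ (X₁ X₂ Y₁ Y₂ : C) :
    (β_ (X₁ ⊗ X₂) (Y₁ ⊗ Y₂)).hom ≫ tensorμ Y₁ Y₂ X₁ X₂ =
      tensorμ X₁ X₂ Y₁ Y₂ ≫ ((β_ X₁ Y₁).hom ⊗ₘ (β_ X₂ Y₂).hom) := by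
  rw [← cancel_mono ((β_ Y₁ X₁).hom ▷ (Y₂ ⊗ X₂)), Category.assoc, Category.assoc,
    braiding_tensor_tensorμ_braiding, ← tensorHom_id, tensorHom_comp_tensorHom,
    SymmetricCategory.symmetry, Category.comp_id, id_tensorHom, tensorμ,
    BraidedCategory.braiding_tensor_right_hom]
  monoidal

instance IsComonHom.braiding (X Y : C) [ComonObj X] [ComonObj Y] : IsComonHom (β_ X Y).hom where
  hom_counit := by
    simp only [Comon.tensorObj_counit, ← BraidedCategory.braiding_naturality_assoc]
    rw [braiding_tensorUnit_left, unitors_equal]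
    monoidal
  hom_comul := by
    simp only [Comon.tensorObj_comul, ← BraidedCategory.braiding_naturality_assoc, braiding_tensorμ,
      Category.assoc]

end

end ComonHom

/-! ### Distributive laws between monoids. -/

section Bicrossed

variable {C : Type u} [Category.{v} C] [MonoidalCategory C]

/-- `Ψ` is a distributive law between the monoids `A` and `B`. -/
structure IsDistributiveLaw {A B : C} [MonObj A] [MonObj B] (Ψ : B ⊗ A ⟶ A ⊗ B) : Prop where
  mul_left : μ[B] ▷ A ≫ Ψ = 𝟙 _ ⊗≫ B ◁ Ψ ⊗≫ Ψ ▷ B ⊗≫ A ◁ μ[B]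
  mul_right : B ◁ μ[A] ≫ Ψ = 𝟙 _ ⊗≫ Ψ ▷ A ⊗≫ A ◁ Ψ ⊗≫ μ[A] ▷ B
  one_left : η[B] ▷ A ≫ Ψ = 𝟙 _ ⊗≫ A ◁ η[B]
  one_right : B ◁ η[A] ≫ Ψ = 𝟙 _ ⊗≫ η[A] ▷ B

/-- The product of `A ⊗ B` determined by `Ψ`. -/
def bicrossedMul {A B : C} [MonObj A] [MonObj B] (Ψ : B ⊗ A ⟶ A ⊗ B) :
    (A ⊗ B) ⊗ (A ⊗ B) ⟶ A ⊗ B :=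
  𝟙 ((A ⊗ B) ⊗ (A ⊗ B)) ⊗≫ A ◁ Ψ ▷ B ⊗≫ (μ[A] ⊗ₘ μ[B])

variable {A B : C} [MonObj A] [MonObj B] {Ψ : B ⊗ A ⟶ A ⊗ B}

theorem bicrossedMul_eq :
    bicrossedMul Ψ = 𝟙 _ ⊗≫ A ◁ Ψ ▷ B ⊗≫ μ[A] ▷ B ▷ B ⊗≫ A ◁ μ[B] := by
  rw [bicrossedMul, MonoidalCategory.tensorHom_def]; monoidal

theorem bicrossedMul_eq' :
    bicrossedMul Ψ = 𝟙 _ ⊗≫ A ◁ Ψ ▷ B ⊗≫ A ◁ A ◁ μ[B] ⊗≫ μ[A] ▷ B := by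
  rw [bicrossedMul, MonoidalCategory.tensorHom_def']; monoidal

namespace IsDistributiveLaw

theorem one_bicrossedMul (h : IsDistributiveLaw Ψ) :
    (𝟙 _ ⊗≫ (η[A] ⊗ₘ η[B])) ▷ (A ⊗ B) ≫ bicrossedMul Ψ = (λ_ (A ⊗ B)).hom := by
  rw [bicrossedMul_eq, MonoidalCategory.tensorHom_def]
  calc _ = 𝟙 _ ⊗≫ η[A] ▷ (A ⊗ B) ⊗≫ A ◁ (η[B] ▷ A ≫ Ψ) ▷ B ⊗≫ μ[A] ▷ B ▷ B ⊗≫ A ◁ μ[B] := by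
        monoidal
    _ = 𝟙 _ ⊗≫ η[A] ▷ (A ⊗ B) ⊗≫ (A ⊗ A) ◁ η[B] ▷ B ⊗≫ μ[A] ▷ B ▷ B ⊗≫ A ◁ μ[B] := by
      rw [h.one_left]; monoidal
    _ = 𝟙 _ ⊗≫ η[A] ▷ (A ⊗ B) ⊗≫ ((A ⊗ A) ◁ η[B] ≫ μ[A] ▷ B) ▷ B ⊗≫ A ◁ μ[B] := by
      monoidal
    _ = 𝟙 _ ⊗≫ (η[A] ▷ A ≫ μ[A]) ▷ B ⊗≫ A ◁ (η[B] ▷ B ≫ μ[B]) := by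
      rw [whisker_exchange]; monoidal
    _ = _ := by rw [MonObj.one_mul, MonObj.one_mul]; monoidal

theorem bicrossedMul_one (h : IsDistributiveLaw Ψ) :
    (A ⊗ B) ◁ (𝟙 _ ⊗≫ (η[A] ⊗ₘ η[B])) ≫ bicrossedMul Ψ = (ρ_ (A ⊗ B)).hom := by
  rw [bicrossedMul_eq, MonoidalCategory.tensorHom_def']
  calc _ = 𝟙 _ ⊗≫ (A ⊗ B) ◁ η[B] ⊗≫ A ◁ (B ◁ η[A] ≫ Ψ) ▷ B ⊗≫ μ[A] ▷ B ▷ B ⊗≫ A ◁ μ[B] := by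
        monoidal
    _ = 𝟙 _ ⊗≫ A ◁ (B ◁ η[B]) ⊗≫ A ◁ η[A] ▷ B ▷ B ⊗≫ μ[A] ▷ B ▷ B ⊗≫ A ◁ μ[B] := by
      rw [h.one_right]; monoidal
    _ = 𝟙 _ ⊗≫ A ◁ (B ◁ η[B]) ⊗≫ (A ◁ η[A] ≫ μ[A]) ▷ B ▷ B ⊗≫ A ◁ μ[B] := by
      monoidal
    _ = 𝟙 _ ⊗≫ A ◁ (B ◁ η[B] ≫ μ[B]) := by
      rw [MonObj.mul_one]; monoidal
    _ = _ := by rw [MonObj.mul_one]; monoidal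

/-- Both bracketings have the same normal form: three crossings `Ψ` followed by products in `A` and
`B`. The law `mul_left` expands one side and `mul_right` the other. -/
theorem bicrossedMul_assoc (h : IsDistributiveLaw Ψ) :
    bicrossedMul Ψ ▷ (A ⊗ B) ≫ bicrossedMul Ψ =
      (α_ _ _ _).hom ≫ (A ⊗ B) ◁ bicrossedMul Ψ ≫ bicrossedMul Ψ := by
  calc _ = 𝟙 _ ⊗≫ A ◁ Ψ ▷ B ▷ A ▷ B ⊗≫ μ[A] ▷ (B ⊗ B ⊗ A ⊗ B) ⊗≫ A ◁ (μ[B] ▷ A ≫ Ψ) ▷ B ⊗≫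
        μ[A] ▷ B ▷ B ⊗≫ A ◁ μ[B] := by
        rw [bicrossedMul_eq]; monoidal
    _ = 𝟙 _ ⊗≫ A ◁ Ψ ▷ B ▷ A ▷ B ⊗≫ (μ[A] ▷ (B ⊗ (B ⊗ A)) ≫ A ◁ (B ◁ Ψ)) ▷ B ⊗≫
        A ◁ Ψ ▷ B ▷ B ⊗≫ (A ◁ (A ◁ μ[B]) ≫ A ◁ (𝟙 (A ⊗ B))) ▷ B ⊗≫
        μ[A] ▷ B ▷ B ⊗≫ A ◁ μ[B] := by
      rw [h.mul_left]; monoidal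
    _ = 𝟙 _ ⊗≫ A ◁ Ψ ▷ B ▷ A ▷ B ⊗≫ A ◁ A ◁ B ◁ Ψ ▷ B ⊗≫ (μ[A] ▷ (B ⊗ A) ≫ A ◁ Ψ) ▷ (B ⊗ B) ⊗≫
        ((A ⊗ A) ◁ μ[B] ≫ μ[A] ▷ B) ▷ B ⊗≫ A ◁ μ[B] := by
      rw [← whisker_exchange μ[A] (B ◁ Ψ)]; monoidal
    _ = 𝟙 _ ⊗≫ A ◁ Ψ ▷ B ▷ A ▷ B ⊗≫ A ◁ A ◁ B ◁ Ψ ▷ B ⊗≫ A ◁ A ◁ Ψ ▷ B ▷ B ⊗≫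
        (μ[A] ▷ A ≫ μ[A]) ▷ B ▷ B ▷ B ⊗≫ A ◁ (μ[B] ▷ B ≫ μ[B]) := by
      rw [← whisker_exchange μ[A] Ψ, whisker_exchange μ[A] μ[B]]; monoidal
    _ = 𝟙 _ ⊗≫ A ◁ Ψ ▷ B ▷ A ▷ B ⊗≫ A ◁ A ◁ B ◁ Ψ ▷ B ⊗≫ A ◁ A ◁ Ψ ▷ B ▷ B ⊗≫
        A ◁ μ[A] ▷ B ▷ B ▷ B ⊗≫ (μ[A] ▷ (B ⊗ (B ⊗ B)) ≫ A ◁ (B ◁ μ[B])) ⊗≫ A ◁ μ[B] := by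
      rw [MonObj.mul_assoc, MonObj.mul_assoc]; monoidal
    _ = 𝟙 _ ⊗≫ A ◁ (Ψ ▷ (B ⊗ A) ≫ (A ⊗ B) ◁ Ψ) ▷ B ⊗≫ A ◁ A ◁ Ψ ▷ B ▷ B ⊗≫
        A ◁ (μ[A] ▷ (B ⊗ (B ⊗ B)) ⊗≫ A ◁ (B ◁ μ[B])) ⊗≫ μ[A] ▷ (B ⊗ B) ⊗≫ A ◁ μ[B] := by
      rw [← whisker_exchange μ[A] (B ◁ μ[B])]; monoidal
    _ = 𝟙 _ ⊗≫ A ◁ (Ψ ▷ (B ⊗ A) ≫ (A ⊗ B) ◁ Ψ) ▷ B ⊗≫ A ◁ A ◁ Ψ ▷ B ▷ B ⊗≫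
        A ◁ (μ[A] ▷ (B ⊗ (B ⊗ B)) ≫ A ◁ (B ◁ μ[B])) ⊗≫ μ[A] ▷ (B ⊗ B) ⊗≫ A ◁ μ[B] := by
      monoidal
    _ = 𝟙 _ ⊗≫ A ◁ B ◁ A ◁ Ψ ▷ B ⊗≫ A ◁ Ψ ▷ A ▷ B ▷ B ⊗≫ A ◁ (A ◁ Ψ ▷ (B ⊗ B) ⊗≫ (A ⊗ A) ◁ B ◁ μ[B]) ⊗≫
        A ◁ μ[A] ▷ B ▷ B ⊗≫ μ[A] ▷ (B ⊗ B) ⊗≫ A ◁ μ[B] := by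
      rw [← whisker_exchange Ψ Ψ, ← whisker_exchange μ[A] (B ◁ μ[B])]; monoidal
    _ = 𝟙 _ ⊗≫ A ◁ B ◁ A ◁ Ψ ▷ B ⊗≫ A ◁ Ψ ▷ A ▷ B ▷ B ⊗≫ A ◁ A ◁ (Ψ ▷ (B ⊗ B) ≫ (A ⊗ B) ◁ μ[B]) ⊗≫
        A ◁ μ[A] ▷ B ▷ B ⊗≫ μ[A] ▷ (B ⊗ B) ⊗≫ A ◁ μ[B] := by
      monoidal
    _ = 𝟙 _ ⊗≫ A ◁ B ◁ A ◁ Ψ ▷ B ⊗≫ A ◁ (Ψ ▷ (A ⊗ B ⊗ B) ≫ (A ⊗ B) ◁ (A ◁ μ[B])) ⊗≫ A ◁ A ◁ Ψ ▷ B ⊗≫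
        A ◁ μ[A] ▷ B ▷ B ⊗≫ μ[A] ▷ (B ⊗ B) ⊗≫ A ◁ μ[B] := by
      rw [← whisker_exchange Ψ μ[B]]; monoidal
    _ = 𝟙 _ ⊗≫ A ◁ B ◁ A ◁ Ψ ▷ B ⊗≫ A ◁ B ◁ A ◁ A ◁ μ[B] ⊗≫ A ◁ (B ◁ μ[A] ≫ Ψ) ▷ B ⊗≫
        μ[A] ▷ (B ⊗ B) ⊗≫ A ◁ μ[B] := by
      rw [← whisker_exchange Ψ (A ◁ μ[B]), h.mul_right]; monoidal
    _ = _ := by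
      nth_rw 1 [bicrossedMul_eq']
      rw [bicrossedMul_eq]; monoidal

/-- The factorisation `a ⊗ b = (a ⊗ 1)(1 ⊗ b)`, from which the antipode is built. -/
theorem inl_inr_bicrossedMul (h : IsDistributiveLaw Ψ) :
    (((ρ_ A).inv ≫ A ◁ η[B]) ⊗ₘ ((λ_ B).inv ≫ η[A] ▷ B)) ≫ bicrossedMul Ψ = 𝟙 (A ⊗ B) := by
  rw [bicrossedMul_eq, MonoidalCategory.tensorHom_def]
  calc _ = 𝟙 _ ⊗≫ A ◁ (η[B] ▷ 𝟙_ C ≫ B ◁ η[A]) ▷ B ⊗≫ A ◁ Ψ ▷ B ⊗≫ μ[A] ▷ B ▷ B ⊗≫ A ◁ μ[B] := by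
        monoidal
    _ = 𝟙 _ ⊗≫ A ◁ η[A] ▷ B ⊗≫ A ◁ (η[B] ▷ A ≫ Ψ) ▷ B ⊗≫ μ[A] ▷ B ▷ B ⊗≫ A ◁ μ[B] := by
      rw [← whisker_exchange]; monoidal
    _ = 𝟙 _ ⊗≫ A ◁ η[A] ▷ B ⊗≫ ((A ⊗ A) ◁ η[B] ≫ μ[A] ▷ B) ▷ B ⊗≫ A ◁ μ[B] := by
      rw [h.one_left]; monoidal
    _ = 𝟙 _ ⊗≫ (A ◁ η[A] ≫ μ[A]) ▷ B ⊗≫ A ◁ (η[B] ▷ B ≫ μ[B]) := by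
      rw [whisker_exchange]; monoidal
    _ = _ := by rw [MonObj.mul_one, MonObj.one_mul]; monoidal

/-- The product `(1 ⊗ b)(a ⊗ 1)` is `Ψ` itself; only the unit laws of `A` and `B` enter. -/
theorem inr_inl_bicrossedMul (Ψ : B ⊗ A ⟶ A ⊗ B) :
    (((λ_ B).inv ≫ η[A] ▷ B) ⊗ₘ ((ρ_ A).inv ≫ A ◁ η[B])) ≫ bicrossedMul Ψ = Ψ := by
  rw [bicrossedMul_eq, MonoidalCategory.tensorHom_def]
  calc _ = 𝟙 _ ⊗≫ η[A] ▷ (B ⊗ A) ⊗≫ A ◁ ((B ⊗ A) ◁ η[B] ≫ Ψ ▷ B) ⊗≫ μ[A] ▷ B ▷ B ⊗≫ A ◁ μ[B] := by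
        monoidal
    _ = 𝟙 _ ⊗≫ (η[A] ▷ (B ⊗ A) ≫ A ◁ Ψ) ⊗≫ ((A ⊗ A) ◁ (B ◁ η[B]) ≫ μ[A] ▷ (B ⊗ B)) ⊗≫ A ◁ μ[B] := by
      rw [whisker_exchange]; monoidal
    _ = 𝟙 _ ⊗≫ Ψ ⊗≫ (η[A] ▷ A ≫ μ[A]) ▷ B ⊗≫ A ◁ (B ◁ η[B] ≫ μ[B]) := by
      rw [whisker_exchange, ← whisker_exchange η[A] Ψ]; monoidal
    _ = _ := by rw [MonObj.mul_one, MonObj.one_mul]; monoidal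

theorem inl_inl_bicrossedMul (h : IsDistributiveLaw Ψ) :
    (((ρ_ A).inv ≫ A ◁ η[B]) ⊗ₘ ((ρ_ A).inv ≫ A ◁ η[B])) ≫ bicrossedMul Ψ =
      μ[A] ≫ (ρ_ A).inv ≫ A ◁ η[B] := by
  rw [bicrossedMul_eq, MonoidalCategory.tensorHom_def']
  calc _ = 𝟙 _ ⊗≫ (A ⊗ A) ◁ η[B] ⊗≫ A ◁ (η[B] ▷ A ≫ Ψ) ▷ B ⊗≫ μ[A] ▷ B ▷ B ⊗≫ A ◁ μ[B] := by
        monoidal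
    _ = 𝟙 _ ⊗≫ (A ⊗ A) ◁ η[B] ⊗≫ ((A ⊗ A) ◁ η[B] ≫ μ[A] ▷ B) ▷ B ⊗≫ A ◁ μ[B] := by
      rw [h.one_left]; monoidal
    _ = 𝟙 _ ⊗≫ ((A ⊗ A) ◁ η[B] ≫ μ[A] ▷ B) ⊗≫ A ◁ (η[B] ▷ B ≫ μ[B]) := by
      have e : (A ⊗ A) ◁ η[B] ≫ μ[A] ▷ B = _ := whisker_exchange μ[A] η[B]
      calc _ = 𝟙 _ ⊗≫ (A ⊗ A) ◁ η[B] ⊗≫ μ[A] ▷ B ⊗≫ A ◁ η[B] ▷ B ⊗≫ A ◁ μ[B] := by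
            rw [e]; monoidal
        _ = _ := by monoidal
    _ = _ := by rw [whisker_exchange, MonObj.one_mul]; monoidal

theorem inr_inr_bicrossedMul (h : IsDistributiveLaw Ψ) :
    (((λ_ B).inv ≫ η[A] ▷ B) ⊗ₘ ((λ_ B).inv ≫ η[A] ▷ B)) ≫ bicrossedMul Ψ =
      μ[B] ≫ (λ_ B).inv ≫ η[A] ▷ B := by
  rw [bicrossedMul_eq, MonoidalCategory.tensorHom_def]
  calc _ = 𝟙 _ ⊗≫ η[A] ▷ (B ⊗ B) ⊗≫ A ◁ (B ◁ η[A] ≫ Ψ) ▷ B ⊗≫ μ[A] ▷ B ▷ B ⊗≫ A ◁ μ[B] := by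
        monoidal
    _ = 𝟙 _ ⊗≫ η[A] ▷ (B ⊗ B) ⊗≫ (A ◁ η[A] ≫ μ[A]) ▷ B ▷ B ⊗≫ A ◁ μ[B] := by
      rw [h.one_right]; monoidal
    _ = 𝟙 _ ⊗≫ (η[A] ▷ (B ⊗ B) ≫ A ◁ μ[B]) := by
      rw [MonObj.mul_one]; monoidal
    _ = _ := by rw [← whisker_exchange]; monoidal

end IsDistributiveLaw

end Bicrossed

/-! ### Convolution and convolution inverses. -/

section Convolution

variable {C : Type u} [Category.{v} C] [MonoidalCategory C]

/-- The convolution product of morphisms from a comonoid to a monoid. -/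
def convMul {M N : C} [ComonObj M] [MonObj N] (f g : M ⟶ N) : M ⟶ N := Δ[M] ≫ (f ⊗ₘ g) ≫ μ[N]

infixl:75 "⊛" => convMul

variable {M M' N N' : C} [ComonObj M] [ComonObj M'] [MonObj N] [MonObj N']

theorem convMul_eq (f g : M ⟶ N) : f ⊛ g = Δ[M] ≫ f ▷ M ≫ N ◁ g ≫ μ[N] := by
  rw [convMul, MonoidalCategory.tensorHom_def, Category.assoc]

theorem convMul_assoc (f g h : M ⟶ N) : (f ⊛ g) ⊛ h = f ⊛ (g ⊛ h) := by
  simp only [convMul_eq]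
  exact mul_assoc (G := Conv M N) f g h

theorem one_convMul (f : M ⟶ N) : (ε[M] ≫ η[N]) ⊛ f = f := by
  rw [convMul_eq]
  exact one_mul (M := Conv M N) f

theorem comp_convMul (p : M' ⟶ M) [IsComonHom p] (f g : M ⟶ N) :
    p ≫ (f ⊛ g) = (p ≫ f) ⊛ (p ≫ g) := by
  simp only [convMul, IsComonHom.hom_comul_assoc, tensorHom_comp_tensorHom_assoc]

theorem convMul_comp (i : N ⟶ N') [IsMonHom i] (f g : M ⟶ N) :
    (f ⊛ g) ≫ i = (f ≫ i) ⊛ (g ≫ i) := by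
  simp only [convMul, Category.assoc, IsMonHom.mul_hom, tensorHom_comp_tensorHom_assoc]

theorem comp_convOne (p : M' ⟶ M) [IsComonHom p] : p ≫ ε[M] ≫ η[N] = ε[M'] ≫ η[N] := by
  rw [IsComonHom.hom_counit_assoc]

theorem convOne_comp (i : N ⟶ N') [IsMonHom i] : (ε[M] ≫ η[N]) ≫ i = ε[M] ≫ η[N'] := by
  rw [Category.assoc, IsMonHom.one_hom]

/-- `g` is a convolution inverse of `f`. -/
structure IsConvInv (f g : M ⟶ N) : Prop where
  mul_inv : f ⊛ g = ε[M] ≫ η[N]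
  inv_mul : g ⊛ f = ε[M] ≫ η[N]

namespace IsConvInv

variable {f g f' g' : M ⟶ N}

theorem mul (h : IsConvInv f g) (h' : IsConvInv f' g') : IsConvInv (f ⊛ f') (g' ⊛ g) where
  mul_inv := by
    rw [convMul_assoc, ← convMul_assoc f', h'.mul_inv, one_convMul, h.mul_inv]
  inv_mul := by
    rw [convMul_assoc, ← convMul_assoc g, h.inv_mul, one_convMul, h'.inv_mul]

theorem comp (h : IsConvInv f g) (p : M' ⟶ M) [IsComonHom p] (i : N ⟶ N') [IsMonHom i] :
    IsConvInv (p ≫ f ≫ i) (p ≫ g ≫ i) where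
  mul_inv := by
    rw [← comp_convMul, ← convMul_comp, h.mul_inv, convOne_comp, comp_convOne]
  inv_mul := by
    rw [← comp_convMul, ← convMul_comp, h.inv_mul, convOne_comp, comp_convOne]

theorem mul_left_cancel (h : IsConvInv f g) {k k' : M ⟶ N} (e : f ⊛ k = f ⊛ k') : k = k' := by
  rw [← one_convMul k, ← h.inv_mul, convMul_assoc, e, ← convMul_assoc, h.inv_mul, one_convMul]

end IsConvInv

theorem isConvInv_antipode {C : Type u} [Category.{v} C] [MonoidalCategory C] [BraidedCategory C]
    (A : C) [HopfObj A] : IsConvInv (𝟙 A) 𝒮[A] where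
  mul_inv := by
    rw [convMul_eq, id_whiskerRight, Category.id_comp, HopfObj.antipode_right]
  inv_mul := by
    rw [convMul_eq, MonoidalCategory.whiskerLeft_id, Category.id_comp, HopfObj.antipode_left]

end Convolution

/-! ### The Hopf algebra structure on a bicrossed product. -/

section

variable {C : Type u} [Category.{v} C] [MonoidalCategory C] [SymmetricCategory C]

section

variable (A B : C) [ComonObj A] [ComonObj B]

attribute [local instance] ComonObj.instTensorUnit

instance isComonHom_fst : IsComonHom (A ◁ ε[B] ≫ (ρ_ A).hom) := inferInstance

instance isComonHom_snd : IsComonHom (ε[A] ▷ B ≫ (λ_ B).hom) := inferInstance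

theorem comul_fst_snd :
    Δ[A ⊗ B] ≫ ((A ◁ ε[B] ≫ (ρ_ A).hom) ⊗ₘ (ε[A] ▷ B ≫ (λ_ B).hom)) = 𝟙 (A ⊗ B) := by
  rw [Comon.tensorObj_comul, ← id_tensorHom, ← tensorHom_id, ← tensorHom_comp_tensorHom,
    Category.assoc, ← tensorμ_natural_assoc, tensorHom_comp_tensorHom_assoc, id_tensorHom,
    tensorHom_id, ComonObj.counit_comul, ComonObj.comul_counit, tensorμ, braiding_tensorUnit_left]
  monoidal

theorem comul_snd_fst :
    Δ[A ⊗ B] ≫ ((ε[A] ▷ B ≫ (λ_ B).hom) ⊗ₘ (A ◁ ε[B] ≫ (ρ_ A).hom)) = (β_ A B).hom := by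
  rw [Comon.tensorObj_comul, ← id_tensorHom, ← tensorHom_id, ← tensorHom_comp_tensorHom,
    Category.assoc, ← tensorμ_natural_assoc, tensorHom_comp_tensorHom_assoc, id_tensorHom,
    tensorHom_id, ComonObj.counit_comul, ComonObj.comul_counit, tensorμ]
  monoidal

end

variable {A B : C} [HopfObj A] [HopfObj B]

theorem IsDistributiveLaw.braiding : IsDistributiveLaw (β_ B A).hom where
  mul_left := by
    rw [BraidedCategory.braiding_naturality_left, BraidedCategory.braiding_tensor_left_hom]
    monoidal
  mul_right := by
    rw [BraidedCategory.braiding_naturality_right, BraidedCategory.braiding_tensor_right_hom]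
    monoidal
  one_left := by
    rw [BraidedCategory.braiding_naturality_left, braiding_tensorUnit_left]
    monoidal
  one_right := by
    rw [BraidedCategory.braiding_naturality_right, braiding_tensorUnit_right]
    monoidal

section

attribute [local instance] ComonObj.instTensorUnit

theorem isComonHom_bicrossedMul (Ψ : B ⊗ A ⟶ A ⊗ B) [IsComonHom Ψ] :
    IsComonHom (bicrossedMul Ψ) := by
  have : IsComonHom ((α_ A B (A ⊗ B)).hom ≫ A ◁ (α_ B A B).inv ≫ A ◁ Ψ ▷ B ≫ A ◁ (α_ A B B).hom ≫
    (α_ A A (B ⊗ B)).inv ≫ (μ[A] ⊗ₘ μ[B])) := inferInstance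
  convert this using 1
  rw [bicrossedMul]; monoidal

theorem isComonHom_one_tensor : IsComonHom (𝟙 (𝟙_ C) ⊗≫ (η[A] ⊗ₘ η[B])) := by
  have : IsComonHom ((λ_ (𝟙_ C)).inv ≫ (η[A] ⊗ₘ η[B])) := inferInstance
  convert this using 1
  monoidal

/-- The bialgebra structure on `A ⊗ B` determined by a distributive law of comonoids. -/
@[reducible]
def bicrossedBimonObj (Ψ : B ⊗ A ⟶ A ⊗ B) [IsComonHom Ψ] (h : IsDistributiveLaw Ψ) :
    BimonObj (A ⊗ B) where
  one := 𝟙 (𝟙_ C) ⊗≫ (η[A] ⊗ₘ η[B])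
  mul := bicrossedMul Ψ
  one_mul := h.one_bicrossedMul
  mul_one := h.bicrossedMul_one
  mul_assoc := h.bicrossedMul_assoc
  counit := ε[A ⊗ B]
  comul := Δ[A ⊗ B]
  counit_comul := ComonObj.counit_comul _
  comul_counit := ComonObj.comul_counit _
  comul_assoc := ComonObj.comul_assoc _
  mul_comul := by
    have := (isComonHom_bicrossedMul Ψ).hom_comul
    rw [Comon.tensorObj_comul (A ⊗ B) (A ⊗ B), Category.assoc] at this
    exact this
  one_comul := (isComonHom_one_tensor (A := A) (B := B)).hom_comul
  mul_counit := (isComonHom_bicrossedMul Ψ).hom_counit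
  one_counit := (isComonHom_one_tensor (A := A) (B := B)).hom_counit

end

/-- When the identity factors as a convolution product of two pieces, its inverse is the product of
their inverses in the opposite order, and each piece is inverted by the antipode of its factor. -/
theorem isConvInv_of_factorization {D : C} [BimonObj D] (pA : D ⟶ A) (pB : D ⟶ B) (iA : A ⟶ D)
    (iB : B ⟶ D) [IsComonHom pA] [IsComonHom pB] [IsMonHom iA] [IsMonHom iB]
    (h : (pA ≫ iA) ⊛ (pB ≫ iB) = 𝟙 D) :
    IsConvInv (𝟙 D) ((pB ≫ 𝒮[B] ≫ iB) ⊛ (pA ≫ 𝒮[A] ≫ iA)) := by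
  have hA := (isConvInv_antipode A).comp pA iA
  have hB := (isConvInv_antipode B).comp pB iB
  rw [Category.id_comp] at hA hB
  rw [← h]
  exact hA.mul hB

/-- The object `A ⊗ B`, as the carrier of the bicrossed product along `Ψ`. -/
def Bicrossed (_ : B ⊗ A ⟶ A ⊗ B) : C := A ⊗ B

theorem bicrossed_antipode (Ψ : B ⊗ A ⟶ A ⊗ B) [IsComonHom Ψ] (h : IsDistributiveLaw Ψ) :
    Δ[A ⊗ B] ≫ ((β_ A B).hom ≫ (𝒮[B] ⊗ₘ 𝒮[A]) ≫ Ψ) ▷ (A ⊗ B) ≫ bicrossedMul Ψ =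
        ε[A ⊗ B] ≫ 𝟙 (𝟙_ C) ⊗≫ (η[A] ⊗ₘ η[B]) ∧
      Δ[A ⊗ B] ≫ (A ⊗ B) ◁ ((β_ A B).hom ≫ (𝒮[B] ⊗ₘ 𝒮[A]) ≫ Ψ) ≫ bicrossedMul Ψ =
        ε[A ⊗ B] ≫ 𝟙 (𝟙_ C) ⊗≫ (η[A] ⊗ₘ η[B]) := by
  have hA : IsComonHom (A ◁ ε[B] ≫ (ρ_ A).hom) := isComonHom_fst A B
  have hB : IsComonHom (ε[A] ▷ B ≫ (λ_ B).hom) := isComonHom_snd A B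
  let i₁ : A ⟶ A ⊗ B := (ρ_ A).inv ≫ A ◁ η[B]
  let i₂ : B ⟶ A ⊗ B := (λ_ B).inv ≫ η[A] ▷ B
  have e₁ : ((A ◁ ε[B] ≫ (ρ_ A).hom) ≫ i₁ ⊗ₘ (ε[A] ▷ B ≫ (λ_ B).hom) ≫ i₂) ≫ bicrossedMul Ψ =
      ((A ◁ ε[B] ≫ (ρ_ A).hom) ⊗ₘ (ε[A] ▷ B ≫ (λ_ B).hom)) := by
    rw [← tensorHom_comp_tensorHom, Category.assoc, h.inl_inr_bicrossedMul, Category.comp_id]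
  have e₂ : ((ε[A] ▷ B ≫ (λ_ B).hom) ≫ 𝒮[B] ≫ i₂ ⊗ₘ (A ◁ ε[B] ≫ (ρ_ A).hom) ≫ 𝒮[A] ≫ i₁) ≫
      bicrossedMul Ψ = ((ε[A] ▷ B ≫ (λ_ B).hom) ⊗ₘ (A ◁ ε[B] ≫ (ρ_ A).hom)) ≫
        (𝒮[B] ⊗ₘ 𝒮[A]) ≫ Ψ := by
    rw [← tensorHom_comp_tensorHom (ε[A] ▷ B ≫ (λ_ B).hom) (A ◁ ε[B] ≫ (ρ_ A).hom),
      ← tensorHom_comp_tensorHom 𝒮[B] 𝒮[A], Category.assoc, Category.assoc,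
      IsDistributiveLaw.inr_inl_bicrossedMul]
  have h₁ := comul_fst_snd A B
  have h₂ := comul_snd_fst A B
  rw [← e₁] at h₁
  rw [← h₂, Category.assoc, ← e₂, ← tensorHom_id _ (A ⊗ B), ← id_tensorHom (A ⊗ B)]
  -- The separate name for the carrier keeps this product apart from the tensor product structure
  -- already present on `A ⊗ B`.
  let : BimonObj (Bicrossed Ψ) := bicrossedBimonObj Ψ h
  let p₁ : Bicrossed Ψ ⟶ A := A ◁ ε[B] ≫ (ρ_ A).hom
  let p₂ : Bicrossed Ψ ⟶ B := ε[A] ▷ B ≫ (λ_ B).hom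
  let j₁ : A ⟶ Bicrossed Ψ := i₁
  let j₂ : B ⟶ Bicrossed Ψ := i₂
  have hp₁ : IsComonHom p₁ := hA
  have hp₂ : IsComonHom p₂ := hB
  have hj₁ : IsMonHom j₁ := by
    refine ⟨?_, h.inl_inl_bicrossedMul.symm⟩
    change η[A] ≫ i₁ = 𝟙 (𝟙_ C) ⊗≫ (η[A] ⊗ₘ η[B])
    simp only [i₁, MonoidalCategory.tensorHom_def]
    monoidal
  have hj₂ : IsMonHom j₂ := by
    refine ⟨?_, h.inr_inr_bicrossedMul.symm⟩
    change η[B] ≫ i₂ = 𝟙 (𝟙_ C) ⊗≫ (η[A] ⊗ₘ η[B])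
    simp only [i₂, MonoidalCategory.tensorHom_def']
    monoidal
  have key := isConvInv_of_factorization p₁ p₂ j₁ j₂ h₁
  exact ⟨key.inv_mul, key.mul_inv⟩

/-- The Hopf algebra structure on `A ⊗ B` determined by a distributive law of comonoids. -/
@[reducible]
def bicrossedHopfObj (Ψ : B ⊗ A ⟶ A ⊗ B) [IsComonHom Ψ] (h : IsDistributiveLaw Ψ) :
    HopfObj (A ⊗ B) :=
  { toBimonObj := bicrossedBimonObj Ψ h
    antipode := (β_ A B).hom ≫ (𝒮[B] ⊗ₘ 𝒮[A]) ≫ Ψ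
    antipode_left := (bicrossed_antipode Ψ h).1
    antipode_right := (bicrossed_antipode Ψ h).2 }

end

end CategoryTheory

namespace HopfTuple

variable {C : Type u} [Category.{v} C] [MonoidalCategory C] [SymmetricCategory C]
variable {A B : C} [HopfObj A] [HopfObj B]

theorem tensor_comul_of : (tensor (of A) (of B)).comul = Δ[A ⊗ B] := by
  rw [Comon.tensorObj_comul, tensorμ, tensor]
  dsimp only [of]
  monoidal

theorem tensor_counit_of : (tensor (of A) (of B)).counit = ε[A ⊗ B] := by
  rw [Comon.tensorObj_counit, tensor]
  dsimp only [of]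
  monoidal

theorem isHopf_bicrossed (φ : B ⊗ A ⟶ A) (ψ : B ⊗ A ⟶ B)
    [IsComonHom (crossing (of A) (of B) φ ψ)] (h : IsDistributiveLaw (crossing (of A) (of B) φ ψ)) :
    (bicrossed (of A) (of B) φ ψ).IsHopf := by
  refine ⟨bicrossedHopfObj _ h, ?_⟩
  ext
  · rfl
  · rfl
  · exact tensor_counit_of.symm
  · exact tensor_comul_of.symm
  · rfl

/-- The tensor product is the bicrossed product along the symmetry, which is a distributive law and
a comonoid morphism. -/
theorem isHopf_tensor : (tensor (of A) (of B)).IsHopf := by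
  refine ⟨bicrossedHopfObj _ IsDistributiveLaw.braiding, ?_⟩
  ext
  · rfl
  · rfl
  · exact tensor_counit_of.symm
  · exact tensor_comul_of.symm
  · change (β_ A B).hom ≫ (𝒮[B] ⊗ₘ 𝒮[A]) ≫ (β_ B A).hom = (𝒮[A] ⊗ₘ 𝒮[B])
    rw [BraidedCategory.braiding_naturality, SymmetricCategory.symmetry_assoc]

end HopfTuple

namespace CategoryTheory

/-! ### Translation and conjugation of comonoids by functionals. -/

section CounitActions

variable {C : Type u} [Category.{v} C] [MonoidalCategory C]
variable {X Y : C} [ComonObj X] [ComonObj Y]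

/-- The left translation `x ↦ u(x₁) x₂` of a comonoid by a functional. -/
def leftAct (u : X ⟶ 𝟙_ C) : X ⟶ X := Δ[X] ≫ u ▷ X ≫ (λ_ X).hom

/-- The right translation `x ↦ x₁ u(x₂)` of a comonoid by a functional. -/
def rightAct (u : X ⟶ 𝟙_ C) : X ⟶ X := Δ[X] ≫ X ◁ u ≫ (ρ_ X).hom

theorem comul_assoc_coherence :
    Δ[X] ⊗≫ X ◁ Δ[X] = Δ[X] ⊗≫ Δ[X] ▷ X ⊗≫ 𝟙 (X ⊗ X ⊗ X) := by
  calc _ = Δ[X] ≫ X ◁ Δ[X] := by monoidal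
    _ = _ := by rw [ComonObj.comul_assoc]; monoidal

theorem leftAct_comp (u v : X ⟶ 𝟙_ C) : leftAct u ≫ v = u ⊛ v := by
  rw [leftAct, convMul_eq]
  calc _ = Δ[X] ≫ (u ▷ X ≫ 𝟙_ C ◁ v) ⊗≫ 𝟙 _ := by monoidal
    _ = _ := by
      change _ = _ ≫ _ ≫ _ ≫ (λ_ (𝟙_ C)).hom
      monoidal

theorem rightAct_comp (u v : X ⟶ 𝟙_ C) : rightAct u ≫ v = v ⊛ u := by
  rw [rightAct, convMul, MonoidalCategory.tensorHom_def']
  calc _ = Δ[X] ≫ (X ◁ u ≫ v ▷ 𝟙_ C) ⊗≫ 𝟙 _ := by monoidal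
    _ = _ := by
      change _ = _ ≫ _ ≫ (λ_ (𝟙_ C)).hom
      monoidal

theorem leftAct_comul (u : X ⟶ 𝟙_ C) : leftAct u ≫ Δ[X] = Δ[X] ≫ leftAct u ▷ X := by
  calc _ = Δ[X] ≫ (u ▷ X ≫ 𝟙_ C ◁ Δ[X]) ⊗≫ 𝟙 _ := by rw [leftAct]; monoidal
    _ = (Δ[X] ⊗≫ X ◁ Δ[X]) ⊗≫ u ▷ X ▷ X ⊗≫ 𝟙 _ := by rw [← whisker_exchange]; monoidal
    _ = _ := by rw [comul_assoc_coherence, leftAct]; monoidal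

theorem rightAct_comul (u : X ⟶ 𝟙_ C) : rightAct u ≫ Δ[X] = Δ[X] ≫ X ◁ rightAct u := by
  calc _ = Δ[X] ≫ (X ◁ u ≫ Δ[X] ▷ 𝟙_ C) ⊗≫ 𝟙 _ := by rw [rightAct]; monoidal
    _ = (Δ[X] ⊗≫ Δ[X] ▷ X ⊗≫ 𝟙 (X ⊗ X ⊗ X)) ⊗≫ X ◁ X ◁ u ⊗≫ 𝟙 _ := by
      rw [whisker_exchange]; monoidal
    _ = _ := by rw [← comul_assoc_coherence, rightAct]; monoidal

theorem comul_rightAct (u : X ⟶ 𝟙_ C) : Δ[X] ≫ rightAct u ▷ X = Δ[X] ≫ X ◁ leftAct u := by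
  calc _ = (Δ[X] ⊗≫ Δ[X] ▷ X ⊗≫ 𝟙 (X ⊗ X ⊗ X)) ⊗≫ X ◁ u ▷ X ⊗≫ 𝟙 (X ⊗ X) := by
        rw [rightAct]; monoidal
    _ = _ := by rw [← comul_assoc_coherence, leftAct]; monoidal

theorem leftAct_rightAct_comm (u v : X ⟶ 𝟙_ C) :
    leftAct u ≫ rightAct v = rightAct v ≫ leftAct u := by
  calc _ = (leftAct u ≫ Δ[X]) ≫ X ◁ v ≫ (ρ_ X).hom := by rw [rightAct]; simp only [Category.assoc]
    _ = Δ[X] ≫ (X ◁ v ≫ leftAct u ▷ 𝟙_ C) ⊗≫ 𝟙 _ := by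
      rw [leftAct_comul, whisker_exchange]; monoidal
    _ = _ := by rw [rightAct]; monoidal

theorem leftAct_leftAct (u v : X ⟶ 𝟙_ C) : leftAct u ≫ leftAct v = leftAct (u ⊛ v) := by
  calc _ = (leftAct u ≫ Δ[X]) ≫ v ▷ X ≫ (λ_ X).hom := by
        simp only [leftAct, Category.assoc]
    _ = Δ[X] ≫ (leftAct u ≫ v) ▷ X ≫ (λ_ X).hom := by
      rw [leftAct_comul]; simp only [Category.assoc, comp_whiskerRight]
    _ = _ := by rw [leftAct_comp]; rfl

theorem rightAct_rightAct (u v : X ⟶ 𝟙_ C) : rightAct u ≫ rightAct v = rightAct (v ⊛ u) := by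
  calc _ = (rightAct u ≫ Δ[X]) ≫ X ◁ v ≫ (ρ_ X).hom := by
        simp only [rightAct, Category.assoc]
    _ = Δ[X] ≫ X ◁ (rightAct u ≫ v) ≫ (ρ_ X).hom := by
      rw [rightAct_comul]; simp only [Category.assoc, MonoidalCategory.whiskerLeft_comp]
    _ = _ := by rw [rightAct_comp]; rfl

theorem comp_leftAct (m : Y ⟶ X) [IsComonHom m] (u : X ⟶ 𝟙_ C) :
    m ≫ leftAct u = leftAct (m ≫ u) ≫ m := by
  rw [leftAct, IsComonHom.hom_comul_assoc, leftAct]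
  calc _ = Δ[Y] ≫ ((m ≫ u) ⊗ₘ m) ≫ (λ_ X).hom := by
        rw [← tensorHom_id, tensorHom_comp_tensorHom_assoc, Category.comp_id]
    _ = _ := by rw [MonoidalCategory.tensorHom_def]; monoidal

theorem comp_rightAct (m : Y ⟶ X) [IsComonHom m] (u : X ⟶ 𝟙_ C) :
    m ≫ rightAct u = rightAct (m ≫ u) ≫ m := by
  rw [rightAct, IsComonHom.hom_comul_assoc, rightAct]
  calc _ = Δ[Y] ≫ (m ⊗ₘ (m ≫ u)) ≫ (ρ_ X).hom := by
        rw [← id_tensorHom, tensorHom_comp_tensorHom_assoc, Category.comp_id]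
    _ = _ := by rw [MonoidalCategory.tensorHom_def']; monoidal

theorem leftAct_counit : leftAct ε[X] = 𝟙 X := by
  rw [leftAct, ComonObj.counit_comul_assoc, Iso.inv_hom_id]

theorem rightAct_counit : rightAct ε[X] = 𝟙 X := by
  rw [rightAct, ComonObj.comul_counit_assoc, Iso.inv_hom_id]

theorem convOne_eq_counit : ε[X] ≫ η[𝟙_ C] = ε[X] := Category.comp_id _

/-- The conjugation `x ↦ u(x₁) x₂ u'(x₃)`. -/
def conjAct (u u' : X ⟶ 𝟙_ C) : X ⟶ X := leftAct u ≫ rightAct u'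

theorem conjAct_conjAct (u u' w w' : X ⟶ 𝟙_ C) :
    conjAct u u' ≫ conjAct w w' = conjAct (u ⊛ w) (w' ⊛ u') := by
  simp only [conjAct, Category.assoc]
  rw [← Category.assoc (rightAct u'), ← leftAct_rightAct_comm, Category.assoc, rightAct_rightAct,
    ← Category.assoc, leftAct_leftAct]

theorem comp_conjAct (m : Y ⟶ X) [IsComonHom m] (u u' : X ⟶ 𝟙_ C) :
    m ≫ conjAct u u' = conjAct (m ≫ u) (m ≫ u') ≫ m := by
  rw [conjAct, ← Category.assoc, comp_leftAct, Category.assoc, comp_rightAct, conjAct,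
    Category.assoc]

theorem conjAct_counit : conjAct ε[X] ε[X] = 𝟙 X := by
  rw [conjAct, leftAct_counit, rightAct_counit, Category.comp_id]

/-- Between the two legs of `u(x₁) x₂ ⊗ x₃ u'(x₄)` the factor `u' * u = ε` can be inserted, and this
splits the result into a conjugate in each leg. -/
theorem IsConvInv.isComonHom_conjAct {u u' : X ⟶ 𝟙_ C} (h : IsConvInv u u') :
    IsComonHom (conjAct u u') where
  hom_counit := by
    rw [conjAct, Category.assoc, rightAct_comp, ← convOne_eq_counit, one_convMul, leftAct_comp,
      h.mul_inv]
  hom_comul := by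
    have e : Δ[X] ≫ (rightAct u' ⊗ₘ leftAct u) = Δ[X] := by
      rw [MonoidalCategory.tensorHom_def, ← Category.assoc, comul_rightAct, Category.assoc,
        ← MonoidalCategory.whiskerLeft_comp, leftAct_leftAct, h.inv_mul, convOne_eq_counit,
        leftAct_counit, MonoidalCategory.whiskerLeft_id, Category.comp_id]
    calc _ = Δ[X] ≫ (leftAct u ⊗ₘ rightAct u') := by
          rw [conjAct, Category.assoc, rightAct_comul, ← Category.assoc, leftAct_comul,
            Category.assoc, MonoidalCategory.tensorHom_def]
      _ = Δ[X] ≫ (rightAct u' ⊗ₘ leftAct u) ≫ (leftAct u ⊗ₘ rightAct u') := by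
        rw [← Category.assoc, e]
      _ = _ := by
        rw [tensorHom_comp_tensorHom, ← leftAct_rightAct_comm]; rfl

theorem IsConvInv.unique {M N : C} [ComonObj M] [MonObj N] {f g g' : M ⟶ N} (h : IsConvInv f g)
    (h' : IsConvInv f g') : g = g' :=
  h.mul_left_cancel (h.mul_inv.trans h'.mul_inv.symm)

end CounitActions

/-! ### Hopf pairings and the crossing they define. -/

section Pairing

variable {C : Type u} [Category.{v} C] [MonoidalCategory C] [SymmetricCategory C]
variable {A B : C}

/-- The left translation `k ⊗ p ↦ v(k, p₁) p₂`. -/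
def pairAct [ComonObj A] (w : B ⊗ A ⟶ 𝟙_ C) : B ⊗ A ⟶ A := B ◁ Δ[A] ⊗≫ w ▷ A ⊗≫ 𝟙 A

/-- The right translation `k ⊗ p ↦ p₁ v(k, p₂)`. -/
def pairActRight [ComonObj A] (w : B ⊗ A ⟶ 𝟙_ C) : B ⊗ A ⟶ A :=
  B ◁ Δ[A] ⊗≫ (β_ B A).hom ▷ A ⊗≫ A ◁ w ⊗≫ 𝟙 A

/-- `b` is a pairing of the Hopf algebra `B` with the Hopf algebra `A`. -/
structure IsHopfPairing [BimonObj A] [BimonObj B] (b : B ⊗ A ⟶ 𝟙_ C) : Prop where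
  mul_left : μ[B] ▷ A ≫ b = 𝟙 _ ⊗≫ B ◁ pairAct b ⊗≫ b
  mul_right : B ◁ μ[A] ≫ b = Δ[B] ▷ (A ⊗ A) ⊗≫ B ◁ (β_ B A).hom ▷ A ⊗≫ b ▷ (B ⊗ A) ⊗≫ b
  one_left : η[B] ▷ A ≫ b = (λ_ A).hom ≫ ε[A]
  one_right : B ◁ η[A] ≫ b = (ρ_ B).hom ≫ ε[B]

theorem comul_tensor_coherence [ComonObj A] [ComonObj B] :
    Δ[B ⊗ A] = B ◁ Δ[A] ⊗≫ Δ[B] ▷ (A ⊗ A) ⊗≫ B ◁ (β_ B A).hom ▷ A ⊗≫ 𝟙 ((B ⊗ A) ⊗ (B ⊗ A)) := by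
  rw [Comon.tensorObj_comul, tensorμ, MonoidalCategory.tensorHom_def']; monoidal

theorem leftAct_braiding [ComonObj A] [ComonObj B] (w : B ⊗ A ⟶ 𝟙_ C) :
    leftAct w ≫ (β_ B A).hom = Δ[B] ▷ A ⊗≫ B ◁ (β_ B A).hom ⊗≫ pairAct w ▷ B := by
  calc _ = B ◁ Δ[A] ⊗≫ Δ[B] ▷ (A ⊗ A) ⊗≫ B ◁ (β_ B A).hom ▷ A ⊗≫
        (w ▷ (B ⊗ A) ≫ 𝟙_ C ◁ (β_ B A).hom) ⊗≫ 𝟙 _ := by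
        rw [leftAct, comul_tensor_coherence]; monoidal
    _ = (B ◁ Δ[A] ≫ Δ[B] ▷ (A ⊗ A)) ⊗≫ B ◁ (β_ B A).hom ▷ A ⊗≫
        (B ⊗ A) ◁ (β_ B A).hom ⊗≫ w ▷ (A ⊗ B) ⊗≫ 𝟙 _ := by rw [← whisker_exchange]; monoidal
    _ = Δ[B] ▷ A ⊗≫ B ◁ (B ◁ Δ[A] ≫ (β_ B (A ⊗ A)).hom) ⊗≫ w ▷ (A ⊗ B) ⊗≫ 𝟙 _ := by
      rw [whisker_exchange, BraidedCategory.braiding_tensor_right_hom]; monoidal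
    _ = _ := by
      rw [BraidedCategory.braiding_naturality_right, pairAct]; monoidal

theorem rightAct_eq [ComonObj A] [ComonObj B] (w : B ⊗ A ⟶ 𝟙_ C) :
    rightAct w = Δ[B] ▷ A ⊗≫ B ◁ pairActRight w := by
  calc _ = (B ◁ Δ[A] ≫ Δ[B] ▷ (A ⊗ A)) ⊗≫ B ◁ (β_ B A).hom ▷ A ⊗≫ (B ⊗ A) ◁ w ⊗≫ 𝟙 _ := by
        rw [rightAct, comul_tensor_coherence]; monoidal
    _ = _ := by
      rw [whisker_exchange, pairActRight]; monoidal

theorem pairAct_counit {C : Type u} [Category.{v} C] [MonoidalCategory C] {A B : C}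
    [ComonObj A] (w : B ⊗ A ⟶ 𝟙_ C) : pairAct w ≫ ε[A] = w := by
  calc _ = B ◁ Δ[A] ⊗≫ (w ▷ A ≫ 𝟙_ C ◁ ε[A]) ⊗≫ 𝟙 _ := by rw [pairAct]; monoidal
    _ = B ◁ (Δ[A] ≫ A ◁ ε[A]) ⊗≫ w := by rw [← whisker_exchange]; monoidal
    _ = _ := by rw [ComonObj.comul_counit]; monoidal

theorem whiskerRight_pairAct {C : Type u} [Category.{v} C] [MonoidalCategory C] {A B : C}
    [ComonObj A] {B' : C} (f : B' ⟶ B) (w : B ⊗ A ⟶ 𝟙_ C) :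
    f ▷ A ≫ pairAct w = pairAct (f ▷ A ≫ w) := by
  calc _ = (f ▷ A ≫ B ◁ Δ[A]) ⊗≫ w ▷ A ⊗≫ 𝟙 A := by rw [pairAct]; monoidal
    _ = _ := by rw [← whisker_exchange, pairAct]; monoidal

end Pairing

section

attribute [local instance] ComonObj.instTensorUnit

variable {C : Type u} [Category.{v} C] [MonoidalCategory C] [SymmetricCategory C]

section

variable {X Y : C} [ComonObj X] [ComonObj Y]

theorem leftAct_snd (u : X ⟶ 𝟙_ C) :
    leftAct ((ε[Y] ▷ X ≫ (λ_ X).hom) ≫ u) = Y ◁ leftAct u := by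
  calc _ = Y ◁ Δ[X] ⊗≫ Δ[Y] ▷ (X ⊗ X) ⊗≫ (Y ◁ (β_ Y X).hom ≫ ε[Y] ▷ (X ⊗ Y)) ▷ X ⊗≫
        u ▷ (Y ⊗ X) ⊗≫ 𝟙 _ := by
        rw [leftAct, comul_tensor_coherence]; monoidal
    _ = Y ◁ Δ[X] ⊗≫ (Δ[Y] ≫ ε[Y] ▷ Y) ▷ (X ⊗ X) ⊗≫ ((β_ Y X).hom ≫ u ▷ Y) ▷ X ⊗≫ 𝟙 _ := by
      rw [whisker_exchange]; monoidal
    _ = _ := by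
      rw [ComonObj.counit_comul, ← BraidedCategory.braiding_naturality_right,
        braiding_tensorUnit_right, leftAct]
      monoidal

theorem rightAct_snd (u : X ⟶ 𝟙_ C) :
    rightAct ((ε[Y] ▷ X ≫ (λ_ X).hom) ≫ u) = Y ◁ rightAct u := by
  calc _ = Y ◁ Δ[X] ⊗≫ Δ[Y] ▷ (X ⊗ X) ⊗≫ Y ◁ ((β_ Y X).hom ≫ X ◁ ε[Y]) ▷ X ⊗≫
        (Y ⊗ X) ◁ u ⊗≫ 𝟙 _ := by
        rw [rightAct, comul_tensor_coherence]; monoidal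
    _ = Y ◁ Δ[X] ⊗≫ (Δ[Y] ≫ Y ◁ ε[Y]) ▷ (X ⊗ X) ⊗≫ (Y ⊗ X) ◁ u ⊗≫ 𝟙 _ := by
      rw [← BraidedCategory.braiding_naturality_left, braiding_tensorUnit_left]; monoidal
    _ = _ := by
      rw [ComonObj.comul_counit, rightAct]
      monoidal

theorem leftAct_fst (u : X ⟶ 𝟙_ C) :
    leftAct ((X ◁ ε[Y] ≫ (ρ_ X).hom) ≫ u) = leftAct u ▷ Y := by
  calc _ = X ◁ Δ[Y] ⊗≫ Δ[X] ▷ (Y ⊗ Y) ⊗≫ X ◁ ((β_ X Y).hom ≫ ε[Y] ▷ X) ▷ Y ⊗≫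
        u ▷ (X ⊗ Y) ⊗≫ 𝟙 _ := by
        rw [leftAct, comul_tensor_coherence]; monoidal
    _ = X ◁ Δ[Y] ⊗≫ (Δ[X] ▷ (Y ⊗ Y) ≫ (X ⊗ X) ◁ (ε[Y] ▷ Y)) ⊗≫ u ▷ (X ⊗ Y) ⊗≫ 𝟙 _ := by
      rw [← BraidedCategory.braiding_naturality_right, braiding_tensorUnit_right]; monoidal
    _ = X ◁ (Δ[Y] ≫ ε[Y] ▷ Y) ⊗≫ Δ[X] ▷ Y ⊗≫ u ▷ (X ⊗ Y) ⊗≫ 𝟙 _ := by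
      rw [← whisker_exchange]; monoidal
    _ = _ := by
      rw [ComonObj.counit_comul, leftAct]
      monoidal

theorem rightAct_fst (u : X ⟶ 𝟙_ C) :
    rightAct ((X ◁ ε[Y] ≫ (ρ_ X).hom) ≫ u) = rightAct u ▷ Y := by
  calc _ = X ◁ Δ[Y] ⊗≫ Δ[X] ▷ (Y ⊗ Y) ⊗≫ X ◁ ((β_ X Y).hom ▷ Y ⊗≫ Y ◁ (X ◁ ε[Y])) ⊗≫
        (X ⊗ Y) ◁ u ⊗≫ 𝟙 _ := by
        rw [rightAct, comul_tensor_coherence]; monoidal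
    _ = X ◁ Δ[Y] ⊗≫ Δ[X] ▷ (Y ⊗ Y) ⊗≫ X ◁ ((β_ X Y).hom ▷ Y ≫ (Y ⊗ X) ◁ ε[Y]) ⊗≫
        (X ⊗ Y) ◁ u ⊗≫ 𝟙 _ := by monoidal
    _ = X ◁ Δ[Y] ⊗≫ (Δ[X] ▷ (Y ⊗ Y) ≫ (X ⊗ X) ◁ (Y ◁ ε[Y])) ⊗≫ X ◁ ((β_ X Y).hom ≫ Y ◁ u) ⊗≫ 𝟙 _ := by
      rw [← whisker_exchange]; monoidal
    _ = X ◁ (Δ[Y] ≫ Y ◁ ε[Y]) ⊗≫ Δ[X] ▷ Y ⊗≫ X ◁ u ▷ Y ⊗≫ 𝟙 _ := by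
      rw [← whisker_exchange, ← BraidedCategory.braiding_naturality_left,
        braiding_tensorUnit_left]
      monoidal
    _ = _ := by
      rw [ComonObj.comul_counit, rightAct]
      monoidal

theorem conjAct_snd (u u' : X ⟶ 𝟙_ C) :
    conjAct ((ε[Y] ▷ X ≫ (λ_ X).hom) ≫ u) ((ε[Y] ▷ X ≫ (λ_ X).hom) ≫ u') =
      Y ◁ conjAct u u' := by
  rw [conjAct, leftAct_snd, rightAct_snd, ← MonoidalCategory.whiskerLeft_comp, conjAct]

theorem conjAct_fst (u u' : X ⟶ 𝟙_ C) :
    conjAct ((X ◁ ε[Y] ≫ (ρ_ X).hom) ≫ u) ((X ◁ ε[Y] ≫ (ρ_ X).hom) ≫ u') =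
      conjAct u u' ▷ Y := by
  rw [conjAct, leftAct_fst, rightAct_fst, ← comp_whiskerRight, conjAct]

theorem isConvInv_counit {C : Type u} [Category.{v} C] [MonoidalCategory C] {X : C} [ComonObj X] :
    IsConvInv ε[X] ε[X] := by
  have := one_convMul (N := 𝟙_ C) ε[X]
  rw [convOne_eq_counit] at this
  exact ⟨this.trans convOne_eq_counit.symm, this.trans convOne_eq_counit.symm⟩

theorem IsConvInv.comp_left {C : Type u} [Category.{v} C] [MonoidalCategory C] {X Y : C}
    [ComonObj X] [ComonObj Y] {u u' : X ⟶ 𝟙_ C} (h : IsConvInv u u') (m : Y ⟶ X) [IsComonHom m] :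
    IsConvInv (m ≫ u) (m ≫ u') := by
  have := h.comp m (𝟙 (𝟙_ C))
  simpa only [Category.comp_id] using this

end

variable {A B : C} [HopfObj A] [HopfObj B] {b : B ⊗ A ⟶ 𝟙_ C}

/-- Rewrites the convolution `w(k₁, p₁) w'(k₂, p₂)` as a nested evaluation, the shape in which
`IsHopfPairing.mul_left` applies. -/
theorem leftAct_comp_eq (w w' : B ⊗ A ⟶ 𝟙_ C) :
    leftAct w ≫ w' = (Δ[B] ≫ (β_ B B).hom) ▷ A ⊗≫ B ◁ pairAct w ⊗≫ w' := by
  calc _ = (leftAct w ≫ (β_ B A).hom) ≫ (β_ A B).hom ≫ w' := by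
        rw [Category.assoc, SymmetricCategory.symmetry_assoc]
    _ = Δ[B] ▷ A ⊗≫ B ◁ (β_ B A).hom ⊗≫ (pairAct w ▷ B ≫ (β_ A B).hom) ≫ w' := by
      rw [leftAct_braiding]; monoidal
    _ = Δ[B] ▷ A ⊗≫ B ◁ ((β_ B A).hom ≫ (β_ A B).hom) ⊗≫ (β_ B B).hom ▷ A ⊗≫ B ◁ pairAct w ⊗≫ w' := by
      rw [BraidedCategory.braiding_naturality_left, BraidedCategory.braiding_tensor_left_hom]
      monoidal
    _ = _ := by rw [SymmetricCategory.symmetry]; monoidal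

namespace IsHopfPairing

/-- In elements, `b(h k, p) = b(k, p₁) b(h, p₂)`, read as a convolution of two functionals on `B ⊗
(B ⊗ A)`. In this form the conjugation by `b(h k, p)` splits. -/
theorem mul_left_eq_convMul (h : IsHopfPairing b) :
    (α_ B B A).inv ≫ μ[B] ▷ A ≫ b =
      ((ε[B] ▷ (B ⊗ A) ≫ (λ_ _).hom) ≫ b) ⊛
        (B ◁ (β_ B A).hom ≫ (α_ _ _ _).inv ≫ ((B ⊗ A) ◁ ε[B] ≫ (ρ_ _).hom) ≫ b) := by
  rw [← leftAct_comp, leftAct_snd]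
  symm
  calc _ = B ◁ (leftAct b ≫ (β_ B A).hom) ⊗≫ (B ⊗ A) ◁ ε[B] ⊗≫ b := by
        monoidal
    _ = B ◁ Δ[B] ▷ A ⊗≫ B ◁ (B ◁ (β_ B A).hom ⊗≫ (pairAct b ▷ B ≫ A ◁ ε[B])) ⊗≫ b := by
      rw [leftAct_braiding]; monoidal
    _ = B ◁ Δ[B] ▷ A ⊗≫ B ◁ (B ◁ ((β_ B A).hom ≫ A ◁ ε[B])) ⊗≫ B ◁ pairAct b ⊗≫ b := by
      rw [← whisker_exchange]; monoidal
    _ = 𝟙 _ ⊗≫ B ◁ (Δ[B] ≫ B ◁ ε[B]) ▷ A ⊗≫ B ◁ pairAct b ⊗≫ b := by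
      rw [← BraidedCategory.braiding_naturality_left, braiding_tensorUnit_left]; monoidal
    _ = _ := by
      rw [h.mul_left, ComonObj.comul_counit]; monoidal

theorem leftAct_braiding_evaluation (h : IsHopfPairing b) :
    B ◁ (leftAct b ≫ (β_ B A).hom) ⊗≫ b ▷ B =
      𝟙 _ ⊗≫ B ◁ Δ[B] ▷ A ⊗≫ μ[B] ▷ (B ⊗ A) ⊗≫ B ◁ (β_ B A).hom ⊗≫ b ▷ B := by
  calc _ = 𝟙 _ ⊗≫ B ◁ Δ[B] ▷ A ⊗≫ (B ⊗ B) ◁ (β_ B A).hom ⊗≫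
        (𝟙 ((B ⊗ B) ⊗ A) ⊗≫ B ◁ pairAct b ⊗≫ b) ▷ B := by
        rw [leftAct_braiding]; monoidal
    _ = 𝟙 _ ⊗≫ B ◁ Δ[B] ▷ A ⊗≫ ((B ⊗ B) ◁ (β_ B A).hom ≫ μ[B] ▷ (A ⊗ B)) ⊗≫ b ▷ B := by
      rw [← h.mul_left]; monoidal
    _ = _ := by rw [whisker_exchange]; monoidal

/-- Right translation of `k ⊗ p` uses only the last coproduct leg of `k`, and the first leg is the
one multiplied by `h`. Coassociativity lets them commute. -/
theorem rightAct_comm_comul_mul (w : B ⊗ A ⟶ 𝟙_ C) :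
    B ◁ rightAct w ⊗≫ B ◁ Δ[B] ▷ A ⊗≫ μ[B] ▷ (B ⊗ A) =
      𝟙 _ ⊗≫ B ◁ Δ[B] ▷ A ⊗≫ μ[B] ▷ (B ⊗ A) ⊗≫ B ◁ rightAct w := by
  rw [rightAct_eq]
  generalize pairActRight w = r at *
  calc _ = 𝟙 _ ⊗≫ B ◁ Δ[B] ▷ A ⊗≫ B ◁ (B ◁ r ≫ Δ[B] ▷ A) ⊗≫ μ[B] ▷ (B ⊗ A) := by monoidal
    _ = 𝟙 _ ⊗≫ B ◁ (Δ[B] ⊗≫ Δ[B] ▷ B ⊗≫ 𝟙 (B ⊗ B ⊗ B)) ▷ A ⊗≫ ((B ⊗ B) ◁ (B ◁ r) ≫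
        μ[B] ▷ (B ⊗ A)) := by rw [whisker_exchange]; monoidal
    _ = _ := by
      rw [← comul_assoc_coherence, whisker_exchange]
      calc _ = 𝟙 _ ⊗≫ B ◁ Δ[B] ▷ A ⊗≫ ((B ⊗ B) ◁ Δ[B] ▷ A ≫ μ[B] ▷ ((B ⊗ B) ⊗ A)) ⊗≫
            B ◁ B ◁ r := by monoidal
        _ = _ := by rw [whisker_exchange]; monoidal

/-- The counterpart of `mul_left_eq_convMul` in the other variable: `b(k, p q) = b(k₁, p) b(k₂, q)`.
-/
theorem mul_right_eq_convMul (h : IsHopfPairing b) :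
    B ◁ μ[A] ≫ b = ((α_ B A A).inv ≫ ((B ⊗ A) ◁ ε[A] ≫ (ρ_ _).hom) ≫ b) ⊛
      (((α_ B A A).inv ≫ (β_ B A).hom ▷ A ≫ (α_ _ _ _).hom) ≫
        (ε[A] ▷ (B ⊗ A) ≫ (λ_ _).hom) ≫ b) := by
  have e := comp_leftAct (α_ B A A).inv (((B ⊗ A) ◁ ε[A] ≫ (ρ_ _).hom) ≫ b)
  have e' : leftAct ((α_ B A A).inv ≫ ((B ⊗ A) ◁ ε[A] ≫ (ρ_ _).hom) ≫ b) =
      (α_ _ _ _).inv ≫ leftAct b ▷ A ≫ (α_ _ _ _).hom := by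
    rw [leftAct_fst] at e
    rw [← Category.assoc (α_ B A A).inv (leftAct b ▷ A), e]
    simp only [Category.assoc, Iso.inv_hom_id, Category.comp_id]
  rw [← leftAct_comp, e', h.mul_right]
  symm
  calc _ = 𝟙 _ ⊗≫ (leftAct b ≫ (β_ B A).hom) ▷ A ⊗≫ ε[A] ▷ (B ⊗ A) ⊗≫ b := by monoidal
    _ = 𝟙 _ ⊗≫ (Δ[B] ▷ A ⊗≫ B ◁ (β_ B A).hom) ▷ A ⊗≫ (pairAct b ≫ ε[A]) ▷ B ▷ A ⊗≫ b := by
      rw [leftAct_braiding]; monoidal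
    _ = _ := by rw [pairAct_counit]; monoidal

variable [IsIso 𝒮[B]]

/-- By multiplicativity `b(k₁, p₁) b(S⁻¹(k₂), p₂) = b(S⁻¹(k₂) k₁, p)`, and the product in the first
argument collapses by `braiding_antipode_cop`. The other order is similar. -/
theorem isConvInv (h : IsHopfPairing b) : IsConvInv b (inv 𝒮[B] ▷ A ≫ b) where
  mul_inv := by
    rw [← leftAct_comp, leftAct_comp_eq]
    calc _ = (Δ[B] ≫ (β_ B B).hom) ▷ A ⊗≫ (B ◁ pairAct b ≫ inv 𝒮[B] ▷ A) ≫ b := by monoidal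
      _ = (Δ[B] ≫ (β_ B B).hom ≫ inv 𝒮[B] ▷ B) ▷ A ≫ (𝟙 _ ⊗≫ B ◁ pairAct b ⊗≫ b) := by
        rw [whisker_exchange]; monoidal
      _ = (Δ[B] ≫ (β_ B B).hom ≫ inv 𝒮[B] ▷ B ≫ μ[B]) ▷ A ≫ b := by
        rw [← h.mul_left]; simp only [comp_whiskerRight, Category.assoc]
      _ = _ := by
        rw [braiding_antipode_cop, comp_whiskerRight, Category.assoc, h.one_left,
          convOne_eq_counit, Comon.tensorObj_counit, MonoidalCategory.tensorHom_def]
        monoidal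
  inv_mul := by
    rw [← leftAct_comp, leftAct_comp_eq, ← whiskerRight_pairAct]
    calc _ = (Δ[B] ≫ (β_ B B).hom ≫ B ◁ inv 𝒮[B]) ▷ A ≫ (𝟙 _ ⊗≫ B ◁ pairAct b ⊗≫ b) := by
          monoidal
      _ = (Δ[B] ≫ (β_ B B).hom ≫ B ◁ inv 𝒮[B] ≫ μ[B]) ▷ A ≫ b := by
        rw [← h.mul_left]; simp only [comp_whiskerRight, Category.assoc]
      _ = _ := by
        rw [braiding_antipode_cop', comp_whiskerRight, Category.assoc, h.one_left,
          convOne_eq_counit, Comon.tensorObj_counit, MonoidalCategory.tensorHom_def]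
        monoidal

variable (b) in
/-- The crossing `k ⊗ p ↦ b(k₁, p₁) p₂ ⊗ k₂ b(S⁻¹ k₃, p₃)` of the double. -/
def doubleCrossing : B ⊗ A ⟶ A ⊗ B := conjAct b (inv 𝒮[B] ▷ A ≫ b) ≫ (β_ B A).hom

theorem isComonHom_doubleCrossing (h : IsHopfPairing b) : IsComonHom (doubleCrossing b) :=
  have := h.isConvInv.isComonHom_conjAct
  inferInstanceAs (IsComonHom (conjAct b (inv 𝒮[B] ▷ A ≫ b) ≫ (β_ B A).hom))

/-- Conjugation is natural in comonoid morphisms. Since convolution inverses are unique, any inverse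
`u'` of the pulled-back functional may replace the pullback of `b ∘ (S⁻¹ ⊗ A)`. -/
theorem comp_doubleCrossing {Z : C} [ComonObj Z] (h : IsHopfPairing b) (m : Z ⟶ B ⊗ A)
    [IsComonHom m] {u u' : Z ⟶ 𝟙_ C} (hu : IsConvInv u u') (e : m ≫ b = u) :
    m ≫ doubleCrossing b = conjAct u u' ≫ m ≫ (β_ B A).hom := by
  have : m ≫ inv 𝒮[B] ▷ A ≫ b = u' := (h.isConvInv.comp_left m).unique (e ▸ hu)
  rw [doubleCrossing, ← Category.assoc, comp_conjAct, e, this, Category.assoc]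

/-- By `mul_left_eq_convMul` the pulled-back pairing is a convolution product, so conjugation by it
is a composite of two conjugations, each moving one factor of `B` past `A`. -/
theorem doubleCrossing_mul_left (h : IsHopfPairing b) :
    μ[B] ▷ A ≫ doubleCrossing b =
      𝟙 _ ⊗≫ B ◁ doubleCrossing b ⊗≫ doubleCrossing b ▷ B ⊗≫ A ◁ μ[B] := by
  have hb := h.isConvInv
  have e := h.mul_left_eq_convMul
  have hs := comp_conjAct (B ◁ (β_ B A).hom ≫ (α_ _ _ _).inv)
    (((B ⊗ A) ◁ ε[B] ≫ (ρ_ _).hom) ≫ b) (((B ⊗ A) ◁ ε[B] ≫ (ρ_ _).hom) ≫ inv 𝒮[B] ▷ A ≫ b)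
  rw [conjAct_fst] at hs
  have hp : IsComonHom (ε[B] ▷ (B ⊗ A) ≫ (λ_ _).hom) := isComonHom_snd B (B ⊗ A)
  have hq : IsComonHom ((B ⊗ A) ◁ ε[B] ≫ (ρ_ _).hom) := isComonHom_fst (B ⊗ A) B
  have key := h.comp_doubleCrossing ((α_ _ _ _).inv ≫ μ[B] ▷ A)
    ((hb.comp_left (ε[B] ▷ (B ⊗ A) ≫ (λ_ _).hom)).mul ((hb.comp_left
      ((B ⊗ A) ◁ ε[B] ≫ (ρ_ _).hom)).comp_left (B ◁ (β_ B A).hom ≫ (α_ _ _ _).inv)))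
    (by rw [Category.assoc, e, Category.assoc (B ◁ (β_ B A).hom)])
  rw [← cancel_epi (α_ _ _ _).inv, ← Category.assoc, key, ← conjAct_conjAct, conjAct_snd]
  have hperm : ((α_ B B A).inv ≫ μ[B] ▷ A) ≫ (β_ B A).hom =
      (B ◁ (β_ B A).hom ≫ (α_ _ _ _).inv) ≫ (β_ B A).hom ▷ B ≫ (α_ _ _ _).hom ≫ A ◁ μ[B] := by
    simp only [Category.assoc, BraidedCategory.braiding_naturality_left,
      BraidedCategory.braiding_tensor_left_hom]
    monoidal
  have hs' := hs.symm
  rw [hperm, Category.assoc, ← Category.assoc (conjAct _ _) (B ◁ _ ≫ _), hs', doubleCrossing]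
  monoidal

/-- As for `doubleCrossing_mul_left`, with `mul_right_eq_convMul` splitting the conjugation over the
two factors of `A`. -/
theorem doubleCrossing_mul_right (h : IsHopfPairing b) :
    B ◁ μ[A] ≫ doubleCrossing b =
      𝟙 _ ⊗≫ doubleCrossing b ▷ A ⊗≫ A ◁ doubleCrossing b ⊗≫ μ[A] ▷ B := by
  have hb := h.isConvInv
  have e := h.mul_right_eq_convMul
  have hs₁ := comp_conjAct (α_ B A A).inv (((B ⊗ A) ◁ ε[A] ≫ (ρ_ _).hom) ≫ b)
    (((B ⊗ A) ◁ ε[A] ≫ (ρ_ _).hom) ≫ inv 𝒮[B] ▷ A ≫ b)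
  have hs₂ := comp_conjAct ((α_ B A A).inv ≫ (β_ B A).hom ▷ A ≫ (α_ _ _ _).hom)
    ((ε[A] ▷ (B ⊗ A) ≫ (λ_ _).hom) ≫ b) ((ε[A] ▷ (B ⊗ A) ≫ (λ_ _).hom) ≫ inv 𝒮[B] ▷ A ≫ b)
  rw [conjAct_fst] at hs₁
  rw [conjAct_snd] at hs₂
  have hp : IsComonHom (ε[A] ▷ (B ⊗ A) ≫ (λ_ _).hom) := isComonHom_snd A (B ⊗ A)
  have hq : IsComonHom ((B ⊗ A) ◁ ε[A] ≫ (ρ_ _).hom) := isComonHom_fst (B ⊗ A) A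
  have key := h.comp_doubleCrossing (B ◁ μ[A])
    (((hb.comp_left ((B ⊗ A) ◁ ε[A] ≫ (ρ_ _).hom)).comp_left (α_ B A A).inv).mul
      ((hb.comp_left (ε[A] ▷ (B ⊗ A) ≫ (λ_ _).hom)).comp_left
      ((α_ B A A).inv ≫ (β_ B A).hom ▷ A ≫ (α_ _ _ _).hom))) e
  rw [key, ← conjAct_conjAct]
  have hperm : B ◁ μ[A] ≫ (β_ B A).hom =
      ((α_ B A A).inv ≫ (β_ B A).hom ▷ A ≫ (α_ _ _ _).hom) ≫ A ◁ (β_ B A).hom ≫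
        (α_ _ _ _).inv ≫ μ[A] ▷ B := by
    simp only [Category.assoc, BraidedCategory.braiding_naturality_right,
      BraidedCategory.braiding_tensor_right_hom]
  generalize conjAct ((α_ B A A).inv ≫ ((B ⊗ A) ◁ ε[A] ≫ (ρ_ _).hom) ≫ b)
    ((α_ B A A).inv ≫ ((B ⊗ A) ◁ ε[A] ≫ (ρ_ _).hom) ≫ inv 𝒮[B] ▷ A ≫ b) = d at *
  rw [hperm, Category.assoc, ← Category.assoc (conjAct _ _) ((α_ B A A).inv ≫ _), ← hs₂]
  calc _ = (d ≫ (α_ B A A).inv) ≫ ((β_ B A).hom ▷ A ≫ (α_ _ _ _).hom ≫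
        A ◁ doubleCrossing b ≫ (α_ _ _ _).inv ≫ μ[A] ▷ B) := by
        simp only [doubleCrossing, Category.assoc, MonoidalCategory.whiskerLeft_comp]
    _ = _ := by
      rw [← hs₁]
      nth_rw 2 [doubleCrossing]
      monoidal

theorem doubleCrossing_one_left (h : IsHopfPairing b) :
    η[B] ▷ A ≫ doubleCrossing b = 𝟙 _ ⊗≫ A ◁ η[B] := by
  have e : η[B] ▷ A ≫ b = ε[𝟙_ C ⊗ A] := by
    rw [h.one_left, Comon.tensorObj_counit, counit_tensorUnit]; monoidal
  rw [h.comp_doubleCrossing (η[B] ▷ A) isConvInv_counit e, conjAct_counit, Category.id_comp,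
    BraidedCategory.braiding_naturality_left, braiding_tensorUnit_left]
  monoidal

theorem doubleCrossing_one_right (h : IsHopfPairing b) :
    B ◁ η[A] ≫ doubleCrossing b = 𝟙 _ ⊗≫ η[A] ▷ B := by
  have e : B ◁ η[A] ≫ b = ε[B ⊗ 𝟙_ C] := by
    rw [h.one_right, Comon.tensorObj_counit, counit_tensorUnit]; monoidal
  rw [h.comp_doubleCrossing (B ◁ η[A]) isConvInv_counit e, conjAct_counit, Category.id_comp,
    BraidedCategory.braiding_naturality_right, braiding_tensorUnit_right]
  monoidal

theorem isDistributiveLaw (h : IsHopfPairing b) : IsDistributiveLaw (doubleCrossing b) :=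
  ⟨h.doubleCrossing_mul_left, h.doubleCrossing_mul_right, h.doubleCrossing_one_left,
    h.doubleCrossing_one_right⟩

/-- In elements, `b(h, p₁) b(S⁻¹(k), p₂) = b(S⁻¹(k) h, p)`. -/
theorem pairActRight_evaluation (h : IsHopfPairing b) :
    B ◁ pairActRight (inv 𝒮[B] ▷ A ≫ b) ≫ b =
      (α_ _ _ _).inv ≫ ((β_ B B).hom ≫ inv 𝒮[B] ▷ B ≫ μ[B]) ▷ A ≫ b := by
  set c := inv 𝒮[B] ▷ A ≫ b with hc
  symm
  calc _ = 𝟙 _ ⊗≫ ((β_ B B).hom ≫ inv 𝒮[B] ▷ B) ▷ A ≫ μ[B] ▷ A ≫ b := by monoidal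
    _ = 𝟙 _ ⊗≫ (β_ B B).hom ▷ A ⊗≫ (inv 𝒮[B] ▷ (B ⊗ A) ≫ B ◁ pairAct b) ⊗≫ b := by
      rw [h.mul_left]; monoidal
    _ = 𝟙 _ ⊗≫ (β_ B B).hom ▷ A ⊗≫ B ◁ pairAct b ⊗≫ c := by
      rw [← whisker_exchange]; monoidal
    _ = 𝟙 _ ⊗≫ ((β_ B B).hom ▷ A ≫ (B ⊗ B) ◁ Δ[A]) ⊗≫ B ◁ (b ▷ A) ⊗≫ c := by
      rw [pairAct]; monoidal
    _ = 𝟙 _ ⊗≫ B ◁ B ◁ Δ[A] ⊗≫ ((β_ B B).hom ▷ A ⊗≫ B ◁ b ⊗≫ 𝟙 B) ▷ A ⊗≫ c := by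
      rw [← whisker_exchange]; monoidal
    _ = 𝟙 _ ⊗≫ B ◁ B ◁ Δ[A] ⊗≫ (B ◁ (β_ B A).hom ⊗≫ b ▷ B ⊗≫ 𝟙 B) ▷ A ⊗≫ c := by
      rw [whiskerLeft_braiding_pairing]; monoidal
    _ = 𝟙 _ ⊗≫ B ◁ B ◁ Δ[A] ⊗≫ B ◁ (β_ B A).hom ▷ A ⊗≫ (b ▷ (B ⊗ A) ≫ 𝟙_ C ◁ c) ⊗≫ 𝟙 _ := by
      monoidal
    _ = 𝟙 _ ⊗≫ B ◁ B ◁ Δ[A] ⊗≫ B ◁ (β_ B A).hom ▷ A ⊗≫ (B ⊗ A) ◁ c ⊗≫ b := by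
      rw [← whisker_exchange]; monoidal
    _ = _ := by rw [pairActRight]; monoidal

theorem rightAct_braiding_evaluation (h : IsHopfPairing b) :
    B ◁ (rightAct (inv 𝒮[B] ▷ A ≫ b) ≫ (β_ B A).hom) ⊗≫ b ▷ B ⊗≫ 𝟙 B =
      𝟙 _ ⊗≫ ((β_ B B).hom ≫ Δ[B] ▷ B ⊗≫ B ◁ (inv 𝒮[B] ▷ B ≫ μ[B])) ▷ A ⊗≫ B ◁ b ⊗≫ 𝟙 B := by
  have key := h.pairActRight_evaluation
  rw [rightAct_eq]
  generalize pairActRight (inv 𝒮[B] ▷ A ≫ b) = r at *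
  calc _ = B ◁ (Δ[B] ▷ A) ⊗≫ B ◁ B ◁ r ⊗≫ (B ◁ (β_ B A).hom ⊗≫ b ▷ B ⊗≫ 𝟙 B) := by monoidal
    _ = B ◁ (Δ[B] ▷ A) ⊗≫ ((B ⊗ B) ◁ r ≫ (β_ B B).hom ▷ A) ⊗≫ B ◁ b ⊗≫ 𝟙 B := by
      rw [whiskerLeft_braiding_pairing]; monoidal
    _ = B ◁ (Δ[B] ▷ A) ⊗≫ (β_ B B).hom ▷ (B ⊗ A) ⊗≫ B ◁ (B ◁ r ≫ b) ⊗≫ 𝟙 B := by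
      rw [whisker_exchange]; monoidal
    _ = 𝟙 _ ⊗≫ (B ◁ Δ[B] ≫ (α_ _ _ _).inv ≫ (β_ B B).hom ▷ B ≫ (α_ _ _ _).hom ≫
        B ◁ (β_ B B).hom) ▷ A ⊗≫ B ◁ (inv 𝒮[B] ▷ B ≫ μ[B]) ▷ A ⊗≫ B ◁ b ⊗≫ 𝟙 B := by
      rw [key]; monoidal
    _ = 𝟙 _ ⊗≫ (B ◁ Δ[B] ≫ (β_ B (B ⊗ B)).hom) ▷ A ⊗≫ B ◁ (inv 𝒮[B] ▷ B ≫ μ[B]) ▷ A ⊗≫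
        B ◁ b ⊗≫ 𝟙 B := by
      rw [BraidedCategory.braiding_tensor_right_hom]; monoidal
    _ = _ := by
      rw [BraidedCategory.braiding_naturality_right]; monoidal

/-- The crossing of the double, evaluated against a further factor. -/
theorem doubleCrossing_evaluation (h : IsHopfPairing b) :
    B ◁ doubleCrossing b ⊗≫ b ▷ B ⊗≫ 𝟙 B = 𝟙 _ ⊗≫ (B ◁ Δ[B] ⊗≫ μ[B] ▷ B ≫
      (β_ B B).hom ≫ Δ[B] ▷ B ⊗≫ B ◁ (inv 𝒮[B] ▷ B ≫ μ[B])) ▷ A ⊗≫ B ◁ b ⊗≫ 𝟙 B := by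
  have h₁ := h.leftAct_braiding_evaluation
  have h₂ := h.rightAct_braiding_evaluation
  have h₃ := rightAct_comm_comul_mul (inv 𝒮[B] ▷ A ≫ b)
  calc _ = B ◁ rightAct (inv 𝒮[B] ▷ A ≫ b) ≫ (B ◁ (leftAct b ≫ (β_ B A).hom) ⊗≫ b ▷ B) ⊗≫ 𝟙 B := by
        rw [doubleCrossing, conjAct, leftAct_rightAct_comm]; monoidal
    _ = (B ◁ rightAct (inv 𝒮[B] ▷ A ≫ b) ⊗≫ B ◁ Δ[B] ▷ A ⊗≫ μ[B] ▷ (B ⊗ A)) ⊗≫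
        B ◁ (β_ B A).hom ⊗≫ b ▷ B ⊗≫ 𝟙 B := by rw [h₁]; monoidal
    _ = 𝟙 _ ⊗≫ B ◁ Δ[B] ▷ A ⊗≫ μ[B] ▷ (B ⊗ A) ⊗≫ (B ◁ (rightAct (inv 𝒮[B] ▷ A ≫ b) ≫
        (β_ B A).hom) ⊗≫ b ▷ B ⊗≫ 𝟙 B) := by rw [h₃]; monoidal
    _ = _ := by rw [h₂]; monoidal

end IsHopfPairing

end

/-! ### The Drinfeld double as a bicrossed product. -/

section

variable {C : Type u} [Category.{v} C] [MonoidalCategory C] [SymmetricCategory C]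

/-- A morphism of comonoids to a tensor product is determined by its components. -/
theorem comonHom_eq_comul_components {Z A B : C} [ComonObj Z] [ComonObj A] [ComonObj B]
    (f : Z ⟶ A ⊗ B) [IsComonHom f] :
    f = Δ[Z] ≫ ((f ≫ A ◁ ε[B] ≫ (ρ_ A).hom) ⊗ₘ (f ≫ ε[A] ▷ B ≫ (λ_ B).hom)) := by
  rw [← tensorHom_comp_tensorHom, ← IsComonHom.hom_comul_assoc, comul_fst_snd, Category.comp_id]

end

end CategoryTheory

namespace DrinfeldDouble

variable {C : Type u} [Category.{v} C] [MonoidalCategory C] [SymmetricCategory C]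
variable (H Hd : C) [HopfObj H] [IsIso 𝒮[H]] [ExactPairing Hd H]

/-- The Hopf algebra `(H^cop)^*`. -/
@[reducible]
def dualCopHopfObj : HopfObj Hd :=
  letI := copHopfObj H
  dualHopfObj H Hd

theorem dualCop_eq_of : dualCop H Hd = letI := dualCopHopfObj H Hd; HopfTuple.of Hd :=
  dualCop_eq H Hd

/-- The coproduct of `Ĥ` keeps the nested order, `b(h k, p) = b(k, p₁) b(h, p₂)`. For the product,
the nesting and the co-opposite coproduct cancel, leaving `b(h, p q) = b(h₁, p) b(h₂, q)`. -/
theorem isHopfPairing_evaluation :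
    letI := dualCopHopfObj H Hd
    IsHopfPairing (ε_ Hd H) := by
  let inst := dualCopHopfObj H Hd
  have e₁ : (H ⊗ H) ◁ Δ[Hd] ≫ ε_ (Hd ⊗ Hd) (H ⊗ H) = μ[H] ▷ Hd ≫ ε_ Hd H := mate_evaluation μ[H]
  have e₂ : H ◁ μ[Hd] ≫ ε_ Hd H = (Δ[H] ≫ (β_ H H).hom) ▷ (Hd ⊗ Hd) ≫ ε_ (Hd ⊗ Hd) (H ⊗ H) :=
    mate_evaluation (Δ[H] ≫ (β_ H H).hom)
  have e₃ : 𝟙_ C ◁ ε[Hd] ≫ ε_ (𝟙_ C) (𝟙_ C) = η[H] ▷ Hd ≫ ε_ Hd H := mate_evaluation η[H]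
  have e₄ : H ◁ η[Hd] ≫ ε_ Hd H = ε[H] ▷ 𝟙_ C ≫ ε_ (𝟙_ C) (𝟙_ C) := mate_evaluation ε[H]
  rw [evaluation_unit] at e₃ e₄
  rw [tensor_evaluation_eq] at e₁ e₂
  constructor
  · rw [← e₁, pairAct]; monoidal
  · rw [e₂]
    calc _ = Δ[H] ▷ (Hd ⊗ Hd) ⊗≫ ((β_ H H).hom ▷ Hd ⊗≫ H ◁ ε_ Hd H ⊗≫ 𝟙 H) ▷ Hd ≫ ε_ Hd H := by
          monoidal
      _ = Δ[H] ▷ (Hd ⊗ Hd) ⊗≫ (H ◁ (β_ H Hd).hom ⊗≫ ε_ Hd H ▷ H ⊗≫ 𝟙 H) ▷ Hd ≫ ε_ Hd H := by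
        rw [whiskerLeft_braiding_pairing]; monoidal
      _ = _ := by monoidal
  · rw [← e₃]; monoidal
  · rw [e₄]; monoidal

/-- The crossing of the Drinfeld double. -/
def doubleCrossing : H ⊗ Hd ⟶ Hd ⊗ H :=
  letI := dualCopHopfObj H Hd
  IsHopfPairing.doubleCrossing (A := Hd) (B := H) (ε_ Hd H)

/-- Explains the role of `J(x ⊗ k) = k₂ ⊗ S⁻¹(k₃) x k₁`: it is the crossing seen through the
pairing. -/
theorem whiskerLeft_doubleCrossing_evaluation :
    H ◁ doubleCrossing H Hd ⊗≫ ε_ Hd H ▷ H ⊗≫ 𝟙 H = 𝟙 _ ⊗≫ J H ▷ Hd ⊗≫ H ◁ ε_ Hd H ⊗≫ 𝟙 H :=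
  letI := dualCopHopfObj H Hd
  (isHopfPairing_evaluation H Hd).doubleCrossing_evaluation

/-- With `Rbar_eq`, shows that `J` contains both actions: applying the counit to its first leg, or
inserting the unit in its first argument, corresponds to taking a component of the crossing. -/
theorem R_eq : R H = J H ≫ ε[H] ▷ H ≫ (λ_ H).hom := by
  symm
  calc _ = H ◁ Δ[H] ⊗≫ μ[H] ▷ H ≫ (β_ H H).hom ≫ Δ[H] ▷ H ⊗≫
        (H ◁ (inv 𝒮[H] ▷ H ≫ μ[H]) ≫ ε[H] ▷ H) ⊗≫ 𝟙 H := by rw [J]; monoidal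
    _ = H ◁ Δ[H] ⊗≫ μ[H] ▷ H ≫ (β_ H H).hom ≫ (Δ[H] ≫ ε[H] ▷ H) ▷ H ⊗≫
        inv 𝒮[H] ▷ H ≫ μ[H] := by rw [whisker_exchange]; monoidal
    _ = H ◁ Δ[H] ⊗≫ μ[H] ▷ H ≫ ((β_ H H).hom ≫ inv 𝒮[H] ▷ H) ≫ μ[H] := by
      rw [ComonObj.counit_comul]; monoidal
    _ = _ := by
      rw [← BraidedCategory.braiding_naturality_right, R, MonoidalCategory.tensorHom_def]
      monoidal

theorem Rbar_eq : Rbar H = (λ_ H).inv ≫ η[H] ▷ H ≫ J H := by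
  symm
  calc _ = 𝟙 _ ⊗≫ (η[H] ▷ H ≫ H ◁ Δ[H]) ⊗≫ μ[H] ▷ H ≫ (β_ H H).hom ≫ Δ[H] ▷ H ⊗≫
        H ◁ (inv 𝒮[H] ▷ H ≫ μ[H]) := by rw [J]; monoidal
    _ = 𝟙 _ ⊗≫ Δ[H] ⊗≫ (η[H] ▷ H ≫ μ[H]) ▷ H ≫ (β_ H H).hom ≫ Δ[H] ▷ H ⊗≫
        H ◁ (inv 𝒮[H] ▷ H ≫ μ[H]) := by rw [← whisker_exchange]; monoidal
    _ = _ := by rw [MonObj.one_mul, Rbar]; monoidal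

theorem leftAction_eq :
    letI := dualCopHopfObj H Hd
    leftAction H Hd = doubleCrossing H Hd ≫ Hd ◁ ε[H] ≫ (ρ_ Hd).hom := by
  have e : leftAction H Hd = actMate Hd Hd (R H) := by rw [leftAction, actMate]; monoidal
  have hJ := whiskerLeft_doubleCrossing_evaluation H Hd
  apply ExactPairing.hom_ext (X := H)
  rw [e, actMate_evaluation, R_eq]
  symm
  calc _ = H ◁ doubleCrossing H Hd ⊗≫ ((H ⊗ Hd) ◁ ε[H] ≫ ε_ Hd H ▷ 𝟙_ C) ⊗≫ 𝟙 _ := by monoidal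
    _ = (H ◁ doubleCrossing H Hd ⊗≫ ε_ Hd H ▷ H ⊗≫ 𝟙 H) ≫ ε[H] := by
      rw [whisker_exchange]; monoidal
    _ = 𝟙 _ ⊗≫ J H ▷ Hd ⊗≫ (H ◁ ε_ Hd H ≫ ε[H] ▷ 𝟙_ C) ⊗≫ 𝟙 _ := by rw [hJ]; monoidal
    _ = _ := by rw [whisker_exchange]; monoidal

theorem rightAction_eq :
    letI := dualCopHopfObj H Hd
    rightAction H Hd = doubleCrossing H Hd ≫ ε[Hd] ▷ H ≫ (λ_ H).hom := by
  let inst := dualCopHopfObj H Hd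
  have h₁ := (isHopfPairing_evaluation H Hd).one_left
  have hJ := whiskerLeft_doubleCrossing_evaluation H Hd
  symm
  calc _ = doubleCrossing H Hd ⊗≫ ((λ_ Hd).hom ≫ ε[Hd]) ▷ H ⊗≫ 𝟙 H := by monoidal
    _ = 𝟙 _ ⊗≫ (𝟙_ C ◁ doubleCrossing H Hd ≫ η[H] ▷ (Hd ⊗ H)) ⊗≫ ε_ Hd H ▷ H ⊗≫ 𝟙 H := by
      rw [← h₁]; monoidal
    _ = 𝟙 _ ⊗≫ η[H] ▷ (H ⊗ Hd) ⊗≫ (H ◁ doubleCrossing H Hd ⊗≫ ε_ Hd H ▷ H ⊗≫ 𝟙 H) := by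
      rw [whisker_exchange]; monoidal
    _ = _ := by rw [hJ, rightAction, Rbar_eq]; monoidal

/-- The crossing is a comonoid morphism, hence recovered from its two components, and these are the
left and right actions by `leftAction_eq` and `rightAction_eq`. -/
theorem crossing_eq :
    letI := dualCopHopfObj H Hd
    HopfTuple.crossing (HopfTuple.of Hd) (HopfTuple.of H) (leftAction H Hd) (rightAction H Hd) =
      doubleCrossing H Hd := by
  let inst := dualCopHopfObj H Hd
  have : IsComonHom (doubleCrossing H Hd) :=
    (isHopfPairing_evaluation H Hd).isComonHom_doubleCrossing
  rw [comonHom_eq_comul_components (doubleCrossing H Hd), ← leftAction_eq, ← rightAction_eq,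
    HopfTuple.crossing, Comon.tensorObj_comul, tensorμ]
  dsimp only [HopfTuple.of]
  monoidal

theorem isHopf_D : (D H Hd).IsHopf := by
  let inst := dualCopHopfObj H Hd
  have h := isHopfPairing_evaluation H Hd
  have hd := h.isDistributiveLaw
  have : IsComonHom (doubleCrossing H Hd) := h.isComonHom_doubleCrossing
  rw [D, dualCop_eq_of]
  have e := crossing_eq H Hd
  have : IsComonHom (HopfTuple.crossing (HopfTuple.of Hd) (HopfTuple.of H) (leftAction H Hd)
    (rightAction H Hd)) := by rw [e]; exact this
  exact HopfTuple.isHopf_bicrossed _ _ (by rw [e]; exact hd)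

end DrinfeldDouble

/-! ### Reduction of the brace equation to an identity for the crossing. -/

namespace CategoryTheory

section

variable {C : Type u} [Category.{v} C] [MonoidalCategory C] [SymmetricCategory C]
variable {A B : C} [HopfObj A] [HopfObj B]

/-- The extension `q ⊗ h ⊗ a ⊗ k ⊗ p ⊗ l ↦ q a F(h ⊗ k ⊗ p) l`. -/
def bilinearExtension (F : B ⊗ (B ⊗ A) ⟶ A ⊗ B) :
    (A ⊗ B) ⊗ ((A ⊗ B) ⊗ (A ⊗ B)) ⟶ A ⊗ B :=
  𝟙 _ ⊗≫ A ◁ (β_ B A).hom ▷ (B ⊗ A ⊗ B) ⊗≫ (A ⊗ A) ◁ F ▷ B ⊗≫ μ[A] ▷ (A ⊗ B ⊗ B) ⊗≫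
    μ[A] ▷ (B ⊗ B) ⊗≫ A ◁ μ[B]

theorem bilinearExtension_injective :
    Function.Injective (bilinearExtension : (B ⊗ (B ⊗ A) ⟶ A ⊗ B) → _) := by
  -- The left inverse puts units in the positions `q`, `a` and `l`.
  apply Function.LeftInverse.injective (g := fun G =>
    𝟙 _ ⊗≫ (B ⊗ B ⊗ A) ◁ η[B] ⊗≫ B ◁ η[A] ▷ (B ⊗ A ⊗ B) ⊗≫ η[A] ▷ (B ⊗ A ⊗ B ⊗ A ⊗ B) ⊗≫ G)
  intro F
  dsimp only
  rw [bilinearExtension]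
  calc _ = 𝟙 _ ⊗≫ (B ⊗ B ⊗ A) ◁ η[B] ⊗≫ B ◁ η[A] ▷ (B ⊗ A ⊗ B) ⊗≫
        (η[A] ▷ (B ⊗ A) ≫ A ◁ (β_ B A).hom) ▷ (B ⊗ A ⊗ B) ⊗≫
        (A ⊗ A) ◁ F ▷ B ⊗≫ μ[A] ▷ (A ⊗ B ⊗ B) ⊗≫ μ[A] ▷ (B ⊗ B) ⊗≫ A ◁ μ[B] := by monoidal
    _ = 𝟙 _ ⊗≫ (B ⊗ B ⊗ A) ◁ η[B] ⊗≫ (B ◁ η[A] ≫ (β_ B A).hom) ▷ (B ⊗ A ⊗ B) ⊗≫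
        (η[A] ▷ (A ⊗ (B ⊗ B ⊗ A)) ≫ A ◁ (A ◁ F)) ▷ B ⊗≫ μ[A] ▷ (A ⊗ B ⊗ B) ⊗≫
        μ[A] ▷ (B ⊗ B) ⊗≫ A ◁ μ[B] := by
      rw [← whisker_exchange η[A] (β_ B A).hom]; monoidal
    _ = 𝟙 _ ⊗≫ (B ⊗ B ⊗ A) ◁ η[B] ⊗≫ (η[A] ▷ (B ⊗ B ⊗ A) ≫ A ◁ F) ▷ B ⊗≫
        (η[A] ▷ A ≫ μ[A]) ▷ (A ⊗ B ⊗ B) ⊗≫ μ[A] ▷ (B ⊗ B) ⊗≫ A ◁ μ[B] := by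
      rw [BraidedCategory.braiding_naturality_right, braiding_tensorUnit_right,
        ← whisker_exchange η[A]]
      monoidal
    _ = 𝟙 _ ⊗≫ ((B ⊗ B ⊗ A) ◁ η[B] ≫ F ▷ B) ⊗≫ (η[A] ▷ A ⊗≫ μ[A]) ▷ (B ⊗ B) ⊗≫ A ◁ μ[B] := by
      rw [MonObj.one_mul, ← whisker_exchange η[A]]
      monoidal
    _ = 𝟙 _ ⊗≫ ((B ⊗ B ⊗ A) ◁ η[B] ≫ F ▷ B) ⊗≫ (η[A] ▷ A ≫ μ[A]) ▷ (B ⊗ B) ⊗≫ A ◁ μ[B] := by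
      monoidal
    _ = 𝟙 _ ⊗≫ F ⊗≫ A ◁ (B ◁ η[B] ≫ μ[B]) := by
      rw [MonObj.one_mul, whisker_exchange]
      monoidal
    _ = _ := by rw [MonObj.mul_one]; monoidal

/-- `h ⊗ k ⊗ p ↦ h ∘ Ψ(k ⊗ p)`, where `∘` is the product of the tensor product algebra. -/
def crossingMulLeft (Ψ : B ⊗ A ⟶ A ⊗ B) : B ⊗ (B ⊗ A) ⟶ A ⊗ B :=
  B ◁ Ψ ⊗≫ (β_ B A).hom ▷ B ⊗≫ A ◁ μ[B]

/-- The left side of the brace equation. In the tensor product algebra the outer factors can be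
pulled out, leaving `h ∘ Ψ(k ⊗ p)` in the middle. -/
theorem whiskerLeft_bicrossedMul_braiding (Ψ : B ⊗ A ⟶ A ⊗ B) :
    (A ⊗ B) ◁ bicrossedMul Ψ ≫ bicrossedMul (β_ B A).hom =
      bilinearExtension (crossingMulLeft Ψ) := by
  rw [bilinearExtension, crossingMulLeft, bicrossedMul_eq', bicrossedMul_eq]
  calc _ = 𝟙 _ ⊗≫ (A ⊗ B ⊗ A) ◁ Ψ ▷ B ⊗≫ (A ⊗ B) ◁ A ◁ A ◁ μ[B] ⊗≫
        A ◁ (B ◁ μ[A] ≫ (β_ B A).hom) ▷ B ⊗≫ μ[A] ▷ (B ⊗ B) ⊗≫ A ◁ μ[B] := by monoidal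
    _ = 𝟙 _ ⊗≫ (A ⊗ B ⊗ A) ◁ Ψ ▷ B ⊗≫ (A ⊗ B) ◁ A ◁ A ◁ μ[B] ⊗≫
        A ◁ (β_ B A).hom ▷ (A ⊗ B) ⊗≫ A ◁ A ◁ (β_ B A).hom ▷ B ⊗≫
        (A ◁ μ[A] ≫ μ[A]) ▷ (B ⊗ B) ⊗≫ A ◁ μ[B] := by
      rw [BraidedCategory.braiding_naturality_right, BraidedCategory.braiding_tensor_right_hom]
      monoidal
    _ = 𝟙 _ ⊗≫ (A ⊗ B ⊗ A) ◁ Ψ ▷ B ⊗≫ A ◁ ((B ⊗ A ⊗ A) ◁ μ[B] ⊗≫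
        (β_ B A).hom ▷ (A ⊗ B) ⊗≫ A ◁ (β_ B A).hom ▷ B) ⊗≫
        (μ[A] ▷ A ⊗≫ μ[A]) ▷ (B ⊗ B) ⊗≫ A ◁ μ[B] := by
      rw [MonObj.mul_assoc_flip]; monoidal
    _ = 𝟙 _ ⊗≫ (A ⊗ B ⊗ A) ◁ Ψ ▷ B ⊗≫ A ◁ (((B ⊗ A) ⊗ A) ◁ μ[B] ≫
        ((β_ B A).hom ▷ A) ▷ B) ⊗≫ A ◁ A ◁ (β_ B A).hom ▷ B ⊗≫
        (μ[A] ▷ A ⊗≫ μ[A]) ▷ (B ⊗ B) ⊗≫ A ◁ μ[B] := by monoidal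
    _ = 𝟙 _ ⊗≫ (A ⊗ B ⊗ A) ◁ Ψ ▷ B ⊗≫ A ◁ (β_ B A).hom ▷ (A ⊗ B ⊗ B) ⊗≫ A ◁ A ◁
        ((B ⊗ A) ◁ μ[B] ≫ (β_ B A).hom ▷ B) ⊗≫ (μ[A] ▷ A ⊗≫ μ[A]) ▷ (B ⊗ B) ⊗≫ A ◁ μ[B] := by
      rw [whisker_exchange]; monoidal
    _ = 𝟙 _ ⊗≫ (A ⊗ B ⊗ A) ◁ Ψ ▷ B ⊗≫ A ◁ (β_ B A).hom ▷ (A ⊗ B ⊗ B) ⊗≫ A ◁ A ◁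
        (β_ B A).hom ▷ (B ⊗ B) ⊗≫ (((A ⊗ A) ⊗ A) ◁ (B ◁ μ[B]) ≫ (μ[A] ▷ A) ▷ (B ⊗ B)) ⊗≫
        μ[A] ▷ (B ⊗ B) ⊗≫ A ◁ μ[B] := by
      rw [whisker_exchange]; monoidal
    _ = 𝟙 _ ⊗≫ (A ⊗ B ⊗ A) ◁ Ψ ▷ B ⊗≫ A ◁ (β_ B A).hom ▷ (A ⊗ B ⊗ B) ⊗≫ A ◁ A ◁
        (β_ B A).hom ▷ (B ⊗ B) ⊗≫ μ[A] ▷ (A ⊗ B ⊗ B ⊗ B) ⊗≫ ((A ⊗ A) ◁ (B ◁ μ[B]) ≫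
        μ[A] ▷ (B ⊗ B)) ⊗≫ A ◁ μ[B] := by
      rw [whisker_exchange]; monoidal
    _ = 𝟙 _ ⊗≫ (A ⊗ B ⊗ A) ◁ Ψ ▷ B ⊗≫ A ◁ (β_ B A).hom ▷ (A ⊗ B ⊗ B) ⊗≫ A ◁ A ◁
        (β_ B A).hom ▷ (B ⊗ B) ⊗≫ μ[A] ▷ (A ⊗ B ⊗ B ⊗ B) ⊗≫
        μ[A] ▷ (B ⊗ B ⊗ B) ⊗≫ A ◁ (B ◁ μ[B] ≫ μ[B]) := by
      rw [whisker_exchange]; monoidal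
    _ = 𝟙 _ ⊗≫ A ◁ ((B ⊗ A) ◁ Ψ ≫ (β_ B A).hom ▷ (A ⊗ B)) ▷ B ⊗≫ A ◁ A ◁
        (β_ B A).hom ▷ (B ⊗ B) ⊗≫ μ[A] ▷ (A ⊗ B ⊗ B ⊗ B) ⊗≫
        (((A ⊗ A) ◁ (μ[B] ▷ B) ≫ μ[A] ▷ (B ⊗ B))) ⊗≫ A ◁ μ[B] := by
      rw [MonObj.mul_assoc_flip, whisker_exchange μ[A] (μ[B] ▷ B)]; monoidal
    _ = 𝟙 _ ⊗≫ A ◁ (β_ B A).hom ▷ (B ⊗ A ⊗ B) ⊗≫ (A ⊗ A) ◁ (B ◁ Ψ ⊗≫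
        (β_ B A).hom ▷ B) ▷ B ⊗≫ (((A ⊗ A) ⊗ A) ◁ (μ[B] ▷ B) ≫ (μ[A] ▷ A) ▷ (B ⊗ B)) ⊗≫
        μ[A] ▷ (B ⊗ B) ⊗≫ A ◁ μ[B] := by
      rw [whisker_exchange (β_ B A).hom Ψ, whisker_exchange (μ[A] ▷ A)]; monoidal
    _ = _ := by monoidal

end

section

variable {C : Type u} [Category.{v} C] [MonoidalCategory C] [SymmetricCategory C]
variable {A B : C} [HopfObj A] [HopfObj B] {Ψ : B ⊗ A ⟶ A ⊗ B}

theorem antipode_mul_cancel :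
    Δ[A] ▷ A ⊗≫ A ◁ μ[A] ⊗≫ 𝒮[A] ▷ A ≫ μ[A] = ε[A] ▷ A ≫ (λ_ A).hom := by
  calc _ = Δ[A] ▷ A ⊗≫ (A ◁ μ[A] ≫ 𝒮[A] ▷ A) ≫ μ[A] := by monoidal
    _ = (Δ[A] ≫ 𝒮[A] ▷ A) ▷ A ⊗≫ A ◁ μ[A] ≫ μ[A] := by
      rw [whisker_exchange]; monoidal
    _ = (Δ[A] ≫ 𝒮[A] ▷ A ≫ μ[A]) ▷ A ≫ μ[A] := by
      rw [MonObj.mul_assoc_flip]; monoidal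
    _ = _ := by
      rw [HopfObj.antipode_left, comp_whiskerRight, Category.assoc, MonObj.one_mul]

theorem antipode_mul_cancel_tensor :
    Δ[A] ▷ (B ⊗ (A ⊗ B)) ⊗≫ A ◁ (A ◁ (β_ B A).hom ▷ B ⊗≫ μ[A] ▷ (B ⊗ B) ⊗≫ A ◁ μ[B]) ⊗≫
        (𝒮[A] ▷ A ≫ μ[A]) ▷ B =
      ε[A] ▷ (B ⊗ (A ⊗ B)) ⊗≫ (β_ B A).hom ▷ B ⊗≫ A ◁ μ[B] := by
  calc _ = Δ[A] ▷ (B ⊗ (A ⊗ B)) ⊗≫ A ◁ (A ◁ (β_ B A).hom ▷ B) ⊗≫ A ◁ (μ[A] ▷ (B ⊗ B) ≫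
        A ◁ μ[B]) ⊗≫ (𝒮[A] ▷ A ≫ μ[A]) ▷ B := by monoidal
    _ = (Δ[A] ▷ (B ⊗ (A ⊗ B)) ≫ (A ⊗ A) ◁ (𝟙 (B ⊗ (A ⊗ B)) ⊗≫ (β_ B A).hom ▷ B ⊗≫
        A ◁ μ[B])) ⊗≫ A ◁ μ[A] ▷ B ⊗≫ (𝒮[A] ▷ A ≫ μ[A]) ▷ B := by
      rw [← whisker_exchange]; monoidal
    _ = 𝟙 _ ⊗≫ A ◁ (𝟙 (B ⊗ (A ⊗ B)) ⊗≫ (β_ B A).hom ▷ B ⊗≫ A ◁ μ[B]) ⊗≫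
        (Δ[A] ▷ A ⊗≫ A ◁ μ[A] ⊗≫ 𝒮[A] ▷ A ≫ μ[A]) ▷ B := by
      rw [← whisker_exchange]; monoidal
    _ = 𝟙 _ ⊗≫ (A ◁ (𝟙 (B ⊗ (A ⊗ B)) ⊗≫ (β_ B A).hom ▷ B ⊗≫ A ◁ μ[B]) ≫
        ε[A] ▷ (A ⊗ B)) ⊗≫ 𝟙 _ := by
      rw [antipode_mul_cancel]; monoidal
    _ = _ := by
      rw [whisker_exchange]; monoidal

/-- The antipode of `a ⊗ h` is `Ψ(S(h) ⊗ S(a))`; by `mul_right` a following factor `p` is absorbed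
as `Ψ(S(h) ⊗ S(a) p)`. -/
theorem crossing_antipode_bicrossedMul (h : IsDistributiveLaw Ψ) :
    ((β_ A B).hom ≫ (𝒮[B] ⊗ₘ 𝒮[A]) ≫ Ψ) ▷ (A ⊗ B) ≫ bicrossedMul Ψ =
      (β_ A B).hom ▷ (A ⊗ B) ⊗≫ B ◁ (𝒮[A] ▷ A ≫ μ[A]) ▷ B ⊗≫ (𝒮[B] ▷ A ≫ Ψ) ▷ B ⊗≫ A ◁ μ[B] := by
  rw [bicrossedMul_eq, MonoidalCategory.tensorHom_def]
  calc _ = ((β_ A B).hom ≫ 𝒮[B] ▷ A) ▷ (A ⊗ B) ⊗≫ B ◁ 𝒮[A] ▷ (A ⊗ B) ⊗≫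
        (𝟙 (B ⊗ (A ⊗ A)) ⊗≫ Ψ ▷ A ⊗≫ A ◁ Ψ ⊗≫ μ[A] ▷ B) ▷ B ⊗≫ A ◁ μ[B] := by monoidal
    _ = (β_ A B).hom ▷ (A ⊗ B) ⊗≫ (𝒮[B] ▷ (A ⊗ A) ≫ B ◁ (𝒮[A] ▷ A ≫ μ[A])) ▷ B ⊗≫ Ψ ▷ B ⊗≫
        A ◁ μ[B] := by rw [← h.mul_right]; monoidal
    _ = _ := by rw [← whisker_exchange]; monoidal

theorem comul_braiding_braiding {A : C} (B : C) [ComonObj A] :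
    𝟙 _ ⊗≫ Δ[A] ▷ B ⊗≫ A ◁ (β_ A B).hom ⊗≫ (β_ A B).hom ▷ A ⊗≫ 𝟙 (B ⊗ (A ⊗ A)) =
      (β_ A B).hom ≫ B ◁ Δ[A] := by
  rw [← BraidedCategory.braiding_naturality_left, BraidedCategory.braiding_tensor_left_hom]
  monoidal

variable (A) in
/-- `h ⊗ p ⊗ l ↦ Ψ(S h₁ ⊗ p) h₂ l`. -/
def crossingGamma (Ψ : B ⊗ A ⟶ A ⊗ B) : B ⊗ (A ⊗ B) ⟶ A ⊗ B :=
  Δ[B] ▷ (A ⊗ B) ⊗≫ B ◁ (𝟙 (B ⊗ (A ⊗ B)) ⊗≫ (β_ B A).hom ▷ B ⊗≫ A ◁ μ[B]) ⊗≫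
    (𝒮[B] ▷ A ≫ Ψ) ▷ B ⊗≫ A ◁ μ[B]

/-- Computes `Γ` on `(a ⊗ h) ⊗ (p ⊗ l)` as `ε(a) Ψ(S(h₁) ⊗ p) h₂ l`: the tensor product contributes
`a₂ p`, and `S(a₁) a₂` cancels inside `Ψ`. -/
theorem gamma_bicrossed (h : IsDistributiveLaw Ψ) :
    ((Δ[A] ⊗ₘ Δ[B]) ⊗≫ A ◁ (β_ A B).hom ▷ B ⊗≫ 𝟙 ((A ⊗ B) ⊗ (A ⊗ B))) ▷ (A ⊗ B) ⊗≫
        ((β_ A B).hom ≫ (𝒮[B] ⊗ₘ 𝒮[A]) ≫ Ψ ⊗ₘ bicrossedMul (β_ B A).hom) ≫ bicrossedMul Ψ =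
      ε[A] ▷ B ▷ (A ⊗ B) ⊗≫ crossingGamma A Ψ := by
  rw [MonoidalCategory.tensorHom_def' ((β_ A B).hom ≫ _), Category.assoc,
    crossing_antipode_bicrossedMul h, bicrossedMul_eq, MonoidalCategory.tensorHom_def',
    crossingGamma]
  calc _ = 𝟙 _ ⊗≫ A ◁ Δ[B] ▷ (A ⊗ B) ⊗≫ Δ[A] ▷ (B ⊗ B ⊗ A ⊗ B) ⊗≫
        A ◁ (β_ A B).hom ▷ (B ⊗ A ⊗ B) ⊗≫
        ((A ⊗ B) ◁ (𝟙 ((A ⊗ B) ⊗ (A ⊗ B)) ⊗≫ A ◁ (β_ B A).hom ▷ B ⊗≫ μ[A] ▷ (B ⊗ B) ⊗≫ A ◁ μ[B]) ≫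
        (β_ A B).hom ▷ (A ⊗ B)) ⊗≫ B ◁ (𝒮[A] ▷ A ≫ μ[A]) ▷ B ⊗≫ (𝒮[B] ▷ A ≫ Ψ) ▷ B ⊗≫
        A ◁ μ[B] := by monoidal
    _ = 𝟙 _ ⊗≫ A ◁ Δ[B] ▷ (A ⊗ B) ⊗≫ (𝟙 (A ⊗ B) ⊗≫ Δ[A] ▷ B ⊗≫
        A ◁ (β_ A B).hom ⊗≫ (β_ A B).hom ▷ A ⊗≫ 𝟙 (B ⊗ (A ⊗ A))) ▷ (B ⊗ A ⊗ B) ⊗≫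
        (B ⊗ A) ◁ (𝟙 ((A ⊗ B) ⊗ (A ⊗ B)) ⊗≫ A ◁ (β_ B A).hom ▷ B ⊗≫ μ[A] ▷ (B ⊗ B) ⊗≫ A ◁ μ[B]) ⊗≫
        B ◁ (𝒮[A] ▷ A ≫ μ[A]) ▷ B ⊗≫ (𝒮[B] ▷ A ≫ Ψ) ▷ B ⊗≫ A ◁ μ[B] := by
      rw [whisker_exchange]; monoidal
    _ = 𝟙 _ ⊗≫ A ◁ Δ[B] ▷ (A ⊗ B) ⊗≫ (β_ A B).hom ▷ (B ⊗ A ⊗ B) ⊗≫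
        B ◁ (Δ[A] ▷ (B ⊗ (A ⊗ B)) ⊗≫ A ◁ (A ◁ (β_ B A).hom ▷ B ⊗≫ μ[A] ▷ (B ⊗ B) ⊗≫
          A ◁ μ[B]) ⊗≫ (𝒮[A] ▷ A ≫ μ[A]) ▷ B) ⊗≫ (𝒮[B] ▷ A ≫ Ψ) ▷ B ⊗≫ A ◁ μ[B] := by
      rw [comul_braiding_braiding B]; monoidal
    _ = 𝟙 _ ⊗≫ A ◁ Δ[B] ▷ (A ⊗ B) ⊗≫ ((β_ A B).hom ≫ B ◁ ε[A]) ▷ (B ⊗ A ⊗ B) ⊗≫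
        B ◁ (𝟙 (B ⊗ (A ⊗ B)) ⊗≫ (β_ B A).hom ▷ B ⊗≫ A ◁ μ[B]) ⊗≫ (𝒮[B] ▷ A ≫ Ψ) ▷ B ⊗≫
        A ◁ μ[B] := by
      rw [antipode_mul_cancel_tensor]; monoidal
    _ = 𝟙 _ ⊗≫ (A ◁ Δ[B] ≫ ε[A] ▷ (B ⊗ B)) ▷ (A ⊗ B) ⊗≫
        B ◁ (𝟙 (B ⊗ (A ⊗ B)) ⊗≫ (β_ B A).hom ▷ B ⊗≫ A ◁ μ[B]) ⊗≫ (𝒮[B] ▷ A ≫ Ψ) ▷ B ⊗≫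
        A ◁ μ[B] := by
      rw [← BraidedCategory.braiding_naturality_left, braiding_tensorUnit_left]; monoidal
    _ = _ := by rw [whisker_exchange]; monoidal

end

section

variable {C : Type u} [Category.{v} C] [MonoidalCategory C] [SymmetricCategory C]

section

variable {A B : C} [HopfObj A] [HopfObj B] {Ψ : B ⊗ A ⟶ A ⊗ B}

/-- In elements, `(q ⊗ h) · (Ψ(k ⊗ p) l) = q Ψ(h k ⊗ p) l`, which is `mul_left` with spectators. -/
theorem IsDistributiveLaw.whiskerLeft_bicrossedMul (h : IsDistributiveLaw Ψ) :
    (A ⊗ B) ◁ (Ψ ▷ B ⊗≫ A ◁ μ[B]) ≫ bicrossedMul Ψ =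
      𝟙 ((A ⊗ B) ⊗ (B ⊗ A) ⊗ B) ⊗≫ A ◁ (μ[B] ▷ A ≫ Ψ) ▷ B ⊗≫ μ[A] ▷ (B ⊗ B) ⊗≫ A ◁ μ[B] := by
  rw [bicrossedMul_eq]
  calc _ = 𝟙 _ ⊗≫ (A ⊗ B) ◁ Ψ ▷ B ⊗≫ A ◁ ((B ⊗ A) ◁ μ[B] ≫ Ψ ▷ B) ⊗≫ μ[A] ▷ (B ⊗ B) ⊗≫
        A ◁ μ[B] := by monoidal
    _ = 𝟙 _ ⊗≫ A ◁ (B ◁ Ψ ⊗≫ Ψ ▷ B) ▷ B ⊗≫ ((A ⊗ A) ◁ (B ◁ μ[B]) ≫ μ[A] ▷ (B ⊗ B)) ⊗≫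
        A ◁ μ[B] := by
      rw [whisker_exchange]; monoidal
    _ = 𝟙 _ ⊗≫ A ◁ (B ◁ Ψ ⊗≫ Ψ ▷ B) ▷ B ⊗≫ μ[A] ▷ (B ⊗ B ⊗ B) ⊗≫ A ◁ (B ◁ μ[B] ≫ μ[B]) := by
      rw [whisker_exchange]; monoidal
    _ = 𝟙 _ ⊗≫ A ◁ (B ◁ Ψ ⊗≫ Ψ ▷ B) ▷ B ⊗≫ (μ[A] ▷ ((B ⊗ B) ⊗ B) ≫ A ◁ (μ[B] ▷ B)) ⊗≫
        A ◁ μ[B] := by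
      rw [MonObj.mul_assoc_flip]; monoidal
    _ = 𝟙 _ ⊗≫ A ◁ (𝟙 ((B ⊗ B) ⊗ A) ⊗≫ B ◁ Ψ ⊗≫ Ψ ▷ B ⊗≫ A ◁ μ[B]) ▷ B ⊗≫
        μ[A] ▷ (B ⊗ B) ⊗≫ A ◁ μ[B] := by
      rw [← whisker_exchange]; monoidal
    _ = _ := by rw [← h.mul_left]

/-- `h ⊗ k ⊗ p ↦ Ψ(h₁ k S h₂ ⊗ p) h₃`. -/
def adjointCrossing {A : C} (Ψ : B ⊗ A ⟶ A ⊗ B) : B ⊗ (B ⊗ A) ⟶ A ⊗ B :=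
  𝟙 _ ⊗≫ (Δ[B] ▷ B ⊗≫ B ◁ (β_ B B).hom ⊗≫ DrinfeldDouble.adjointAction B ▷ B) ▷ A ⊗≫
    B ◁ (β_ B A).hom ⊗≫ Ψ ▷ B ⊗≫ A ◁ μ[B]

theorem comul_braiding_comul {B : C} [ComonObj B] :
    Δ[B] ▷ B ⊗≫ B ◁ (β_ B B).hom ⊗≫ B ◁ B ◁ Δ[B] =
      Δ[B] ▷ B ⊗≫ B ◁ (β_ B B).hom ⊗≫ Δ[B] ▷ B ▷ B ⊗≫ B ◁ (β_ B B).hom ▷ B ⊗≫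
        𝟙 (B ⊗ (B ⊗ (B ⊗ B))) := by
  calc _ = Δ[B] ▷ B ⊗≫ B ◁ ((β_ B B).hom ≫ B ◁ Δ[B]) := by monoidal
    _ = (Δ[B] ≫ B ◁ Δ[B]) ▷ B ⊗≫ B ◁ (B ◁ (β_ B B).hom ⊗≫ (β_ B B).hom ▷ B) ⊗≫ 𝟙 _ := by
      rw [← BraidedCategory.braiding_naturality_left, BraidedCategory.braiding_tensor_left_hom]
      monoidal
    _ = Δ[B] ▷ B ⊗≫ (Δ[B] ▷ (B ⊗ B) ≫ (B ⊗ B) ◁ (β_ B B).hom) ⊗≫ B ◁ (β_ B B).hom ▷ B ⊗≫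
        𝟙 _ := by
      rw [ComonObj.comul_assoc]; monoidal
    _ = _ := by rw [← whisker_exchange]; monoidal

/-- The factor `h₁ k` from the product of `T(H)` and the factor `S(h₂)` from `Γ` assemble into the
adjoint action, while `h₃` remains outside; coassociativity matches the legs. -/
theorem comul_mul_adjointCrossing {A : C} (Ψ : B ⊗ A ⟶ A ⊗ B) :
    𝟙 _ ⊗≫ Δ[B] ▷ (B ⊗ (A ⊗ B)) ⊗≫ B ◁ (β_ B B).hom ▷ (A ⊗ B) ⊗≫ μ[B] ▷ (B ⊗ (A ⊗ B)) ⊗≫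
      B ◁ (Δ[B] ▷ (A ⊗ B) ⊗≫ B ◁ (𝟙 (B ⊗ (A ⊗ B)) ⊗≫ (β_ B A).hom ▷ B ⊗≫ A ◁ μ[B]) ⊗≫
        𝒮[B] ▷ (A ⊗ B)) ⊗≫ (μ[B] ▷ A ≫ Ψ) ▷ B ⊗≫ A ◁ μ[B] =
    adjointCrossing Ψ ▷ B ⊗≫ A ◁ μ[B] := by
  symm
  rw [adjointCrossing, DrinfeldDouble.adjointAction, MonoidalCategory.tensorHom_def]
  generalize hQ : 𝟙 (B ⊗ (A ⊗ B)) ⊗≫ (β_ B A).hom ▷ B ⊗≫ A ◁ μ[B] = Q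
  calc _ = 𝟙 _ ⊗≫ (Δ[B] ▷ B ⊗≫ B ◁ (β_ B B).hom ⊗≫ Δ[B] ▷ B ▷ B ⊗≫ B ◁ (β_ B B).hom ▷ B ⊗≫
        𝟙 (B ⊗ (B ⊗ (B ⊗ B)))) ▷ (A ⊗ B) ⊗≫ μ[B] ▷ (B ⊗ (B ⊗ (A ⊗ B))) ⊗≫
        (B ◁ 𝒮[B] ≫ μ[B]) ▷ (B ⊗ (A ⊗ B)) ⊗≫ B ◁ (β_ B A).hom ▷ B ⊗≫ Ψ ▷ (B ⊗ B) ⊗≫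
        A ◁ (μ[B] ▷ B ≫ μ[B]) := by monoidal
    _ = 𝟙 _ ⊗≫ (Δ[B] ▷ B ⊗≫ B ◁ (β_ B B).hom ⊗≫ B ◁ B ◁ Δ[B]) ▷ (A ⊗ B) ⊗≫
        μ[B] ▷ (B ⊗ (B ⊗ (A ⊗ B))) ⊗≫ (B ◁ 𝒮[B] ≫ μ[B]) ▷ (B ⊗ (A ⊗ B)) ⊗≫
        B ◁ (β_ B A).hom ▷ B ⊗≫ (Ψ ▷ (B ⊗ B) ≫ (A ⊗ B) ◁ μ[B]) ⊗≫ A ◁ μ[B] := by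
      rw [← comul_braiding_comul, MonObj.mul_assoc]; monoidal
    _ = 𝟙 _ ⊗≫ (Δ[B] ▷ B ⊗≫ B ◁ (β_ B B).hom ⊗≫ B ◁ B ◁ Δ[B]) ▷ (A ⊗ B) ⊗≫
        μ[B] ▷ (B ⊗ (B ⊗ (A ⊗ B))) ⊗≫ (B ◁ 𝒮[B] ≫ μ[B]) ▷ (B ⊗ (A ⊗ B)) ⊗≫
        B ◁ (𝟙 (B ⊗ (A ⊗ B)) ⊗≫ (β_ B A).hom ▷ B ⊗≫ A ◁ μ[B]) ⊗≫ Ψ ▷ B ⊗≫ A ◁ μ[B] := by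
      rw [← whisker_exchange]; monoidal
    _ = 𝟙 _ ⊗≫ (Δ[B] ▷ B ⊗≫ B ◁ (β_ B B).hom ⊗≫ B ◁ B ◁ Δ[B]) ▷ (A ⊗ B) ⊗≫
        μ[B] ▷ (B ⊗ (B ⊗ (A ⊗ B))) ⊗≫ B ◁ 𝒮[B] ▷ (B ⊗ (A ⊗ B)) ⊗≫
        (μ[B] ▷ (B ⊗ (A ⊗ B)) ≫ B ◁ Q) ⊗≫ Ψ ▷ B ⊗≫ A ◁ μ[B] := by
      rw [hQ]; monoidal
    _ = 𝟙 _ ⊗≫ Δ[B] ▷ (B ⊗ (A ⊗ B)) ⊗≫ B ◁ (β_ B B).hom ▷ (A ⊗ B) ⊗≫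
        ((B ⊗ B) ◁ (Δ[B] ▷ (A ⊗ B)) ≫ μ[B] ▷ ((B ⊗ B) ⊗ (A ⊗ B))) ⊗≫
        B ◁ (𝒮[B] ▷ (B ⊗ (A ⊗ B)) ≫ B ◁ Q) ⊗≫ (μ[B] ▷ A ≫ Ψ) ▷ B ⊗≫ A ◁ μ[B] := by
      rw [← whisker_exchange μ[B] Q]; monoidal
    _ = _ := by rw [whisker_exchange, ← whisker_exchange 𝒮[B] Q]; monoidal

theorem comul_braiding_counit :
    (((Δ[A] ⊗ₘ Δ[B]) ⊗≫ A ◁ (β_ A B).hom ▷ B ⊗≫ 𝟙 ((A ⊗ B) ⊗ (A ⊗ B))) ▷ (A ⊗ B) ⊗≫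
        (A ⊗ B) ◁ (β_ (A ⊗ B) (A ⊗ B)).hom) ≫ (A ⊗ B) ◁ (A ⊗ B) ◁ (ε[A] ▷ B) =
      𝟙 _ ⊗≫ A ◁ Δ[B] ▷ (A ⊗ B) ⊗≫ (A ⊗ B) ◁ (β_ B (A ⊗ B)).hom ⊗≫ 𝟙 _ := by
  rw [MonoidalCategory.tensorHom_def']
  calc _ = 𝟙 _ ⊗≫ A ◁ Δ[B] ▷ (A ⊗ B) ⊗≫ Δ[A] ▷ (B ⊗ B ⊗ A ⊗ B) ⊗≫
        A ◁ (β_ A B).hom ▷ (B ⊗ A ⊗ B) ⊗≫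
        (A ⊗ B) ◁ ((β_ (A ⊗ B) (A ⊗ B)).hom ≫ (A ⊗ B) ◁ (ε[A] ▷ B)) := by monoidal
    _ = 𝟙 _ ⊗≫ A ◁ Δ[B] ▷ (A ⊗ B) ⊗≫ Δ[A] ▷ (B ⊗ B ⊗ A ⊗ B) ⊗≫
        A ◁ ((β_ A B).hom ≫ B ◁ ε[A]) ▷ (B ⊗ A ⊗ B) ⊗≫
        (A ⊗ B) ◁ (β_ B (A ⊗ B)).hom ⊗≫ 𝟙 _ := by
      rw [← BraidedCategory.braiding_naturality_left, BraidedCategory.braiding_tensor_left_hom,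
        braiding_tensorUnit_left]
      monoidal
    _ = 𝟙 _ ⊗≫ A ◁ Δ[B] ▷ (A ⊗ B) ⊗≫ (Δ[A] ≫ A ◁ ε[A]) ▷ (B ⊗ B ⊗ A ⊗ B) ⊗≫
        (A ⊗ B) ◁ (β_ B (A ⊗ B)).hom ⊗≫ 𝟙 _ := by
      rw [← BraidedCategory.braiding_naturality_left, braiding_tensorUnit_left]
      monoidal
    _ = _ := by rw [ComonObj.comul_counit]; monoidal

theorem mul_mul_tensor_mul :
    μ[A] ▷ (A ⊗ (B ⊗ B)) ⊗≫ μ[A] ▷ (B ⊗ B) ⊗≫ A ◁ μ[B] =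
      (A ⊗ A) ◁ A ◁ μ[B] ⊗≫ μ[A] ▷ (A ⊗ B) ⊗≫ μ[A] ▷ B := by
  calc _ = μ[A] ▷ (A ⊗ (B ⊗ B)) ⊗≫ (μ[A] ▷ (B ⊗ B) ≫ A ◁ μ[B]) := by monoidal
    _ = (μ[A] ▷ (A ⊗ (B ⊗ B)) ≫ A ◁ (A ◁ μ[B])) ⊗≫ μ[A] ▷ B := by
      rw [← whisker_exchange]; monoidal
    _ = _ := by rw [← whisker_exchange]; monoidal

theorem comul_braiding_braiding' {B : C} (A : C) [ComonObj B] :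
    𝟙 _ ⊗≫ Δ[B] ▷ A ⊗≫ B ◁ (β_ B A).hom ⊗≫ (β_ B A).hom ▷ B ⊗≫ 𝟙 (A ⊗ (B ⊗ B)) =
      (β_ B A).hom ≫ A ◁ Δ[B] := by
  rw [← BraidedCategory.braiding_naturality_left, BraidedCategory.braiding_tensor_left_hom]
  monoidal

/-- The right side of the brace equation. The counit on `A` in `Γ` leaves `(q a ⊗ h₁ k) · (Ψ(S(h₂) ⊗
p) h₃ l)`, and `whiskerLeft_bicrossedMul` merges it to `q a Ψ(h₁ k S(h₂) ⊗ p) h₃ l`. -/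
theorem bicrossedMul_gamma (h : IsDistributiveLaw Ψ) :
    ((Δ[A] ⊗ₘ Δ[B]) ⊗≫ A ◁ (β_ A B).hom ▷ B ⊗≫ 𝟙 ((A ⊗ B) ⊗ (A ⊗ B))) ▷
        ((A ⊗ B) ⊗ (A ⊗ B)) ⊗≫ (A ⊗ B) ◁ (β_ (A ⊗ B) (A ⊗ B)).hom ▷ (A ⊗ B) ⊗≫
        (bicrossedMul (β_ B A).hom ⊗ₘ (ε[A] ▷ B ▷ (A ⊗ B) ⊗≫ crossingGamma A Ψ)) ≫
          bicrossedMul Ψ =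
      bilinearExtension (adjointCrossing Ψ) := by
  have h₁ := h.whiskerLeft_bicrossedMul
  have h₂ := comul_mul_adjointCrossing (A := A) Ψ
  have h₃ := comul_braiding_counit (A := A) (B := B)
  have h₄ : (A ⊗ B) ◁ crossingGamma A Ψ ≫ bicrossedMul Ψ = (A ⊗ B) ◁ (Δ[B] ▷ (A ⊗ B) ⊗≫
      B ◁ (𝟙 (B ⊗ (A ⊗ B)) ⊗≫ (β_ B A).hom ▷ B ⊗≫ A ◁ μ[B]) ⊗≫ 𝒮[B] ▷ (A ⊗ B)) ⊗≫
        A ◁ (μ[B] ▷ A ≫ Ψ) ▷ B ⊗≫ μ[A] ▷ (B ⊗ B) ⊗≫ A ◁ μ[B] := by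
    calc _ = (A ⊗ B) ◁ (Δ[B] ▷ (A ⊗ B) ⊗≫ B ◁ (𝟙 (B ⊗ (A ⊗ B)) ⊗≫ (β_ B A).hom ▷ B ⊗≫
          A ◁ μ[B]) ⊗≫ 𝒮[B] ▷ (A ⊗ B)) ⊗≫ (A ⊗ B) ◁ (Ψ ▷ B ⊗≫ A ◁ μ[B]) ≫ bicrossedMul Ψ := by
          rw [crossingGamma]; monoidal
      _ = _ := by rw [h₁]; monoidal
  generalize Δ[B] ▷ (A ⊗ B) ⊗≫ B ◁ (𝟙 (B ⊗ (A ⊗ B)) ⊗≫ (β_ B A).hom ▷ B ⊗≫ A ◁ μ[B]) ⊗≫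
    𝒮[B] ▷ (A ⊗ B) = R at h₂ h₄
  generalize μ[B] ▷ A ≫ Ψ = V at h₂ h₄
  rw [MonoidalCategory.tensorHom_def' (bicrossedMul _)]
  calc _ = 𝟙 _ ⊗≫ ((((Δ[A] ⊗ₘ Δ[B]) ⊗≫ A ◁ (β_ A B).hom ▷ B ⊗≫ 𝟙 ((A ⊗ B) ⊗ (A ⊗ B))) ▷
        (A ⊗ B) ⊗≫ (A ⊗ B) ◁ (β_ (A ⊗ B) (A ⊗ B)).hom) ≫ (A ⊗ B) ◁ (A ⊗ B) ◁ (ε[A] ▷ B)) ▷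
        (A ⊗ B) ⊗≫ (((A ⊗ B) ⊗ (A ⊗ B)) ◁ crossingGamma A Ψ ≫
          bicrossedMul (β_ B A).hom ▷ (A ⊗ B)) ≫ bicrossedMul Ψ := by
        monoidal
    _ = 𝟙 _ ⊗≫ A ◁ Δ[B] ▷ ((A ⊗ B) ⊗ (A ⊗ B)) ⊗≫ (A ⊗ B) ◁ (β_ B (A ⊗ B)).hom ▷ (A ⊗ B) ⊗≫
        bicrossedMul (β_ B A).hom ▷ (B ⊗ (A ⊗ B)) ≫ (A ⊗ B) ◁ crossingGamma A Ψ ≫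
          bicrossedMul Ψ := by
      rw [h₃, whisker_exchange]; monoidal
    _ = 𝟙 _ ⊗≫ A ◁ Δ[B] ▷ ((A ⊗ B) ⊗ (A ⊗ B)) ⊗≫ (A ⊗ B) ◁ (β_ B A).hom ▷ (B ⊗ (A ⊗ B)) ⊗≫
        A ◁ ((B ⊗ A) ◁ (β_ B B).hom ▷ (A ⊗ B) ≫ (β_ B A).hom ▷ ((B ⊗ B) ⊗ (A ⊗ B))) ⊗≫
        μ[A] ▷ (B ⊗ B ⊗ (B ⊗ (A ⊗ B))) ⊗≫ A ◁ μ[B] ▷ (B ⊗ (A ⊗ B)) ⊗≫ (A ⊗ B) ◁ R ⊗≫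
        A ◁ V ▷ B ⊗≫ μ[A] ▷ (B ⊗ B) ⊗≫ A ◁ μ[B] := by
      rw [h₄, BraidedCategory.braiding_tensor_right_hom, bicrossedMul_eq]; monoidal
    _ = 𝟙 _ ⊗≫ A ◁ (𝟙 (B ⊗ A) ⊗≫ Δ[B] ▷ A ⊗≫ B ◁ (β_ B A).hom ⊗≫ (β_ B A).hom ▷ B ⊗≫
        𝟙 (A ⊗ (B ⊗ B))) ▷ (B ⊗ (A ⊗ B)) ⊗≫ (A ⊗ A ⊗ B) ◁ (β_ B B).hom ▷ (A ⊗ B) ⊗≫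
        μ[A] ▷ (B ⊗ B ⊗ (B ⊗ (A ⊗ B))) ⊗≫ A ◁ μ[B] ▷ (B ⊗ (A ⊗ B)) ⊗≫ (A ⊗ B) ◁ R ⊗≫
        A ◁ V ▷ B ⊗≫ μ[A] ▷ (B ⊗ B) ⊗≫ A ◁ μ[B] := by
      rw [whisker_exchange]; monoidal
    _ = 𝟙 _ ⊗≫ A ◁ (β_ B A).hom ▷ (B ⊗ (A ⊗ B)) ⊗≫ (A ⊗ A) ◁ (Δ[B] ▷ (B ⊗ (A ⊗ B)) ⊗≫
        B ◁ (β_ B B).hom ▷ (A ⊗ B)) ⊗≫ (μ[A] ▷ ((B ⊗ B) ⊗ (B ⊗ (A ⊗ B))) ≫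
        A ◁ (μ[B] ▷ (B ⊗ (A ⊗ B)) ⊗≫ B ◁ R ⊗≫ V ▷ B)) ⊗≫ μ[A] ▷ (B ⊗ B) ⊗≫ A ◁ μ[B] := by
      rw [comul_braiding_braiding' A]; monoidal
    _ = 𝟙 _ ⊗≫ A ◁ (β_ B A).hom ▷ (B ⊗ (A ⊗ B)) ⊗≫ (A ⊗ A) ◁ (Δ[B] ▷ (B ⊗ (A ⊗ B)) ⊗≫
        B ◁ (β_ B B).hom ▷ (A ⊗ B) ⊗≫ μ[B] ▷ (B ⊗ (A ⊗ B)) ⊗≫ B ◁ R ⊗≫ V ▷ B) ⊗≫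
        (μ[A] ▷ (A ⊗ (B ⊗ B)) ⊗≫ μ[A] ▷ (B ⊗ B) ⊗≫ A ◁ μ[B]) := by
      rw [← whisker_exchange]; monoidal
    _ = 𝟙 _ ⊗≫ A ◁ (β_ B A).hom ▷ (B ⊗ (A ⊗ B)) ⊗≫ (A ⊗ A) ◁ (𝟙 ((B ⊗ (B ⊗ A)) ⊗ B) ⊗≫
        Δ[B] ▷ (B ⊗ (A ⊗ B)) ⊗≫ B ◁ (β_ B B).hom ▷ (A ⊗ B) ⊗≫ μ[B] ▷ (B ⊗ (A ⊗ B)) ⊗≫ B ◁ R ⊗≫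
        V ▷ B ⊗≫ A ◁ μ[B]) ⊗≫ μ[A] ▷ (A ⊗ B) ⊗≫ μ[A] ▷ B := by
      rw [mul_mul_tensor_mul]; monoidal
    _ = 𝟙 _ ⊗≫ A ◁ (β_ B A).hom ▷ (B ⊗ (A ⊗ B)) ⊗≫ (A ⊗ A) ◁ adjointCrossing Ψ ▷ B ⊗≫
        ((A ⊗ A) ◁ A ◁ μ[B] ⊗≫ μ[A] ▷ (A ⊗ B) ⊗≫ μ[A] ▷ B) := by
      rw [h₂]; monoidal
    _ = _ := by
      rw [← mul_mul_tensor_mul, bilinearExtension]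

end

end

end CategoryTheory

namespace HopfTuple

variable {C : Type u} [Category.{v} C] [MonoidalCategory C] [SymmetricCategory C]
theorem gamma_eq {C : Type u} [Category.{v} C] [MonoidalCategory C] {X : C} (A₁ A₂ : HopfTuple X) :
    gamma A₁ A₂ = A₁.comul ▷ X ≫ (α_ X X X).hom ≫ (A₁.antipode ⊗ₘ A₂.mul) ≫ A₁.mul := by
  rw [gamma]; monoidal

section

variable {C : Type u} [Category.{v} C] [MonoidalCategory C] {X Y : C}

/-- Together with its tensor version, names the coherence isomorphisms, so that the brace equation
for an arbitrary object can be compared with its instance at a tensor product. -/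
theorem whiskerRight_whiskerLeft_eq (f : X ⟶ X ⊗ X) (g : X ⊗ X ⟶ X ⊗ X)
    (k : (X ⊗ X) ⊗ (X ⊗ X) ⟶ X) :
    f ▷ (X ⊗ X) ⊗≫ X ◁ g ▷ X ⊗≫ k = f ▷ (X ⊗ X) ≫ (α_ X X (X ⊗ X)).hom ≫
      X ◁ ((α_ X X X).inv ≫ g ▷ X ≫ (α_ X X X).hom) ≫ (α_ X X (X ⊗ X)).inv ≫ k := by
  monoidal

theorem whiskerRight_whiskerLeft_tensor_eq (f : X ⊗ Y ⟶ (X ⊗ Y) ⊗ (X ⊗ Y))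
    (g : (X ⊗ Y) ⊗ (X ⊗ Y) ⟶ (X ⊗ Y) ⊗ (X ⊗ Y))
    (k : ((X ⊗ Y) ⊗ (X ⊗ Y)) ⊗ ((X ⊗ Y) ⊗ (X ⊗ Y)) ⟶ X ⊗ Y) :
    f ▷ ((X ⊗ Y) ⊗ (X ⊗ Y)) ⊗≫ (X ⊗ Y) ◁ g ▷ (X ⊗ Y) ⊗≫ k =
      f ▷ ((X ⊗ Y) ⊗ (X ⊗ Y)) ≫ (α_ _ _ _).hom ≫
        (X ⊗ Y) ◁ ((α_ _ _ _).inv ≫ g ▷ (X ⊗ Y) ≫ (α_ _ _ _).hom) ≫ (α_ _ _ _).inv ≫ k := by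
  monoidal

end

variable {A B : C} [HopfObj A] [HopfObj B]

/-- Both sides of the compatibility are bilinear extensions, and `bilinearExtension_injective`
strips the spectators. The remaining brace axioms hold because the two structures share their
coalgebra and are Hopf algebras. -/
theorem isHopfBrace_bicrossed_tensor_iff (φ : B ⊗ A ⟶ A) (ψ : B ⊗ A ⟶ B)
    (hD : (bicrossed (of A) (of B) φ ψ).IsHopf)
    (h : IsDistributiveLaw (crossing (of A) (of B) φ ψ)) :
    IsHopfBrace (bicrossed (of A) (of B) φ ψ) (tensor (of A) (of B)) ↔
      crossingMulLeft (crossing (of A) (of B) φ ψ) =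
        adjointCrossing (crossing (of A) (of B) φ ψ) := by
  rw [← bilinearExtension_injective.eq_iff, ← whiskerLeft_bicrossedMul_braiding,
    ← bicrossedMul_gamma h, ← gamma_bicrossed h]
  have e₁ : gamma (bicrossed (of A) (of B) φ ψ) (tensor (of A) (of B)) =
      ((Δ[A] ⊗ₘ Δ[B]) ⊗≫ A ◁ (β_ A B).hom ▷ B ⊗≫ 𝟙 ((A ⊗ B) ⊗ (A ⊗ B))) ▷ (A ⊗ B) ⊗≫
        ((β_ A B).hom ≫ (𝒮[B] ⊗ₘ 𝒮[A]) ≫ crossing (of A) (of B) φ ψ ⊗ₘ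
          bicrossedMul (β_ B A).hom) ≫ bicrossedMul (crossing (of A) (of B) φ ψ) :=
    (gamma_eq _ _).trans (by
      change ((Δ[A] ⊗ₘ Δ[B]) ⊗≫ A ◁ (β_ A B).hom ▷ B ⊗≫ 𝟙 ((A ⊗ B) ⊗ (A ⊗ B))) ▷ (A ⊗ B) ≫
        (α_ _ _ _).hom ≫ ((β_ A B).hom ≫ (𝒮[B] ⊗ₘ 𝒮[A]) ≫ crossing (of A) (of B) φ ψ ⊗ₘ
          bicrossedMul (β_ B A).hom) ≫ bicrossedMul (crossing (of A) (of B) φ ψ) = _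
      generalize (_ ⊗ₘ bicrossedMul (β_ B A).hom) ≫ bicrossedMul _ = k
      monoidal)
  rw [← e₁]
  rw [whiskerRight_whiskerLeft_tensor_eq, ← whiskerRight_whiskerLeft_eq]
  exact ⟨fun e => e.compat, fun e => ⟨hD, isHopf_tensor, rfl, rfl, e⟩⟩

end HopfTuple

/-! ### Translation of the crossing identity into the identity for `J`. -/

namespace DrinfeldDouble

variable {C : Type u} [Category.{v} C] [MonoidalCategory C] [SymmetricCategory C]
variable (H Hd : C) [HopfObj H] [IsIso 𝒮[H]] [ExactPairing Hd H]

/-- Pairing the `Hd` leg with `x` replaces `Ψ(k ⊗ p)` by `J(x ⊗ k)` paired with `p`; the factor `h`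
then multiplies the first leg of `J`. -/
theorem crossingMulLeft_evaluation :
    letI := dualCopHopfObj H Hd
    H ◁ crossingMulLeft (doubleCrossing H Hd) ≫ (α_ _ _ _).inv ≫ ε_ Hd H ▷ H =
      ((H ◁ (α_ H H Hd).inv ≫ (α_ _ _ _).inv) ≫
        (𝟙 (H ⊗ (H ⊗ H)) ⊗≫ (β_ H H).hom ▷ H ⊗≫ H ◁ J H ⊗≫ μ[H] ▷ H) ▷ Hd ≫
        (α_ _ _ _).hom ≫ H ◁ ε_ Hd H) ≫ (ρ_ H).hom ≫ (λ_ H).inv := by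
  have hJ := whiskerLeft_doubleCrossing_evaluation H Hd
  rw [crossingMulLeft]
  generalize doubleCrossing H Hd = Ψ at *
  calc _ = H ◁ H ◁ Ψ ⊗≫ H ◁ (β_ H Hd).hom ▷ H ⊗≫ ((H ⊗ Hd) ◁ μ[H] ≫ ε_ Hd H ▷ H) := by monoidal
    _ = H ◁ H ◁ Ψ ⊗≫ (H ◁ (β_ H Hd).hom ⊗≫ ε_ Hd H ▷ H ⊗≫ 𝟙 H) ▷ H ⊗≫ μ[H] ⊗≫ 𝟙 _ := by
      rw [whisker_exchange]; monoidal
    _ = 𝟙 _ ⊗≫ ((H ⊗ H) ◁ Ψ ≫ (β_ H H).hom ▷ (Hd ⊗ H)) ⊗≫ H ◁ (ε_ Hd H ▷ H ⊗≫ 𝟙 H) ≫ μ[H] ⊗≫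
        𝟙 _ := by
      rw [whiskerLeft_braiding_pairing]; monoidal
    _ = 𝟙 _ ⊗≫ (β_ H H).hom ▷ (H ⊗ Hd) ⊗≫ H ◁ (H ◁ Ψ ⊗≫ ε_ Hd H ▷ H ⊗≫ 𝟙 H) ≫ μ[H] ⊗≫
        𝟙 _ := by
      rw [whisker_exchange]; monoidal
    _ = 𝟙 _ ⊗≫ (β_ H H).hom ▷ (H ⊗ Hd) ⊗≫ H ◁ J H ▷ Hd ⊗≫ ((H ⊗ H) ◁ ε_ Hd H ≫
        μ[H] ▷ 𝟙_ C) ⊗≫ 𝟙 _ := by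
      rw [hJ]; monoidal
    _ = _ := by rw [whisker_exchange]; monoidal

/-- As in `crossingMulLeft_evaluation`, now with `J(x ⊗ h₁ k S(h₂))` and `h₃` multiplying its first
leg from the right. -/
theorem adjointCrossing_evaluation :
    letI := dualCopHopfObj H Hd
    H ◁ adjointCrossing (doubleCrossing H Hd) ≫ (α_ _ _ _).inv ≫ ε_ Hd H ▷ H =
      ((H ◁ (α_ H H Hd).inv ≫ (α_ _ _ _).inv) ≫
        (H ◁ (Δ[H] ▷ H ⊗≫ H ◁ (β_ H H).hom ⊗≫ adjointAction H ▷ H) ⊗≫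
            J H ▷ H ⊗≫ H ◁ (β_ H H).hom ⊗≫ μ[H] ▷ H) ▷ Hd ≫
        (α_ _ _ _).hom ≫ H ◁ ε_ Hd H) ≫ (ρ_ H).hom ≫ (λ_ H).inv := by
  have hJ := whiskerLeft_doubleCrossing_evaluation H Hd
  rw [adjointCrossing]
  generalize doubleCrossing H Hd = Ψ at *
  generalize Δ[H] ▷ H ⊗≫ H ◁ (β_ H H).hom ⊗≫ adjointAction H ▷ H = P
  calc _ = 𝟙 _ ⊗≫ H ◁ P ▷ Hd ⊗≫ H ◁ H ◁ (β_ H Hd).hom ⊗≫ H ◁ Ψ ▷ H ⊗≫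
        ((H ⊗ Hd) ◁ μ[H] ≫ ε_ Hd H ▷ H) := by monoidal
    _ = 𝟙 _ ⊗≫ H ◁ P ▷ Hd ⊗≫ H ◁ H ◁ (β_ H Hd).hom ⊗≫
        (H ◁ Ψ ⊗≫ ε_ Hd H ▷ H ⊗≫ 𝟙 H) ▷ H ⊗≫ μ[H] ⊗≫ 𝟙 _ := by
      rw [whisker_exchange]; monoidal
    _ = 𝟙 _ ⊗≫ H ◁ P ▷ Hd ⊗≫ ((H ⊗ H) ◁ (β_ H Hd).hom ≫ J H ▷ (Hd ⊗ H)) ⊗≫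
        H ◁ (ε_ Hd H ▷ H ⊗≫ 𝟙 H) ⊗≫ μ[H] ⊗≫ 𝟙 _ := by
      rw [hJ]; monoidal
    _ = 𝟙 _ ⊗≫ H ◁ P ▷ Hd ⊗≫ J H ▷ (H ⊗ Hd) ⊗≫
        H ◁ (H ◁ (β_ H Hd).hom ⊗≫ ε_ Hd H ▷ H ⊗≫ 𝟙 H) ⊗≫ μ[H] ⊗≫ 𝟙 _ := by
      rw [whisker_exchange]; monoidal
    _ = 𝟙 _ ⊗≫ H ◁ P ▷ Hd ⊗≫ J H ▷ (H ⊗ Hd) ⊗≫ H ◁ (β_ H H).hom ▷ Hd ⊗≫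
        ((H ⊗ H) ◁ ε_ Hd H ≫ μ[H] ▷ 𝟙_ C) ⊗≫ 𝟙 _ := by
      rw [whiskerLeft_braiding_pairing]; monoidal
    _ = _ := by rw [whisker_exchange]; monoidal

/-- The exact pairing is nondegenerate on both sides: testing the output leg in `Hd` against `H`
loses nothing, and neither does testing a leg in `H` against the input `Hd`. -/
theorem crossingMulLeft_eq_adjointCrossing_iff :
    letI := dualCopHopfObj H Hd
    crossingMulLeft (doubleCrossing H Hd) = adjointCrossing (doubleCrossing H Hd) ↔
      H ◁ (Δ[H] ▷ H ⊗≫ H ◁ (β_ H H).hom ⊗≫ adjointAction H ▷ H) ⊗≫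
          J H ▷ H ⊗≫ H ◁ (β_ H H).hom ⊗≫ μ[H] ▷ H =
        𝟙 (H ⊗ (H ⊗ H)) ⊗≫ (β_ H H).hom ▷ H ⊗≫ H ◁ J H ⊗≫ μ[H] ▷ H := by
  have h₁ := crossingMulLeft_evaluation H Hd
  have h₂ := adjointCrossing_evaluation H Hd
  constructor
  · intro e
    rw [← e, h₁, cancel_mono, cancel_epi] at h₂
    exact ExactPairing.hom_ext_right h₂.symm
  · intro e
    apply ExactPairing.hom_ext_tensor (X := H)
    rw [h₁, h₂, e]

end DrinfeldDouble

end

theorem corollary2p18 {C : Type u} [Category.{v} C] [MonoidalCategory C] [SymmetricCategory C]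
    (H Hd : C) [HopfObj H] [ExactPairing Hd H] :
    ∃ _ : IsIso 𝒮[H],
      HopfTuple.IsHopfBrace (DrinfeldDouble.D H Hd) (DrinfeldDouble.T H Hd) ↔
        H ◁ (Δ[H] ▷ H ⊗≫ H ◁ (β_ H H).hom ⊗≫ DrinfeldDouble.adjointAction H ▷ H) ⊗≫
            DrinfeldDouble.J H ▷ H ⊗≫ H ◁ (β_ H H).hom ⊗≫ μ[H] ▷ H =
          𝟙 (H ⊗ (H ⊗ H)) ⊗≫ (β_ H H).hom ▷ H ⊗≫ H ◁ DrinfeldDouble.J H ⊗≫ μ[H] ▷ H := by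
  refine ⟨isIso_antipode H Hd, ?_⟩
  have := isIso_antipode H Hd
  let inst := DrinfeldDouble.dualCopHopfObj H Hd
  have hD := DrinfeldDouble.isHopf_D H Hd
  have hc := DrinfeldDouble.crossing_eq H Hd
  have hd := (DrinfeldDouble.isHopfPairing_evaluation H Hd).isDistributiveLaw
  rw [← DrinfeldDouble.crossingMulLeft_eq_adjointCrossing_iff H Hd]
  rw [DrinfeldDouble.D, DrinfeldDouble.dualCop_eq_of] at hD
  rw [DrinfeldDouble.D, DrinfeldDouble.T, DrinfeldDouble.dualCop_eq_of,
    HopfTuple.isHopfBrace_bicrossed_tensor_iff _ _ hD (by rw [hc]; exact hd), hc]
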